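/- Let $H$ be a separable complex Hilbert space and let $\Gamma$ be a positive, unbounded self-adjoint operator on $H$ with discrete spectrum: there are eigenvalues $0<\lambda_1\le\lambda_2\le\dots$, $\lambda_j\to\infty$ (repeated according to multiplicity), and an orthonormal basis $(e_j)$ of $H$ with $\Gamma e_j=\lambda_j e_j$. Let $H^1(\Gamma)$ be the space of all $\psi=\sum_j c_je_j\in H$ with $\|\psi\|_1^2:=\sum_j\lambda_j|c_j|^2<\infty$. Let $(L(t))_{t\in\mathbb R}$ be a family of self-adjoint operators on $H$ with $L(t+1)=L(t)$ for all $t$, satisfying (Condition 1) there is $C_0<\infty$ such that for every $t\in\mathbb R$ we have $H^1(\Gamma)\subset D(L(t))$ and $\|L(t)\psi\|\le C_0\|\psi\|_1$ for all $\psi\in H^1(\Gamma)$. Assume that $L(t)$ generates a strongly continuous family $(U(t))_{t\in\mathbb R}$ of unitary operators on $H$, that is, for each $\psi_0\in H$ the continuous function $\psi(t)=U(t)\psi_0$ is a weak solution of $\psi'(t)=iL(t)\psi(t)$, $\psi(0)=\psi_0$: for every $\chi\in H^1(\Gamma)$ the function $t\mapsto\langle\psi(t),\chi\rangle$ is locally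 absolutely continuous with derivative $i\langle\psi(t),L(t)\chi\rangle$ for a.e. $t$ (the inner product being linear in its first argument). Put $U(t,s)=U(t)U(s)^*$ and $V=U(1)$, and assume (Condition 2) there is $B\in L^\infty_{\rm loc}(\mathbb R)$ such that for all $t,s\in\mathbb R$ and all $\psi\in H^1(\Gamma)$ we have $U(t,s)\psi\in H^1(\Gamma)$ and $\|U(t,s)\psi\|_1\le B(t-s)\|\psi\|_1$. For $A>0$ and $\phi_0\in H$, a solution of $$\frac{d}{dt}\phi^A(t)=iAL(At)\phi^A(t)-\Gamma\phi^A(t),\qquad \phi^A(0)=\phi_0,$$ means a function $\phi^A\in C([0,\infty),H)$ with $\phi^A\in L^2([0,T],H^1(\Gamma))$ for all $T>0$ which satisfies the initial condition, and the equation in the weak sense: for every $\chi\in D(\Gamma)$ the function $t\mapsto\langle\phi^A(t),\chi\rangle$ is locally absolutely continuous on $[0,\infty)$ with derivative $iA\langle L(At)\phi^A(t),\chi\rangle-\langle\phi^A(t),\Gamma\chi\rangle$ for a.e. $t$. The family $L(t)$ is called relaxation-enhancing with respect to $\Gamma$ if for all $\tau,\delta>0$ there is $A_0>0$ such that for every $A>A_0$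 and every $\phi_0\in H$ with $\|\phi_0\|=1$ the solution $\phi^A$ exists and satisfies $\|\phi^A(\tau)\|<\delta$. Then $L(t)$ is relaxation-enhancing with respect to $\Gamma$ if and only if $V$ has no eigenvector in $H^1(\Gamma)$, i.e. there are no $\mu\in\mathbb C$ and $0\ne\psi\in H^1(\Gamma)$ with $V\psi=\mu\psi$. -/

import Mathlib

open MeasureTheory Filter Set
open scoped ENNReal Topology

namespace RelaxationEnhancement

noncomputable section

variable {H : Type*} [NormedAddCommGroup H] [InnerProductSpace ℂ H] [CompleteSpace H]

/-- The value `T x` of a partially defined operator, for `x` in its domain. Outside the domain the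
value is `0`; every use below is at vectors that the hypotheses place in the domain. -/
def opApply (T : H →ₗ.[ℂ] H) (x : H) : H := by
  classical exact if h : x ∈ T.domain then T ⟨x, h⟩ else 0

/-- `lam 0 ≤ lam 1 ≤ …` are the eigenvalues of `Γ`, repeated according to multiplicity, and the
orthonormal basis `e` consists of corresponding eigenvectors. The operator is positive
(`0 < lam 0`). Discreteness of the spectrum (eigenvalues of finite multiplicity without finite
accumulation point) is `lam j → ∞`, which also contains the unboundedness of `Γ`. -/
structure IsEigenbasis (Γ : H →ₗ.[ℂ] H) (e : HilbertBasis ℕ ℂ H) (lam : ℕ → ℝ) : Prop where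
  pos : 0 < lam 0
  mono : Monotone lam
  tendsto : Tendsto lam atTop atTop
  eigen : ∀ j, ∃ h : e j ∈ Γ.domain, Γ ⟨e j, h⟩ = (lam j : ℂ) • e j

/-- Membership in the Sobolev space `H¹(Γ)`: for `ψ = ∑ c_j e_j`, the sum `∑ lam j |c_j|²` is
finite. -/
def MemH1 (e : HilbertBasis ℕ ℂ H) (lam : ℕ → ℝ) (ψ : H) : Prop :=
  Summable fun j => lam j * ‖e.repr ψ j‖ ^ 2

/-- The norm `‖ψ‖₁ = (∑ lam j |c_j|²)^{1/2}` of `H¹(Γ)`. -/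
def norm1 (e : HilbertBasis ℕ ℂ H) (lam : ℕ → ℝ) (ψ : H) : ℝ :=
  √(∑' j, lam j * ‖e.repr ψ j‖ ^ 2)

/-- Condition 1: every `L(t)` is defined on `H¹(Γ)`, and `‖L(t)ψ‖ ≤ C₀ ‖ψ‖₁` there, with `C₀`
independent of `t` and `ψ`. -/
def Condition1 (e : HilbertBasis ℕ ℂ H) (lam : ℕ → ℝ) (L : ℝ → H →ₗ.[ℂ] H) : Prop :=
  ∃ C₀ : ℝ, ∀ t : ℝ, ∀ ψ : H, MemH1 e lam ψ →
    ψ ∈ (L t).domain ∧ ‖opApply (L t) ψ‖ ≤ C₀ * norm1 e lam ψ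

/-- `ψ : ℝ → H` is a (continuous) weak solution of `ψ' = i L(t) ψ`, `ψ(0) = ψ₀`: for each test
vector `χ ∈ H¹(Γ)` the function `⟨χ, ψ(t)⟩` is locally absolutely continuous with derivative
`i ⟨L(t)χ, ψ(t)⟩` almost everywhere. -/
structure IsWeakSolution (e : HilbertBasis ℕ ℂ H) (lam : ℕ → ℝ) (L : ℝ → H →ₗ.[ℂ] H)
    (ψ₀ : H) (ψ : ℝ → H) : Prop where
  continuous : Continuous ψ
  initial : ψ 0 = ψ₀
  integrable : ∀ χ : H, MemH1 e lam χ → ∀ t : ℝ,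
    IntervalIntegrable (fun s => Complex.I * inner ℂ (opApply (L s) χ) (ψ s)) volume 0 t
  equation : ∀ χ : H, MemH1 e lam χ → ∀ t : ℝ,
    inner ℂ χ (ψ t) = inner ℂ χ ψ₀ +
      ∫ s in (0 : ℝ)..t, Complex.I * inner ℂ (opApply (L s) χ) (ψ s)

/-- The family `L(t)` generates the strongly continuous unitary evolution `U(t)`: for every
`ψ₀ ∈ H`, `U(t)ψ₀` is a weak solution of `ψ' = i L(t) ψ`, `ψ(0) = ψ₀`. -/
def Generates (e : HilbertBasis ℕ ℂ H) (lam : ℕ → ℝ) (L : ℝ → H →ₗ.[ℂ] H)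
    (U : ℝ → H ≃ₗᵢ[ℂ] H) : Prop :=
  ∀ ψ₀ : H, IsWeakSolution e lam L ψ₀ (fun t => U t ψ₀)

/-- The two-parameter propagator `U(t,s) = U(t) U(s)^*`. -/
def propagator (U : ℝ → H ≃ₗᵢ[ℂ] H) (t s : ℝ) : H ≃ₗᵢ[ℂ] H := (U s).symm.trans (U t)

/-- Condition 2: `‖U(t,s)ψ‖₁ ≤ B(t-s) ‖ψ‖₁` on `H¹(Γ)`, with `B` locally (essentially) bounded. -/
def Condition2 (e : HilbertBasis ℕ ℂ H) (lam : ℕ → ℝ) (U : ℝ → H ≃ₗᵢ[ℂ] H) : Prop :=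
  ∃ B : ℝ → ℝ, (∀ K : Set ℝ, IsCompact K → MemLp B ∞ (volume.restrict K)) ∧
    ∀ t s : ℝ, ∀ ψ : H, MemH1 e lam ψ →
      MemH1 e lam (propagator U t s ψ) ∧
        norm1 e lam (propagator U t s ψ) ≤ B (t - s) * norm1 e lam ψ

/-- `φ` is a solution on `[0,∞)` of `φ' = i A L(At) φ - Γ φ`, `φ(0) = φ₀`, for general `φ₀ ∈ H`:
`φ ∈ C([0,∞), H) ∩ L²([0,T], H¹(Γ))` for all `T`, and the equation holds in the weak sense (that is,
in the dual of `H¹(Γ)`), tested against the domain of `Γ` and integrated in time. -/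
structure IsSolution (Γ : H →ₗ.[ℂ] H) (e : HilbertBasis ℕ ℂ H) (lam : ℕ → ℝ)
    (L : ℝ → H →ₗ.[ℂ] H) (A : ℝ) (φ₀ : H) (φ : ℝ → H) : Prop where
  continuousOn : ContinuousOn φ (Ici 0)
  initial : φ 0 = φ₀
  memH1 : ∀ᵐ t ∂(volume.restrict (Ioi (0 : ℝ))), MemH1 e lam (φ t)
  normSq_integrable : ∀ T : ℝ, 0 < T → IntegrableOn (fun t => norm1 e lam (φ t) ^ 2) (Ioc 0 T)
  integrable : ∀ χ : Γ.domain, ∀ t : ℝ, 0 ≤ t →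
    IntervalIntegrable (fun s => Complex.I * (A : ℂ) *
      inner ℂ (χ : H) (opApply (L (A * s)) (φ s)) - inner ℂ (Γ χ) (φ s)) volume 0 t
  equation : ∀ χ : Γ.domain, ∀ t : ℝ, 0 ≤ t →
    inner ℂ (χ : H) (φ t) = inner ℂ (χ : H) φ₀ +
      ∫ s in (0 : ℝ)..t, (Complex.I * (A : ℂ) *
        inner ℂ (χ : H) (opApply (L (A * s)) (φ s)) - inner ℂ (Γ χ) (φ s))

/-- The family `L(t)` is relaxation-enhancing with respect to `Γ`: for all `τ, δ > 0` there is
`A₀ > 0` such that for all `A > A₀` and all unit vectors `φ₀`, the solution `φ` of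
`φ' = i A L(At) φ - Γ φ`, `φ(0) = φ₀` (it exists, and whichever solution one takes) satisfies
`‖φ(τ)‖ < δ`. -/
def RelaxationEnhancing (Γ : H →ₗ.[ℂ] H) (e : HilbertBasis ℕ ℂ H) (lam : ℕ → ℝ)
    (L : ℝ → H →ₗ.[ℂ] H) : Prop :=
  ∀ τ δ : ℝ, 0 < τ → 0 < δ → ∃ A₀ : ℝ, 0 < A₀ ∧ ∀ A : ℝ, A₀ < A → ∀ φ₀ : H, ‖φ₀‖ = 1 →
    (∃ φ : ℝ → H, IsSolution Γ e lam L A φ₀ φ) ∧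
      ∀ φ : ℝ → H, IsSolution Γ e lam L A φ₀ φ → ‖φ τ‖ < δ

end

end RelaxationEnhancement

namespace RelaxationEnhancement

variable {H : Type*} [NormedAddCommGroup H] [InnerProductSpace ℂ H]

/-! ### Coordinates in the eigenbasis and spectral truncations -/

section Coordinates

variable (e : HilbertBasis ℕ ℂ H)

/-! Everything rests on one pairing identity (`IsTraj.inner_sub_inner`). If `x` and `y` solve `x' =
iTx - κΓx` and `y' = iTy - κ'Γy` with the same symmetric `T`, then the drift drops out and `⟨x,y⟩' =
-(κ+κ')⟨Γ^{1/2}x, Γ^{1/2}y⟩`. With `x = y` and `κ = 1` this is the energy identity, so `∫‖φ‖₁² ≤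
‖φ(0)‖²/2` whatever the amplitude `A`.

Eigenvector prevents enhancement. If `Vψ = μψ` with `ψ ∈ H¹` a unit vector, periodicity and
Condition 2 keep the free trajectory `U(At)ψ` bounded in `H¹`, uniformly in `A` and `t ≥ 0`. Pairing
it with the dissipative solution started at `ψ`, the overlap loses at most `∫‖U(As)ψ‖₁‖φ(s)‖₁ ds`.
This is small for small `τ`, uniformly in `A`, so `‖φ(τ)‖` stays away from 0.

No eigenvector forces enhancement. Otherwise there are `Aₙ → ∞` and solutions `φₙ` with `‖φₙ(τ)‖ ≥
δ`; as norms decrease, `δ ≤ ‖φₙ(t)‖ ≤ 1` on `(0,τ]`. Pull `φₙ(t)` back to the start of the current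
period of the free evolution to get `wₙ(t)`. The energy identity and Condition 2 bound `∫‖wₙ‖₁²`,
and over one period, of length `1/Aₙ`, `wₙ` moves by `V` up to `O(Aₙ^{-1/2}‖φₙ(t)‖₁)`. Hence the
covariance operators `∫ wₙ ⊗ wₙ*` become `V`-invariant in the limit. Since `λ_j → ∞`, the `H¹` bound
acts as tightness: a weak limit `T` is compact, symmetric, nonzero, has range in `H¹` and commutes
with `V`. An eigenspace of `T` for a nonzero eigenvalue is finite-dimensional, lies in `H¹` and is
invariant under `V`, so `V` has an eigenvector in it
(`exists_eigenvector_of_asymptotically_invariant`).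

Existence of solutions comes from a Dyson series around `exp(-tΓ)`. The drift costs one factor
`Γ^{1/2}`, and the Duhamel integral regains it by mapping `L²` in time with values in `H` into
bounded functions with values in `H¹`; iteration gives factorial decay. Uniqueness is not needed,
since the decay estimate is proved for every solution. -/

theorem hasSum_norm_repr_sq (x : H) : HasSum (fun j => ‖e.repr x j‖ ^ 2) (‖x‖ ^ 2) := by
  have h := e.hasSum_inner_mul_inner x x
  have h2 := Complex.hasSum_re h
  have e1 : ‖x‖ ^ 2 = (inner ℂ x x : ℂ).re := by
    rw [inner_self_eq_norm_sq_to_K]; norm_cast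
  rw [e1]
  convert h2 using 2 with j
  rw [← e.repr_apply_apply, ← inner_conj_symm, ← e.repr_apply_apply, Complex.conj_mul']
  norm_cast

theorem norm_repr_le (x : H) (j : ℕ) : ‖e.repr x j‖ ≤ ‖x‖ := by
  rw [e.repr_apply_apply]
  simpa [e.orthonormal.1 j] using norm_inner_le_norm (𝕜 := ℂ) (e j) x

theorem ext_repr {x y : H} (h : ∀ j, e.repr x j = e.repr y j) : x = y :=
  e.repr.injective (lp.ext (funext h))

/-- The orthogonal projection onto the span of the first `N` basis vectors. -/
noncomputable def proj (N : ℕ) : H →L[ℂ] H :=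
  ∑ j ∈ Finset.range N, (innerSL ℂ (e j)).smulRight (e j)

theorem proj_apply (N : ℕ) (x : H) :
    proj e N x = ∑ j ∈ Finset.range N, e.repr x j • e j := by
  simp [proj, e.repr_apply_apply]

theorem inner_proj_left (N : ℕ) (x y : H) :
    inner ℂ (proj e N x) y =
      ∑ j ∈ Finset.range N, starRingEnd ℂ (e.repr x j) * e.repr y j := by
  rw [proj_apply, sum_inner]
  refine Finset.sum_congr rfl fun j _ => ?_
  rw [inner_smul_left, e.repr_apply_apply y]

theorem inner_proj_right (N : ℕ) (x y : H) :
    inner ℂ x (proj e N y) =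
      ∑ j ∈ Finset.range N, starRingEnd ℂ (e.repr x j) * e.repr y j := by
  rw [proj_apply, inner_sum]
  refine Finset.sum_congr rfl fun j _ => ?_
  rw [inner_smul_right, mul_comm, e.repr_apply_apply x, inner_conj_symm]

theorem repr_proj (N : ℕ) (x : H) (j : ℕ) :
    e.repr (proj e N x) j = if j < N then e.repr x j else 0 := by
  classical
  rw [e.repr_apply_apply, inner_proj_right]
  by_cases h : j < N <;>
    simp [e.repr_self, lp.single_apply, Pi.single_apply, apply_ite, h]

theorem tendsto_proj (x : H) : Tendsto (fun N => proj e N x) atTop (𝓝 x) := by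
  simp only [proj_apply]
  exact (e.hasSum_repr x).tendsto_sum_nat

theorem norm_proj_le (N : ℕ) (x : H) : ‖proj e N x‖ ≤ ‖x‖ := by
  refine (sq_le_sq₀ (norm_nonneg _) (norm_nonneg _)).1 ?_
  refine hasSum_le (fun j => ?_) (hasSum_norm_repr_sq e _) (hasSum_norm_repr_sq e x)
  rw [repr_proj]
  split_ifs <;> simp

/-- The vector with prescribed coordinates (and `0` if these are not square summable). -/
noncomputable def ofCoords (c : ℕ → ℂ) : H := by
  classical exact if h : Memℓp c 2 then e.repr.symm ⟨c, h⟩ else 0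

variable {e}

theorem repr_ofCoords {c : ℕ → ℂ} (h : Summable fun j => ‖c j‖ ^ 2) (j : ℕ) :
    e.repr (ofCoords e c) j = c j := by
  have h' : Memℓp c 2 := memℓp_gen (by simpa using h)
  rw [ofCoords, dif_pos h', LinearIsometryEquiv.apply_symm_apply]

/-- The countable basis reduces strong measurability to scalar coordinates: the truncations are
finite sums and converge pointwise. -/
theorem aestronglyMeasurable_of_repr {α : Type*} [MeasurableSpace α] {μ : Measure α} {f : α → H}
    (h : ∀ j, AEStronglyMeasurable (fun t => e.repr (f t) j) μ) : AEStronglyMeasurable f μ := by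
  refine aestronglyMeasurable_of_tendsto_ae atTop (f := fun N t => proj e N (f t))
    (fun N => ?_) (ae_of_all _ fun t => tendsto_proj e (f t))
  simp only [proj_apply]
  exact Finset.aestronglyMeasurable_fun_sum _ fun j _ => (h j).smul_const _

theorem _root_.MeasureTheory.AEStronglyMeasurable.repr {α : Type*} [MeasurableSpace α]
    {μ : Measure α} {f : α → H} (h : AEStronglyMeasurable f μ) (j : ℕ) :
    AEStronglyMeasurable (fun t => e.repr (f t) j) μ := by
  simp only [e.repr_apply_apply]
  exact (innerSL ℂ (e j)).continuous.comp_aestronglyMeasurable h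

end Coordinates

/-! ### The space `H¹` and the square root of the generator -/

section Sobolev

variable (e : HilbertBasis ℕ ℂ H) (lam : ℕ → ℝ)

/-- The vector `Γ^{1/2} x` (only meaningful on `H¹(Γ)`). -/
noncomputable def sqrtGen (x : H) : H := ofCoords e fun j => (√(lam j) : ℂ) * e.repr x j

variable {e lam}

theorem norm_sqrt_mul_sq (hlam : ∀ j, 0 < lam j) (c : ℕ → ℂ) (j : ℕ) :
    ‖(√(lam j) : ℂ) * c j‖ ^ 2 = lam j * ‖c j‖ ^ 2 := by
  rw [norm_mul, mul_pow, Complex.norm_real, Real.norm_of_nonneg (Real.sqrt_nonneg _),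
    Real.sq_sqrt (hlam j).le]

theorem repr_sqrtGen (hlam : ∀ j, 0 < lam j) {x : H} (hx : MemH1 e lam x) (j : ℕ) :
    e.repr (sqrtGen e lam x) j = (√(lam j) : ℂ) * e.repr x j :=
  repr_ofCoords (by simp only [norm_sqrt_mul_sq hlam]; exact hx) j

theorem norm_sqrtGen (hlam : ∀ j, 0 < lam j) {x : H} (hx : MemH1 e lam x) :
    ‖sqrtGen e lam x‖ = norm1 e lam x := by
  have h := hasSum_norm_repr_sq e (sqrtGen e lam x)
  simp only [repr_sqrtGen hlam hx, norm_sqrt_mul_sq hlam] at h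
  rw [norm1, h.tsum_eq, Real.sqrt_sq (norm_nonneg _)]

theorem norm1_nonneg (x : H) : 0 ≤ norm1 e lam x := Real.sqrt_nonneg _

theorem hasSum_norm1_sq (hlam : ∀ j, 0 < lam j) {x : H} (hx : MemH1 e lam x) :
    HasSum (fun j => lam j * ‖e.repr x j‖ ^ 2) (norm1 e lam x ^ 2) := by
  rw [norm1, Real.sq_sqrt (tsum_nonneg fun j => mul_nonneg (hlam j).le (sq_nonneg _))]
  exact hx.hasSum

/-- Converse to `norm_sqrtGen`: a vector `z` playing the role of `Γ^{1/2}x` certifies `x ∈ H¹`. This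
is how sums of series are shown to lie in `H¹`. -/
theorem memH1_of_repr {x z : H} (hlam : ∀ j, 0 < lam j)
    (h : ∀ j, e.repr z j = (√(lam j) : ℂ) * e.repr x j) :
    MemH1 e lam x ∧ norm1 e lam x = ‖z‖ := by
  have hz := hasSum_norm_repr_sq e z
  simp only [h, norm_sqrt_mul_sq hlam] at hz
  exact ⟨hz.summable, by rw [norm1, hz.tsum_eq, Real.sqrt_sq (norm_nonneg _)]⟩

theorem memH1_basis (j : ℕ) : MemH1 e lam (e j) := by
  classical
  refine summable_of_ne_finset_zero (s := {j}) fun k hk => ?_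
  simp only [Finset.mem_singleton] at hk
  simp [e.repr_self, lp.single_apply, hk]

theorem memH1_smul (c : ℂ) {x : H} (hx : MemH1 e lam x) : MemH1 e lam (c • x) := by
  refine (hx.mul_left (‖c‖ ^ 2)).congr fun j => ?_
  simp only [map_smul, lp.coeFn_smul, Pi.smul_apply, norm_smul]
  ring

theorem norm1_smul (c : ℂ) (x : H) : norm1 e lam (c • x) = ‖c‖ * norm1 e lam x := by
  rw [norm1, norm1, ← Real.sqrt_sq (norm_nonneg c), ← Real.sqrt_mul (sq_nonneg _), ← tsum_mul_left]
  congr 2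
  ext j
  simp only [map_smul, lp.coeFn_smul, Pi.smul_apply, norm_smul]
  ring

theorem inner_proj_sqrtGen (hlam : ∀ j, 0 < lam j) {x y : H} (hx : MemH1 e lam x)
    (hy : MemH1 e lam y) (N : ℕ) :
    inner ℂ (proj e N (sqrtGen e lam x)) (sqrtGen e lam y) =
      ∑ j ∈ Finset.range N, (lam j : ℂ) * (starRingEnd ℂ (e.repr x j) * e.repr y j) := by
  rw [inner_proj_left]
  refine Finset.sum_congr rfl fun j _ => ?_
  rw [repr_sqrtGen hlam hx, repr_sqrtGen hlam hy, map_mul, Complex.conj_ofReal]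
  have : (lam j : ℂ) = (√(lam j) : ℂ) * √(lam j) := by
    rw [← Complex.ofReal_mul, Real.mul_self_sqrt (hlam j).le]
  rw [this]; ring

/-- The tail of an `H¹` vector is controlled by its `H¹` norm. -/
theorem norm_sub_proj_sq_le (hlam : ∀ j, 0 < lam j) (hmono : Monotone lam) {x : H}
    (hx : MemH1 e lam x) (N : ℕ) :
    lam N * ‖x - proj e N x‖ ^ 2 ≤ norm1 e lam x ^ 2 := by
  refine hasSum_le (fun j => ?_) ((hasSum_norm_repr_sq e _).mul_left (lam N))
    (hasSum_norm1_sq hlam hx)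
  rw [map_sub, lp.coeFn_sub, Pi.sub_apply, repr_proj]
  split_ifs with h
  · simpa using mul_nonneg (hlam j).le (sq_nonneg _)
  · rw [sub_zero]
    exact mul_le_mul_of_nonneg_right (hmono (not_lt.1 h)) (sq_nonneg _)

theorem aestronglyMeasurable_sqrtGen {α : Type*} [MeasurableSpace α] {μ : Measure α} {f : α → H}
    (hlam : ∀ j, 0 < lam j) (hf : ∀ j, AEStronglyMeasurable (fun t => e.repr (f t) j) μ)
    (h1 : ∀ᵐ t ∂μ, MemH1 e lam (f t)) :
    AEStronglyMeasurable (fun t => sqrtGen e lam (f t)) μ := by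
  refine aestronglyMeasurable_of_repr (e := e) fun j => ?_
  refine ((hf j).const_mul (√(lam j) : ℂ)).congr ?_
  filter_upwards [h1] with t ht
  rw [repr_sqrtGen hlam ht]

theorem aestronglyMeasurable_norm1 {α : Type*} [MeasurableSpace α] {μ : Measure α} {f : α → H}
    (hlam : ∀ j, 0 < lam j) (hf : ∀ j, AEStronglyMeasurable (fun t => e.repr (f t) j) μ)
    (h1 : ∀ᵐ t ∂μ, MemH1 e lam (f t)) :
    AEStronglyMeasurable (fun t => norm1 e lam (f t)) μ := by
  refine (aestronglyMeasurable_sqrtGen hlam hf h1).norm.congr ?_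
  filter_upwards [h1] with t ht
  rw [norm_sqrtGen hlam ht]

end Sobolev

end RelaxationEnhancement

namespace RelaxationEnhancement

/-! ### Product rule for complex primitives -/

section ProductRule

theorem absolutelyContinuousOnInterval_const {F : Type*} [NormedAddCommGroup F] (c : F) (a b : ℝ) :
    AbsolutelyContinuousOnInterval (fun _ : ℝ => c) a b :=
  ((LipschitzWith.const c).lipschitzOnWith).absolutelyContinuousOnInterval

/-- The real statement is applied to real and imaginary parts, which are recombined as multiples of
`1` and `I`. -/
theorem absolutelyContinuousOnInterval_integral {f : ℝ → ℂ} {a b : ℝ}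
    (hf : IntervalIntegrable f volume a b) :
    AbsolutelyContinuousOnInterval (fun t => ∫ s in a..t, f s) a b := by
  have hre : IntervalIntegrable (fun s => (f s).re) volume a b := ⟨hf.1.re, hf.2.re⟩
  have him : IntervalIntegrable (fun s => (f s).im) volume a b := ⟨hf.1.im, hf.2.im⟩
  have h1 := (hre.absolutelyContinuousOnInterval_intervalIntegral (c := a) left_mem_uIcc).fun_smul
    (absolutelyContinuousOnInterval_const (1 : ℂ) a b)
  have h2 := (him.absolutelyContinuousOnInterval_intervalIntegral (c := a) left_mem_uIcc).fun_smul
    (absolutelyContinuousOnInterval_const Complex.I a b)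
  have h3 := h1.fun_add h2
  have key : ∀ t ∈ uIcc a b, (∫ s in a..t, f s) =
      (∫ s in a..t, (f s).re) • (1 : ℂ) + (∫ s in a..t, (f s).im) • Complex.I := by
    intro t ht
    have hft : IntervalIntegrable f volume a t := hf.mono_set (uIcc_subset_uIcc_left ht)
    apply Complex.ext
    · have := (Complex.reCLM.intervalIntegral_comp_comm hft)
      simp only [Complex.reCLM_apply] at this
      simp [← this]
    · have := (Complex.imCLM.intervalIntegral_comp_comm hft)
      simp only [Complex.imCLM_apply] at this
      simp [← this]
  rw [absolutelyContinuousOnInterval_iff] at h3 ⊢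
  intro ε hε
  obtain ⟨δ, hδ, h⟩ := h3 ε hε
  refine ⟨δ, hδ, fun E hE hE' => ?_⟩
  refine lt_of_eq_of_lt (Finset.sum_congr rfl fun i hi => ?_) (h E hE hE')
  have := hE.1 i hi
  rw [key _ this.1, key _ this.2]

/-- Integration by parts for complex-valued absolutely continuous functions, given as primitives. -/
theorem mul_sub_mul_eq_integral {u v f g : ℝ → ℂ} {a b : ℝ} (hab : a ≤ b)
    (hf : IntervalIntegrable f volume a b) (hg : IntervalIntegrable g volume a b)
    (hu : ∀ t ∈ Icc a b, u t = u a + ∫ s in a..t, f s)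
    (hv : ∀ t ∈ Icc a b, v t = v a + ∫ s in a..t, g s) :
    u b * v b - u a * v a = ∫ s in a..b, (f s * v s + u s * g s) := by
  set u' : ℝ → ℂ := fun t => u a + ∫ s in a..t, f s with hu'
  set v' : ℝ → ℂ := fun t => v a + ∫ s in a..t, g s with hv'
  have acu : AbsolutelyContinuousOnInterval u' a b :=
    (absolutelyContinuousOnInterval_const _ a b).fun_add
      (absolutelyContinuousOnInterval_integral hf)
  have acv : AbsolutelyContinuousOnInterval v' a b :=
    (absolutelyContinuousOnInterval_const _ a b).fun_add
      (absolutelyContinuousOnInterval_integral hg)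
  set h : ℝ → ℂ := fun s => f s * v' s + u' s * g s with hh
  have hint : IntervalIntegrable h volume a b :=
    (hf.mul_continuousOn acv.continuousOn).add (hg.continuousOn_mul acu.continuousOn)
  have acw : AbsolutelyContinuousOnInterval (fun t => u' t * v' t - ∫ s in a..t, h s) a b :=
    (acu.fun_smul acv).fun_sub (absolutelyContinuousOnInterval_integral hint)
  -- Product minus primitive is absolutely continuous with derivative zero almost everywhere, hence
  -- constant; the two endpoints are compared below.
  obtain ⟨C, hC⟩ := acw.const_of_ae_hasDerivAt_zero (by
    filter_upwards [hf.ae_hasDerivAt_integral, hg.ae_hasDerivAt_integral,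
      hint.ae_hasDerivAt_integral] with x hx1 hx2 hx3 hx
    have d1 := (hx1 hx a left_mem_uIcc).const_add (u a)
    have d2 := (hx2 hx a left_mem_uIcc).const_add (v a)
    have d3 := hx3 hx a left_mem_uIcc
    exact ((d1.mul d2).sub d3).congr_deriv (by simp only [hh, hu', hv']; ring))
  have ea := hC a left_mem_uIcc
  have eb := hC b right_mem_uIcc
  have e1 : u b = u' b := hu b (right_mem_Icc.2 hab)
  have e2 : v b = v' b := hv b (right_mem_Icc.2 hab)
  have e3 : u a = u' a := hu a (left_mem_Icc.2 hab)
  have e4 : v a = v' a := hv a (left_mem_Icc.2 hab)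
  have e5 : ∫ s in a..b, (f s * v s + u s * g s) = ∫ s in a..b, h s := by
    refine intervalIntegral.integral_congr fun s hs => ?_
    rw [uIcc_of_le hab] at hs
    simp only [hh]
    rw [hu s hs, hv s hs]
  rw [e5, e1, e2, e3, e4]
  simp only [intervalIntegral.integral_same, sub_zero] at ea eb
  rw [ea, ← eb]; ring

end ProductRule

/-! ### Trajectories, the pairing identity and the energy identity -/

variable {H : Type*} [NormedAddCommGroup H] [InnerProductSpace ℂ H]

/-- A time-dependent family of symmetric operators that is uniformly bounded from `H¹` to `H`. -/
structure IsSymmField (e : HilbertBasis ℕ ℂ H) (lam : ℕ → ℝ) (T : ℝ → H → H) (C : ℝ) : Prop where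
  pos : ∀ j, 0 < lam j
  nonneg : 0 ≤ C
  bound : ∀ t x, MemH1 e lam x → ‖T t x‖ ≤ C * norm1 e lam x
  symm : ∀ t x y, MemH1 e lam x → MemH1 e lam y → inner ℂ (T t x) y = inner ℂ x (T t y)

/-- The right-hand side of the `j`-th coordinate of `x' = i T x - κ Γ x`. -/
noncomputable def coordVel (e : HilbertBasis ℕ ℂ H) (lam : ℕ → ℝ) (T : ℝ → H → H) (κ : ℝ)
    (x : ℝ → H) (j : ℕ) (s : ℝ) : ℂ :=
  Complex.I * e.repr (T s (x s)) j - κ * (lam j : ℂ) * e.repr (x s) j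

/-- `x` is a bounded, square integrable in `H¹`, coordinatewise absolutely continuous solution of
`x' = i T x - κ Γ x` on `[a, b]`. -/
structure IsTraj (e : HilbertBasis ℕ ℂ H) (lam : ℕ → ℝ) (T : ℝ → H → H) (κ a b : ℝ)
    (x : ℝ → H) : Prop where
  bounded : ∃ C, ∀ t ∈ Icc a b, ‖x t‖ ≤ C
  memH1 : ∀ᵐ t ∂(volume.restrict (Ioc a b)), MemH1 e lam (x t)
  normSq_integrable : IntegrableOn (fun t => norm1 e lam (x t) ^ 2) (Ioc a b)
  integrable : ∀ j, IntervalIntegrable (coordVel e lam T κ x j) volume a b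
  equation : ∀ j, ∀ t ∈ Icc a b,
    e.repr (x t) j = e.repr (x a) j + ∫ s in a..t, coordVel e lam T κ x j s

variable {e : HilbertBasis ℕ ℂ H} {lam : ℕ → ℝ} {T : ℝ → H → H} {C κ κ' a b : ℝ} {x y : ℝ → H}

theorem IsTraj.mono (h : IsTraj e lam T κ a b x) {a' b' : ℝ} (ha : a ≤ a') (hab : a' ≤ b')
    (hb : b' ≤ b) : IsTraj e lam T κ a' b' x := by
  have hs : Ioc a' b' ⊆ Ioc a b := Ioc_subset_Ioc ha hb
  have hI : ∀ {s t}, a ≤ s → s ≤ t → t ≤ b → ∀ j,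
      IntervalIntegrable (coordVel e lam T κ x j) volume s t := by
    intro s t h1 h2 h3 j
    refine (h.integrable j).mono_set ?_
    rw [uIcc_of_le h2, uIcc_of_le (h1.trans (h2.trans h3))]
    exact Icc_subset_Icc h1 h3
  refine ⟨?_, ae_restrict_of_ae_restrict_of_subset hs h.memH1, h.normSq_integrable.mono_set hs,
    fun j => hI ha hab hb j, fun j t ht => ?_⟩
  · obtain ⟨C, hC⟩ := h.bounded
    exact ⟨C, fun t ht => hC t ⟨ha.trans ht.1, ht.2.trans hb⟩⟩
  · rw [h.equation j t ⟨ha.trans ht.1, ht.2.trans hb⟩,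
      h.equation j a' ⟨ha, hab.trans hb⟩, add_assoc,
      intervalIntegral.integral_add_adjacent_intervals (hI le_rfl ha (hab.trans hb) j)
        (hI ha ht.1 (ht.2.trans hb) j)]

theorem IsTraj.continuousOn_repr (h : IsTraj e lam T κ a b x) (hab : a ≤ b) (j : ℕ) :
    ContinuousOn (fun t => e.repr (x t) j) (Icc a b) := by
  have := (absolutelyContinuousOnInterval_integral (h.integrable j)).continuousOn
  rw [uIcc_of_le hab] at this
  exact (this.const_add (e.repr (x a) j)).congr fun t ht => h.equation j t ht

theorem IsTraj.aestronglyMeasurable_repr (h : IsTraj e lam T κ a b x) (hab : a ≤ b) (j : ℕ) :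
    AEStronglyMeasurable (fun t => e.repr (x t) j) (volume.restrict (Ioc a b)) :=
  ((h.continuousOn_repr hab j).mono Ioc_subset_Icc_self).aestronglyMeasurable measurableSet_Ioc

theorem IsTraj.norm1_integrable (hpos : ∀ j, 0 < lam j) (h : IsTraj e lam T κ a b x)
    (hab : a ≤ b) : IntegrableOn (fun t => norm1 e lam (x t)) (Ioc a b) := by
  refine Integrable.mono' (g := fun t => 1 + norm1 e lam (x t) ^ 2)
    ((integrable_const 1).add h.normSq_integrable)
    (aestronglyMeasurable_norm1 hpos (h.aestronglyMeasurable_repr hab) h.memH1)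
    (ae_of_all _ fun t => ?_)
  rw [Real.norm_of_nonneg (norm1_nonneg _)]
  nlinarith [sq_nonneg (norm1 e lam (x t) - 1)]

/-- The evolution of the inner product of two trajectories: the contribution of the symmetric
operators cancels. -/
theorem IsTraj.inner_sub_inner (hT : IsSymmField e lam T C) (hab : a ≤ b)
    (hx : IsTraj e lam T κ a b x) (hy : IsTraj e lam T κ' a b y) :
    inner ℂ (x b) (y b) - inner ℂ (x a) (y a) =
      -((κ + κ' : ℝ) : ℂ) * ∫ s in a..b, inner ℂ (sqrtGen e lam (x s)) (sqrtGen e lam (y s)) := by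
  obtain ⟨X, hX⟩ := hx.bounded
  obtain ⟨Y, hY⟩ := hy.bounded
  -- The derivative of the pairing truncated to the first `N` coordinates; the product rule applies
  -- coordinatewise, and `N → ∞` is taken by dominated convergence.
  let F : ℕ → ℝ → ℂ := fun N s => ∑ j ∈ Finset.range N,
    (starRingEnd ℂ (coordVel e lam T κ x j s) * e.repr (y s) j +
      starRingEnd ℂ (e.repr (x s) j) * coordVel e lam T κ' y j s)
  have hconj : ∀ j, IntervalIntegrable
      (fun s => starRingEnd ℂ (coordVel e lam T κ x j s)) volume a b := fun j =>
    ⟨(Complex.conjCLE.toContinuousLinearMap.integrable_comp (hx.integrable j).1),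
      (Complex.conjCLE.toContinuousLinearMap.integrable_comp (hx.integrable j).2)⟩
  have hxc : ∀ j, ContinuousOn (fun t => starRingEnd ℂ (e.repr (x t) j)) (uIcc a b) := fun j => by
    rw [uIcc_of_le hab]
    exact Complex.continuous_conj.comp_continuousOn (hx.continuousOn_repr hab j)
  have hyc : ∀ j, ContinuousOn (fun t => e.repr (y t) j) (uIcc a b) := fun j => by
    rw [uIcc_of_le hab]; exact hy.continuousOn_repr hab j
  have hFj : ∀ j, IntervalIntegrable (fun s =>
      starRingEnd ℂ (coordVel e lam T κ x j s) * e.repr (y s) j +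
      starRingEnd ℂ (e.repr (x s) j) * coordVel e lam T κ' y j s) volume a b := fun j =>
    ((hconj j).mul_continuousOn (hyc j)).add ((hy.integrable j).continuousOn_mul (hxc j))
  have hFint : ∀ N, IntervalIntegrable (F N) volume a b := fun N => by
    have := IntervalIntegrable.sum (Finset.range N) (f := fun j s =>
      starRingEnd ℂ (coordVel e lam T κ x j s) * e.repr (y s) j +
      starRingEnd ℂ (e.repr (x s) j) * coordVel e lam T κ' y j s) (μ := volume) (a := a) (b := b)
      fun j _ => hFj j
    rwa [show F N = ∑ j ∈ Finset.range N, fun s =>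
      starRingEnd ℂ (coordVel e lam T κ x j s) * e.repr (y s) j +
      starRingEnd ℂ (e.repr (x s) j) * coordVel e lam T κ' y j s by
        ext s; simp only [F, Finset.sum_apply]]
  have hsum : ∀ N, inner ℂ (proj e N (x b)) (y b) - inner ℂ (proj e N (x a)) (y a) =
      ∫ s in a..b, F N s := fun N => by
    rw [inner_proj_left, inner_proj_left, ← Finset.sum_sub_distrib,
      intervalIntegral.integral_finsetSum fun j _ => hFj j]
    refine Finset.sum_congr rfl fun j _ => ?_
    refine mul_sub_mul_eq_integral hab (hconj j) (hy.integrable j)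
      (u := fun t => starRingEnd ℂ (e.repr (x t) j)) (v := fun t => e.repr (y t) j)
      (fun t ht => ?_) (hy.equation j)
    have := hx.equation j t ht
    simp only [this, map_add]
    congr 1
    exact (Complex.conjCLE.toContinuousLinearMap.intervalIntegral_comp_comm
      ((hx.integrable j).mono_set (by
        rw [uIcc_of_le hab, uIcc_of_le ht.1]; exact Icc_subset_Icc_right ht.2))).symm
  -- The truncation does not commute with `T s`, so for fixed `N` the two drift terms need not
  -- cancel; symmetry removes them only in the limit.
  have hF : ∀ N s, MemH1 e lam (x s) → MemH1 e lam (y s) → F N s =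
      -Complex.I * inner ℂ (T s (x s)) (proj e N (y s))
      + Complex.I * inner ℂ (proj e N (x s)) (T s (y s))
      - ((κ + κ' : ℝ) : ℂ) *
        inner ℂ (proj e N (sqrtGen e lam (x s))) (sqrtGen e lam (y s)) := by
    intro N s h1 h2
    rw [inner_proj_sqrtGen hT.pos h1 h2, inner_proj_right, inner_proj_left, Finset.mul_sum,
      Finset.mul_sum, Finset.mul_sum, ← Finset.sum_add_distrib, ← Finset.sum_sub_distrib]
    refine Finset.sum_congr rfl fun j _ => ?_
    simp only [coordVel, map_sub, map_mul, Complex.conj_I, Complex.conj_ofReal, Complex.ofReal_add]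
    ring
  have hlim := intervalIntegral.tendsto_integral_filter_of_dominated_convergence
    (μ := volume) (a := a) (b := b) (l := atTop) (F := F)
    (f := fun s => -((κ + κ' : ℝ) : ℂ) *
      inner ℂ (sqrtGen e lam (x s)) (sqrtGen e lam (y s)))
    (fun s => C * norm1 e lam (x s) * Y + X * (C * norm1 e lam (y s)) +
      |κ + κ'| * (norm1 e lam (x s) ^ 2 + norm1 e lam (y s) ^ 2))
    (Eventually.of_forall fun N => (by
      have := (hFint N).1
      rw [uIoc_of_le hab]; exact this.aestronglyMeasurable))
    (Eventually.of_forall fun N => by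
      rw [uIoc_of_le hab, ← ae_restrict_iff' measurableSet_Ioc]
      filter_upwards [hx.memH1, hy.memH1, ae_restrict_mem measurableSet_Ioc] with s h1 h2 hs
      have hs' := Ioc_subset_Icc_self hs
      rw [hF N s h1 h2]
      have b1 : ‖-Complex.I * inner ℂ (T s (x s)) (proj e N (y s))‖ ≤
          C * norm1 e lam (x s) * Y := by
        rw [norm_mul, norm_neg, Complex.norm_I, one_mul]
        exact (norm_inner_le_norm _ _).trans (mul_le_mul (hT.bound s _ h1)
          ((norm_proj_le e N _).trans (hY s hs')) (norm_nonneg _)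
          (mul_nonneg hT.nonneg (norm1_nonneg _)))
      have b2 : ‖Complex.I * inner ℂ (proj e N (x s)) (T s (y s))‖ ≤
          X * (C * norm1 e lam (y s)) := by
        rw [norm_mul, Complex.norm_I, one_mul]
        exact (norm_inner_le_norm _ _).trans (mul_le_mul ((norm_proj_le e N _).trans (hX s hs'))
          (hT.bound s _ h2) (norm_nonneg _) ((norm_nonneg _).trans (hX s hs')))
      have b3 : ‖((κ + κ' : ℝ) : ℂ) * inner ℂ (proj e N (sqrtGen e lam (x s)))
          (sqrtGen e lam (y s))‖ ≤
          |κ + κ'| * (norm1 e lam (x s) ^ 2 + norm1 e lam (y s) ^ 2) := by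
        rw [norm_mul, Complex.norm_real, Real.norm_eq_abs]
        refine mul_le_mul_of_nonneg_left ((norm_inner_le_norm _ _).trans ?_) (abs_nonneg _)
        have := norm_proj_le e N (sqrtGen e lam (x s))
        rw [norm_sqrtGen hT.pos h1] at this
        rw [norm_sqrtGen hT.pos h2]
        nlinarith [norm1_nonneg (e := e) (lam := lam) (y s),
          norm_nonneg (proj e N (sqrtGen e lam (x s))),
          sq_nonneg (norm1 e lam (x s) - norm1 e lam (y s)), sq_nonneg (norm1 e lam (x s)),
          sq_nonneg (norm1 e lam (y s)), norm1_nonneg (e := e) (lam := lam) (x s),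
          mul_le_mul_of_nonneg_right this (norm1_nonneg (e := e) (lam := lam) (y s))]
      exact (norm_sub_le _ _).trans (add_le_add ((norm_add_le _ _).trans (add_le_add b1 b2)) b3))
    (by
      rw [intervalIntegrable_iff_integrableOn_Ioc_of_le hab]
      exact ((((hx.norm1_integrable hT.pos hab).const_mul C).mul_const Y).add
        (((hy.norm1_integrable hT.pos hab).const_mul C).const_mul X)).add
        ((hx.normSq_integrable.add hy.normSq_integrable).const_mul _))
    (by
      rw [uIoc_of_le hab, ← ae_restrict_iff' measurableSet_Ioc]
      filter_upwards [hx.memH1, hy.memH1] with s h1 h2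
      simp only [hF _ s h1 h2]
      have l1 := ((tendsto_const_nhds (x := T s (x s))).inner (𝕜 := ℂ)
        (tendsto_proj e (y s))).const_mul (-Complex.I)
      have l2 := ((tendsto_proj e (x s)).inner (𝕜 := ℂ)
        (tendsto_const_nhds (x := T s (y s)))).const_mul Complex.I
      have l3 := ((tendsto_proj e (sqrtGen e lam (x s))).inner (𝕜 := ℂ)
        (tendsto_const_nhds (x := sqrtGen e lam (y s)))).const_mul ((κ + κ' : ℝ) : ℂ)
      have := (l1.add l2).sub l3
      rw [hT.symm s _ _ h1 h2] at this
      convert this using 2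
      ring)
  simp only [← hsum] at hlim
  have hlim2 := (((tendsto_proj e (x b)).inner (𝕜 := ℂ) (tendsto_const_nhds (x := y b))).sub
    ((tendsto_proj e (x a)).inner (𝕜 := ℂ) (tendsto_const_nhds (x := y a))))
  rw [tendsto_nhds_unique hlim2 hlim, intervalIntegral.integral_const_mul]

/-- The energy identity. -/
theorem IsTraj.norm_sq_sub (hT : IsSymmField e lam T C) (hab : a ≤ b)
    (hx : IsTraj e lam T κ a b x) :
    ‖x b‖ ^ 2 - ‖x a‖ ^ 2 = -(2 * κ) * ∫ s in a..b, norm1 e lam (x s) ^ 2 := by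
  have h := hx.inner_sub_inner hT hab hx
  have e1 : (∫ s in a..b, inner ℂ (sqrtGen e lam (x s)) (sqrtGen e lam (x s))) =
      ((∫ s in a..b, norm1 e lam (x s) ^ 2 : ℝ) : ℂ) := by
    rw [← intervalIntegral.integral_ofReal]
    refine intervalIntegral.integral_congr_ae ?_
    rw [uIoc_of_le hab, ← ae_restrict_iff' measurableSet_Ioc]
    filter_upwards [hx.memH1] with s h1
    rw [inner_self_eq_norm_sq_to_K, norm_sqrtGen hT.pos h1]
    norm_cast
  have e2 : ∀ z : H, inner ℂ z z = ((‖z‖ ^ 2 : ℝ) : ℂ) := fun z => by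
    rw [inner_self_eq_norm_sq_to_K]; norm_cast
  rw [e1, e2, e2] at h
  apply Complex.ofReal_injective
  push_cast at h ⊢
  linear_combination h

end RelaxationEnhancement

/-! ### Growth bounds, periodicity and measurability of the free evolution -/

namespace RelaxationEnhancement

variable {H : Type*} [NormedAddCommGroup H] [InnerProductSpace ℂ H]
variable {e : HilbertBasis ℕ ℂ H} {lam : ℕ → ℝ} {U : ℝ → H ≃ₗᵢ[ℂ] H}

/-- An essentially locally bounded growth rate can be replaced by a locally bounded one. -/
theorem Condition2.exists_bound (h2 : Condition2 e lam U) (R : ℝ) :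
    ∃ M : ℝ, 0 ≤ M ∧ ∀ t s : ℝ, |t - s| ≤ R → ∀ ψ : H, MemH1 e lam ψ →
      norm1 e lam (propagator U t s ψ) ≤ M * norm1 e lam ψ := by
  obtain ⟨B, hB, hU⟩ := h2
  -- The added `1` gives the window of intermediate times positive measure. With `r₁` and `t - s`
  -- both within `R'`, the increments `r₁` and `t - s - r₁` stay within `2R'`.
  set R' := |R| + 1 with hR'
  have hR'pos : 0 < R' := by positivity
  have hRR' : R ≤ R' := (le_abs_self R).trans (by linarith)
  obtain ⟨C, hC0, hC⟩ : ∃ C : ℝ, 0 ≤ C ∧ ∀ᵐ r, r ∈ Icc (-(2 * R')) (2 * R') → B r ≤ C := by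
    have hm := hB _ (isCompact_Icc (a := -(2 * R')) (b := 2 * R'))
    refine ⟨(eLpNormEssSup B (volume.restrict (Icc (-(2 * R')) (2 * R')))).toReal,
      ENNReal.toReal_nonneg, ?_⟩
    rw [← ae_restrict_iff' measurableSet_Icc]
    filter_upwards [ae_le_eLpNormEssSup (f := B)
      (μ := volume.restrict (Icc (-(2 * R')) (2 * R')))] with r hr
    have htop := hm.2.ne
    rw [eLpNorm_exponent_top] at htop
    have := ENNReal.toReal_mono htop hr
    rw [toReal_enorm] at this
    exact (le_abs_self _).trans this
  refine ⟨C ^ 2, by positivity, fun t s hts ψ hψ => ?_⟩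
  have hC' : ∀ᵐ r₁, (t - s) - r₁ ∈ Icc (-(2 * R')) (2 * R') → B ((t - s) - r₁) ≤ C :=
    (Measure.measurePreserving_sub_left volume (t - s)).quasiMeasurePreserving.ae hC
  -- The essential bound says nothing about the particular value `B (t - s)`. Splitting the
  -- evolution at an intermediate time `s + r₁`, with `r₁` outside two null sets, makes both factors
  -- at most `C`, whence the constant `C ^ 2`.
  obtain ⟨r₁, hr₁, g1, g2⟩ : ∃ r₁ ∈ Icc (-R') R', (r₁ ∈ Icc (-(2 * R')) (2 * R') → B r₁ ≤ C) ∧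
      ((t - s) - r₁ ∈ Icc (-(2 * R')) (2 * R') → B ((t - s) - r₁) ≤ C) := by
    by_contra! hne
    have hn : ∀ᵐ r₁ : ℝ, r₁ ∉ Icc (-R') R' := by
      filter_upwards [hC, hC'] with r h1 h2 hr
      exact absurd (h2 (hne r hr h1).1) (not_le.2 (hne r hr h1).2)
    rw [ae_iff] at hn
    simp only [not_not, ofPred_mem_eq, Real.volume_Icc, ENNReal.ofReal_eq_zero] at hn
    linarith
  have hts' := abs_le.1 hts
  have b1 := g1 ⟨by linarith [hr₁.1], by linarith [hr₁.2]⟩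
  have b2 := g2 ⟨by linarith [hr₁.2], by linarith [hr₁.1]⟩
  have k1 := hU (s + r₁) s ψ hψ
  have k2 := hU t (s + r₁) _ k1.1
  have hcomp : propagator U t (s + r₁) (propagator U (s + r₁) s ψ) = propagator U t s ψ := by
    simp [propagator]
  rw [hcomp] at k2
  have n0 := norm1_nonneg (e := e) (lam := lam) ψ
  have n1 := norm1_nonneg (e := e) (lam := lam) (propagator U (s + r₁) s ψ)
  rw [add_sub_cancel_left] at k1
  rw [← sub_sub] at k2
  calc norm1 e lam (propagator U t s ψ)
      ≤ B (t - s - r₁) * norm1 e lam (propagator U (s + r₁) s ψ) :=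
        k2.2
    _ ≤ C * norm1 e lam (propagator U (s + r₁) s ψ) := mul_le_mul_of_nonneg_right b2 n1
    _ ≤ C * (C * norm1 e lam ψ) := mul_le_mul_of_nonneg_left
        (k1.2.trans (mul_le_mul_of_nonneg_right b1 n0)) hC0
    _ = C ^ 2 * norm1 e lam ψ := by ring

section Operators

theorem opApply_of_mem (T : H →ₗ.[ℂ] H) {x : H} (h : x ∈ T.domain) : opApply T x = T ⟨x, h⟩ :=
  dif_pos h

theorem inner_opApply_comm [CompleteSpace H] {T : H →ₗ.[ℂ] H} (hT : IsSelfAdjoint T) {x y : H}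
    (hx : x ∈ T.domain)
    (hy : y ∈ T.domain) : inner ℂ (opApply T x) y = inner ℂ x (opApply T y) := by
  rw [opApply_of_mem T hx, opApply_of_mem T hy]
  have h := LinearPMap.adjoint_isFormalAdjoint hT.dense_domain
  rw [LinearPMap.isSelfAdjoint_def.1 hT] at h
  exact h ⟨x, hx⟩ ⟨y, hy⟩

theorem IsEigenbasis.lam_pos {Γ : H →ₗ.[ℂ] H} (he : IsEigenbasis Γ e lam) (j : ℕ) : 0 < lam j :=
  he.pos.trans_le (he.mono (Nat.zero_le j))

theorem IsEigenbasis.repr_apply [CompleteSpace H] {Γ : H →ₗ.[ℂ] H} (he : IsEigenbasis Γ e lam)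
    (hΓ : IsSelfAdjoint Γ) (χ : Γ.domain) (j : ℕ) :
    e.repr (Γ χ) j = lam j * e.repr (χ : H) j := by
  obtain ⟨h, hj⟩ := he.eigen j
  have := inner_opApply_comm hΓ h χ.2
  rw [opApply_of_mem Γ h, opApply_of_mem Γ χ.2, hj, inner_smul_left, Complex.conj_ofReal] at this
  rw [e.repr_apply_apply, e.repr_apply_apply, this]

/-- The operators `A L(A t)` that drive the accelerated evolution. -/
noncomputable def driftField (L : ℝ → H →ₗ.[ℂ] H) (A : ℝ) (t : ℝ) (x : H) : H :=
  (A : ℂ) • opApply (L (A * t)) x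

variable {L : ℝ → H →ₗ.[ℂ] H}

theorem exists_isSymmField [CompleteSpace H] (hlam : ∀ j, 0 < lam j) (hL : ∀ t, IsSelfAdjoint (L t))
    (h1 : Condition1 e lam L) (A : ℝ) : ∃ C, IsSymmField e lam (driftField L A) C := by
  obtain ⟨C₀, hC⟩ := h1
  refine ⟨|A| * |C₀|, hlam, by positivity, fun t x hx => ?_, fun t x y hx hy => ?_⟩
  · rw [driftField, norm_smul, Complex.norm_real, Real.norm_eq_abs, mul_assoc]
    refine mul_le_mul_of_nonneg_left (((hC (A * t) x hx).2).trans ?_) (abs_nonneg _)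
    exact mul_le_mul_of_nonneg_right (le_abs_self _) (norm1_nonneg _)
  · rw [driftField, driftField, inner_smul_left, inner_smul_right, Complex.conj_ofReal,
      inner_opApply_comm (hL _) (hC _ _ hx).1 (hC _ _ hy).1]

theorem Generates.zero_apply (hU : Generates e lam L U) (ψ : H) : U 0 ψ = ψ := (hU ψ).initial

theorem Generates.memH1 (hU : Generates e lam L U) (h2 : Condition2 e lam U) (t : ℝ) {ψ : H}
    (hψ : MemH1 e lam ψ) : MemH1 e lam (U t ψ) := by
  obtain ⟨B, -, h⟩ := h2
  have := (h t 0 ψ hψ).1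
  have h0 : (U 0).symm ψ = ψ := by rw [LinearIsometryEquiv.symm_apply_eq, hU.zero_apply]
  rwa [propagator, LinearIsometryEquiv.trans_apply, h0] at this

theorem Generates.exists_bound (hU : Generates e lam L U) (h2 : Condition2 e lam U) (R : ℝ) :
    ∃ M : ℝ, 0 ≤ M ∧ ∀ t : ℝ, |t| ≤ R → ∀ ψ : H, MemH1 e lam ψ →
      norm1 e lam (U t ψ) ≤ M * norm1 e lam ψ := by
  obtain ⟨M, hM, h⟩ := h2.exists_bound R
  refine ⟨M, hM, fun t ht ψ hψ => ?_⟩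
  have := h t 0 (by simpa using ht) ψ hψ
  have h0 : (U 0).symm ψ = ψ := by rw [LinearIsometryEquiv.symm_apply_eq, hU.zero_apply]
  rwa [propagator, LinearIsometryEquiv.trans_apply, h0] at this

/-- Speeding up time by `A` turns a free orbit into a trajectory with `κ = 0`. The shift `c` is any
period of `L`: `c = 0` is the orbit itself, and `c = 1` is what yields the periodicity of the
evolution. -/
theorem Generates.isTraj [CompleteSpace H] (hU : Generates e lam L U)
    (hlam : ∀ j, 0 < lam j)
    (hL : ∀ t, IsSelfAdjoint (L t)) (h1 : Condition1 e lam L) (h2 : Condition2 e lam U)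
    {A c : ℝ} (hA : 0 < A) (hc : ∀ t, L (t + c) = L t) {a b : ℝ} {χ : H}
    (hχ : MemH1 e lam χ) : IsTraj e lam (driftField L A) 0 a b (fun t => U (A * t + c) χ) := by
  have hcont : Continuous fun t => U (A * t + c) χ := (hU χ).continuous.comp (by fun_prop)
  have hvel : ∀ j, coordVel e lam (driftField L A) 0 (fun t => U (A * t + c) χ) j =
      fun s => (A : ℂ) *
        (Complex.I * inner ℂ (opApply (L (A * s + c)) (e j)) (U (A * s + c) χ)) := by
    intro j
    ext s
    have hs : inner ℂ (opApply (L (A * s + c)) (e j)) (U (A * s + c) χ) =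
        inner ℂ (e j) (opApply (L (A * s + c)) (U (A * s + c) χ)) := by
      obtain ⟨C₀, hC⟩ := h1
      exact inner_opApply_comm (hL _) (hC _ _ (memH1_basis j)).1
        (hC _ _ (hU.memH1 h2 _ hχ)).1
    rw [hs, hc]
    simp only [coordVel, driftField, e.repr_apply_apply, inner_smul_right]
    push_cast
    ring
  have hint : ∀ j, ∀ r r' : ℝ, IntervalIntegrable
      (fun s => Complex.I * inner ℂ (opApply (L s) (e j)) (U s χ)) volume r r' := fun j r r' =>
    ((hU χ).integrable (e j) (memH1_basis j) r).symm.trans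
      ((hU χ).integrable (e j) (memH1_basis j) r')
  refine ⟨⟨‖χ‖, fun t _ => by simp⟩, ae_of_all _ fun t => hU.memH1 h2 _ hχ, ?_, fun j => ?_,
    fun j t _ => ?_⟩
  · obtain ⟨M, -, hM⟩ := hU.exists_bound h2 (|A| * max |a| |b| + |c|)
    have hmeas := aestronglyMeasurable_norm1 (μ := volume.restrict (Ioc a b)) (e := e) hlam
      (fun j => hcont.aestronglyMeasurable.repr j) (ae_of_all _ fun t => hU.memH1 h2 _ hχ)
    refine Integrable.of_bound (hmeas.pow 2) ((M * norm1 e lam χ) ^ 2) ?_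
    filter_upwards [ae_restrict_mem measurableSet_Ioc] with t ht
    rw [Real.norm_of_nonneg (sq_nonneg _)]
    refine pow_le_pow_left₀ (norm1_nonneg _) (hM _ ?_ χ hχ) 2
    refine (abs_add_le _ _).trans ?_
    rw [abs_mul]
    gcongr
    exact abs_le_max_abs_abs ht.1.le ht.2
  · rw [hvel]
    have h := (((hint j (A * a + c) (A * b + c)).comp_add_right c).comp_mul_left (c := A))
    simp only [add_sub_cancel_right, mul_div_cancel_left₀ _ hA.ne'] at h
    exact h.const_mul _
  · rw [hvel, intervalIntegral.integral_const_mul]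
    have h := intervalIntegral.smul_integral_comp_mul_add (a := a) (b := t)
      (fun s => Complex.I * inner ℂ (opApply (L s) (e j)) (U s χ)) A c
    rw [Complex.real_smul] at h
    rw [h, e.repr_apply_apply, e.repr_apply_apply, (hU χ).equation _ (memH1_basis j) (A * t + c),
      (hU χ).equation _ (memH1_basis j) (A * a + c), add_assoc,
      intervalIntegral.integral_add_adjacent_intervals (hint _ _ _) (hint _ _ _)]

/-- The evolution family inherits the periodicity of its generator. -/
theorem Generates.add_one_apply [CompleteSpace H] (hU : Generates e lam L U)
    (hlam : ∀ j, 0 < lam j)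
    (hL : ∀ t, IsSelfAdjoint (L t)) (hper : Function.Periodic L 1)
    (h1 : Condition1 e lam L) (h2 : Condition2 e lam U) {t : ℝ} (ht : 0 ≤ t) (ψ : H) :
    U (t + 1) ψ = U t (U 1 ψ) := by
  obtain ⟨C, hT⟩ := exists_isSymmField hlam hL h1 1
  -- Both `U(s)e_k` and `U(s+1)e_j` solve the free equation, so their pairing is conserved. Its
  -- values at `0` and `t` give every coordinate of `U(t)⁻¹U(t+1)e_j`.
  have key : ∀ j, U (t + 1) (e j) = U t (U 1 (e j)) := by
    intro j
    rw [← LinearIsometryEquiv.symm_apply_eq]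
    refine ext_repr e fun k => ?_
    have hx := hU.isTraj hlam hL h1 h2 one_pos (c := 0) (fun t => by rw [add_zero])
      (a := 0) (b := t)
      (memH1_basis k)
    have hy := hU.isTraj hlam hL h1 h2 one_pos hper (a := 0) (b := t) (memH1_basis j)
    have := hx.inner_sub_inner hT ht hy
    simp only [one_mul, add_zero, zero_add, Complex.ofReal_zero, neg_zero, zero_mul,
      hU.zero_apply, sub_eq_zero] at this
    rw [e.repr_apply_apply, e.repr_apply_apply, ← this, ← LinearIsometryEquiv.inner_map_map (U t),
      LinearIsometryEquiv.apply_symm_apply]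
  have hdense : Dense (Submodule.span ℂ (Set.range e) : Set H) :=
    Submodule.dense_iff_topologicalClosure_eq_top.2 e.dense_span
  have := ContinuousLinearMap.ext_on (f := ((U (t + 1)).toContinuousLinearEquiv : H →L[ℂ] H))
    (g := (((U 1).trans (U t)).toContinuousLinearEquiv : H →L[ℂ] H)) hdense (by
      rintro _ ⟨j, rfl⟩
      exact key j)
  exact congrArg (fun f : H →L[ℂ] H => f ψ) this

theorem Generates.add_nat_apply [CompleteSpace H] (hU : Generates e lam L U)
    (hlam : ∀ j, 0 < lam j)
    (hL : ∀ t, IsSelfAdjoint (L t)) (hper : Function.Periodic L 1)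
    (h1 : Condition1 e lam L) (h2 : Condition2 e lam U) {t : ℝ} (ht : 0 ≤ t) (k : ℕ) (ψ : H) :
    U (t + k) ψ = U t ((U 1)^[k] ψ) := by
  induction k generalizing ψ with
  | zero => simp
  | succ k ih =>
    rw [Nat.cast_succ, ← add_assoc, hU.add_one_apply hlam hL hper h1 h2 (by positivity), ih,
      Function.iterate_succ_apply]

/-- This separates the long-time behaviour, carried by powers of the period map, from a remainder
over times in `[0,1)`, where Condition 2 gives a uniform `H¹` bound. -/
theorem Generates.eq_fract_apply [CompleteSpace H] (hU : Generates e lam L U)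
    (hlam : ∀ j, 0 < lam j)
    (hL : ∀ t, IsSelfAdjoint (L t)) (hper : Function.Periodic L 1)
    (h1 : Condition1 e lam L) (h2 : Condition2 e lam U) {t : ℝ} (ht : 0 ≤ t) (ψ : H) :
    U t ψ = U (Int.fract t) ((U 1)^[⌊t⌋₊] ψ) := by
  rw [← hU.add_nat_apply hlam hL hper h1 h2 (Int.fract_nonneg t)]
  congr 2
  rw [natCast_floor_eq_intCast_floor ht, Int.fract_add_floor]

/-- The operators `L(t)` are strongly measurable on `H¹`. -/
theorem Generates.aestronglyMeasurable_opApply (hU : Generates e lam L U) {χ : H}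
    (hχ : MemH1 e lam χ) : AEStronglyMeasurable (fun s => opApply (L s) χ) volume := by
  have h0 : ∀ ψ : H, AEStronglyMeasurable (fun s => inner ℂ (opApply (L s) χ) (U s ψ)) volume := by
    intro ψ
    have hloc : LocallyIntegrable
        (fun s => Complex.I * inner ℂ (opApply (L s) χ) (U s ψ)) volume := by
      rw [locallyIntegrable_iff]
      intro K hK
      obtain ⟨R, hR⟩ := hK.isBounded.subset_closedBall 0
      rw [Real.closedBall_eq_Icc] at hR
      have hi := ((hU ψ).integrable χ hχ (0 - |R| - 1)).symm.trans
        ((hU ψ).integrable χ hχ (0 + |R|))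
      rw [intervalIntegrable_iff_integrableOn_Ioc_of_le (by linarith [abs_nonneg R])] at hi
      refine hi.mono_set fun x hx => ?_
      have := hR hx
      exact ⟨by linarith [this.1, le_abs_self R], by linarith [this.2, le_abs_self R]⟩
    refine (hloc.aestronglyMeasurable.const_mul (-Complex.I)).congr (ae_of_all _ fun s => ?_)
    simp only
    rw [← mul_assoc]; simp
  refine aestronglyMeasurable_of_repr (e := e) fun j => ?_
  -- Only the pairings of `L(s)χ` with orbits are known to be measurable. Hence `L(s)χ` is expanded
  -- in the moving orthonormal basis `U(s)e_m`, whose own coordinates are continuous in `s`.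
  have hsum : ∀ s, Tendsto (fun N => ∑ m ∈ Finset.range N,
      inner ℂ (U s (e m)) (opApply (L s) χ) * inner ℂ (e j) (U s (e m))) atTop
      (𝓝 (e.repr (opApply (L s) χ) j)) := by
    intro s
    have h := (e.hasSum_inner_mul_inner ((U s).symm (e j)) ((U s).symm (opApply (L s) χ)))
    rw [LinearIsometryEquiv.inner_map_map] at h
    have h' := h.tendsto_sum_nat
    rw [e.repr_apply_apply]
    convert h' using 3 with N m
    rw [mul_comm, ← LinearIsometryEquiv.inner_map_map (U s) _ (e m),
      ← LinearIsometryEquiv.inner_map_map (U s) (e m) ((U s).symm _)]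
    simp
  refine aestronglyMeasurable_of_tendsto_ae atTop (fun N => ?_) (ae_of_all _ hsum)
  refine Finset.aestronglyMeasurable_fun_sum _ fun m _ => ?_
  refine AEStronglyMeasurable.mul ?_ ?_
  · refine (Complex.continuous_conj.comp_aestronglyMeasurable (h0 (e m))).congr
      (ae_of_all _ fun s => ?_)
    exact inner_conj_symm _ _
  · exact ((continuous_const.inner (hU (e m)).continuous)).aestronglyMeasurable

end Operators

end RelaxationEnhancement

/-! ### Free versus dissipative trajectories, and the obstruction by an eigenvector -/

namespace RelaxationEnhancement

variable {H : Type*} [NormedAddCommGroup H] [InnerProductSpace ℂ H]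
variable {e : HilbertBasis ℕ ℂ H} {lam : ℕ → ℝ} {U : ℝ → H ≃ₗᵢ[ℂ] H} {L : ℝ → H →ₗ.[ℂ] H}

section Comparison

variable {T : ℝ → H → H} {C κ κ' a b : ℝ} {x y : ℝ → H}

/-- Young's inequality with a free weight `η`, so that the dissipation of `y` can be absorbed by the
energy identity or made small. -/
theorem IsTraj.norm_integral_inner_le (hlam : ∀ j, 0 < lam j) (hab : a ≤ b)
    (hx : IsTraj e lam T κ a b x) (hy : IsTraj e lam T κ' a b y) {K η : ℝ} (hη : 0 < η)
    (hK : ∀ t ∈ Ioc a b, norm1 e lam (x t) ≤ K) :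
    ‖∫ s in a..b, inner ℂ (sqrtGen e lam (x s)) (sqrtGen e lam (y s))‖ ≤
      η * (∫ s in a..b, norm1 e lam (y s) ^ 2) + K ^ 2 / (4 * η) * (b - a) := by
  have hi : IntervalIntegrable (fun s => norm1 e lam (y s) ^ 2) volume a b :=
    (intervalIntegrable_iff_integrableOn_Ioc_of_le hab).2 hy.normSq_integrable
  have h := intervalIntegral.norm_integral_le_of_norm_le hab
    (f := fun s => inner ℂ (sqrtGen e lam (x s)) (sqrtGen e lam (y s)))
    (g := fun s => η * norm1 e lam (y s) ^ 2 + K ^ 2 / (4 * η)) (μ := volume) (by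
      rw [← ae_restrict_iff' measurableSet_Ioc]
      filter_upwards [hx.memH1, hy.memH1, ae_restrict_mem measurableSet_Ioc] with s h1 h2 hs
      refine (norm_inner_le_norm _ _).trans ?_
      rw [norm_sqrtGen hlam h1, norm_sqrtGen hlam h2]
      have hy0 := norm1_nonneg (e := e) (lam := lam) (y s)
      refine (mul_le_mul_of_nonneg_right (hK s hs) hy0).trans ?_
      have hsq : η * norm1 e lam (y s) ^ 2 + K ^ 2 / (4 * η) - K * norm1 e lam (y s) =
          (2 * η * norm1 e lam (y s) - K) ^ 2 / (4 * η) := by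
        field_simp; ring
      have : 0 ≤ (2 * η * norm1 e lam (y s) - K) ^ 2 / (4 * η) := by positivity
      linarith) ((hi.const_mul η).add intervalIntegrable_const)
  rwa [intervalIntegral.integral_add (hi.const_mul η) intervalIntegrable_const,
    intervalIntegral.integral_const_mul, intervalIntegral.integral_const, smul_eq_mul,
    mul_comm (b - a)] at h

/-- On short time intervals the dissipative evolution stays close to the free one. -/
theorem IsTraj.norm_sub_sq_le (hT : IsSymmField e lam T C) (hab : a ≤ b)
    (hx : IsTraj e lam T 0 a b x) (hy : IsTraj e lam T 1 a b y) (hxy : x a = y a) {K : ℝ}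
    (hK : ∀ t ∈ Ioc a b, norm1 e lam (x t) ≤ K) :
    ‖y b - x b‖ ^ 2 ≤ K ^ 2 / 2 * (b - a) := by
  have ex := hx.norm_sq_sub hT hab
  have ey := hy.norm_sq_sub hT hab
  have exy := hx.inner_sub_inner hT hab hy
  -- Expanding the square gives `‖y b - x b‖² = 2 Re J - 2E`; the weight `η = 1` cancels the
  -- dissipation `E` exactly.
  have hJ := hx.norm_integral_inner_le hT.pos hab hy one_pos hK
  set J := ∫ s in a..b, inner ℂ (sqrtGen e lam (x s)) (sqrtGen e lam (y s))
  set E := ∫ s in a..b, norm1 e lam (y s) ^ 2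
  have hre : RCLike.re (inner ℂ (y b) (x b)) = ‖y a‖ ^ 2 - J.re := by
    have h1 : inner ℂ (x b) (y b) = ((‖y a‖ ^ 2 : ℝ) : ℂ) - J := by
      have h2 : inner ℂ (x a) (y a) = ((‖y a‖ ^ 2 : ℝ) : ℂ) := by
        rw [hxy, inner_self_eq_norm_sq_to_K]; norm_cast
      rw [h2] at exy
      simp only [zero_add, Complex.ofReal_one] at exy
      linear_combination exy
    rw [inner_re_symm, h1]
    simp [-Complex.ofReal_pow]
  have hJ' : J.re ≤ ‖J‖ := Complex.re_le_norm J
  rw [@norm_sub_sq ℂ, hre]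
  rw [hxy] at ex
  linarith

end Comparison

theorem IsSolution.isTraj {Γ : H →ₗ.[ℂ] H} (he : IsEigenbasis Γ e lam) {A : ℝ} {φ₀ : H}
    {φ : ℝ → H} (hφ : IsSolution Γ e lam L A φ₀ φ) {τ : ℝ} (hτ : 0 < τ) :
    IsTraj e lam (driftField L A) 1 0 τ φ := by
  have hvel : ∀ j, ∃ h : e j ∈ Γ.domain, coordVel e lam (driftField L A) 1 φ j = fun s =>
      Complex.I * (A : ℂ) * inner ℂ (e j) (opApply (L (A * s)) (φ s)) -
        inner ℂ (Γ ⟨e j, h⟩) (φ s) := by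
    intro j
    obtain ⟨h, hj⟩ := he.eigen j
    refine ⟨h, ?_⟩
    ext s
    rw [hj]
    simp only [coordVel, driftField, e.repr_apply_apply, inner_smul_right, inner_smul_left,
      Complex.conj_ofReal]
    push_cast
    ring
  refine ⟨?_, ae_restrict_of_ae_restrict_of_subset Ioc_subset_Ioi_self hφ.memH1,
    hφ.normSq_integrable τ hτ, fun j => ?_, fun j t ht => ?_⟩
  · exact isCompact_Icc.exists_bound_of_continuousOn (hφ.continuousOn.mono Icc_subset_Ici_self)
  · obtain ⟨h, hj⟩ := hvel j
    rw [hj]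
    exact hφ.integrable ⟨e j, h⟩ τ hτ.le
  · obtain ⟨h, hj⟩ := hvel j
    rw [hj, e.repr_apply_apply, e.repr_apply_apply, hφ.initial]
    exact hφ.equation ⟨e j, h⟩ t ht.1

/-- The bound does not see the drift; this is the source of all uniformity in `A`. -/
theorem IsTraj.integral_norm1_sq_le {T : ℝ → H → H} {C a b : ℝ} {y : ℝ → H}
    (hT : IsSymmField e lam T C) (hab : a ≤ b) (hy : IsTraj e lam T 1 a b y) :
    ∫ s in a..b, norm1 e lam (y s) ^ 2 ≤ ‖y a‖ ^ 2 / 2 := by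
  have := hy.norm_sq_sub hT hab
  nlinarith [sq_nonneg ‖y b‖]

theorem IsTraj.norm_le {T : ℝ → H → H} {C a b : ℝ} {y : ℝ → H}
    (hT : IsSymmField e lam T C) (hab : a ≤ b) (hy : IsTraj e lam T 1 a b y) : ‖y b‖ ≤ ‖y a‖ := by
  have h := hy.norm_sq_sub hT hab
  have h0 : 0 ≤ ∫ s in a..b, norm1 e lam (y s) ^ 2 :=
    intervalIntegral.integral_nonneg hab fun s _ => sq_nonneg _
  exact (sq_le_sq₀ (norm_nonneg _) (norm_nonneg _)).1 (by linarith)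

variable [CompleteSpace H]

/-- A solution that starts at an `H¹` eigenvector of the period map does not decay, uniformly in
the amplitude of the drift. -/
theorem not_relaxationEnhancing_of_eigenvector {Γ : H →ₗ.[ℂ] H} (he : IsEigenbasis Γ e lam)
    (hL : ∀ t, IsSelfAdjoint (L t)) (hper : Function.Periodic L 1) (hU : Generates e lam L U)
    (h1 : Condition1 e lam L) (h2 : Condition2 e lam U) {μ : ℂ} {ψ : H} (hψ0 : ψ ≠ 0)
    (hψ : MemH1 e lam ψ) (hV : U 1 ψ = μ • ψ) : ¬ RelaxationEnhancing Γ e lam L := by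
  intro hRE
  have hn : ‖ψ‖ ≠ 0 := norm_ne_zero_iff.2 hψ0
  set χ : H := ((‖ψ‖⁻¹ : ℝ) : ℂ) • ψ with hχdef
  have hχ : MemH1 e lam χ := memH1_smul _ hψ
  have hχ1 : ‖χ‖ = 1 := by
    rw [hχdef, norm_smul, Complex.norm_real, norm_inv, norm_norm, inv_mul_cancel₀ hn]
  have hVχ : U 1 χ = μ • χ := by rw [hχdef, map_smul, hV, smul_comm]
  have hμ : ‖μ‖ = 1 := by
    have := congrArg norm hVχ
    rwa [LinearIsometryEquiv.norm_map, norm_smul μ, hχ1, mul_one, eq_comm] at this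
  have hiter : ∀ k, (U 1)^[k] χ = μ ^ k • χ := by
    intro k
    induction k with
    | zero => simp
    | succ k ih => rw [Function.iterate_succ_apply', ih, map_smul, hVχ, smul_smul, pow_succ]
  obtain ⟨M, hM0, hM⟩ := hU.exists_bound h2 1
  set N := M * norm1 e lam χ with hN
  have hbound : ∀ t, 0 ≤ t → norm1 e lam (U t χ) ≤ N := by
    intro t ht
    rw [hU.eq_fract_apply he.lam_pos hL hper h1 h2 ht, hiter, map_smul, norm1_smul, norm_pow, hμ,
      one_pow, one_mul]
    exact hM _ (by rw [abs_of_nonneg (Int.fract_nonneg t)]; exact (Int.fract_lt_one t).le) χ hχ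
  -- Chosen so that `N²τ ≤ 1/8`. With weight `η = 1/4` below, `‖J‖ ≤ (1/4)(1/2) + N²τ ≤ 1/4`, hence
  -- `‖φ τ‖ ≥ 3/4`, against the requested `1/2`. Since `N` is independent of `A`, so is `τ`.
  set τ : ℝ := 1 / (8 * (N ^ 2 + 1)) with hτ
  have hτ0 : 0 < τ := by positivity
  have hNτ : N ^ 2 * τ ≤ 1 / 8 := by
    rw [hτ, mul_one_div, div_le_div_iff₀ (by positivity) (by norm_num)]
    linarith
  obtain ⟨A₀, hA₀, hA⟩ := hRE τ (1 / 2) hτ0 (by norm_num)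
  have hAp : 0 < A₀ + 1 := by linarith
  obtain ⟨⟨φ, hφ⟩, hall⟩ := hA (A₀ + 1) (by linarith) χ hχ1
  have hlt := hall φ hφ
  obtain ⟨C, hT⟩ := exists_isSymmField he.lam_pos hL h1 (A₀ + 1)
  have ty := hφ.isTraj he hτ0
  have tx := hU.isTraj he.lam_pos hL h1 h2 hAp (c := 0) (fun t => by rw [add_zero])
    (a := 0) (b := τ) hχ
  have hJ := tx.norm_integral_inner_le he.lam_pos hτ0.le ty (η := 1 / 4) (K := N) (by norm_num)
    fun t ht => hbound _ (by have := ht.1; positivity)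
  have hE := ty.integral_norm1_sq_le hT hτ0.le
  have hpair := tx.inner_sub_inner hT hτ0.le ty
  rw [hφ.initial, hχ1] at hE
  simp only [mul_zero, add_zero, zero_add, hU.zero_apply, hφ.initial, sub_zero] at hpair hJ
  have hone : inner ℂ χ χ = (1 : ℂ) := by rw [inner_self_eq_norm_sq_to_K, hχ1]; norm_num
  rw [hone] at hpair
  set J := ∫ s in (0 : ℝ)..τ, inner ℂ (sqrtGen e lam (U ((A₀ + 1) * s) χ)) (sqrtGen e lam (φ s))
  have hin : ‖inner ℂ (U ((A₀ + 1) * τ) χ) (φ τ)‖ ≤ ‖φ τ‖ := by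
    simpa [hχ1] using norm_inner_le_norm (𝕜 := ℂ) (U ((A₀ + 1) * τ) χ) (φ τ)
  have hsub : (1 : ℂ) = inner ℂ (U ((A₀ + 1) * τ) χ) (φ τ) + J := by
    simp only [Complex.ofReal_one] at hpair
    linear_combination -hpair
  have h1le : (1 : ℝ) ≤ ‖inner ℂ (U ((A₀ + 1) * τ) χ) (φ τ)‖ + ‖J‖ := by
    calc (1 : ℝ) = ‖(1 : ℂ)‖ := by simp
      _ ≤ _ := by rw [hsub]; exact norm_add_le _ _
  norm_num at hJ
  linarith

end RelaxationEnhancement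

/-! ### Covariance forms of tight random vectors -/

namespace RelaxationEnhancement

variable {H : Type*} [NormedAddCommGroup H] [InnerProductSpace ℂ H]
variable {α : Type*} [MeasurableSpace α]

/-- The sesquilinear form `(x, y) ↦ ∫ ⟨x, w⟩ ⟨w, y⟩` of a random vector `w`. -/
noncomputable def covForm (μ : Measure α) (w : α → H) (x y : H) : ℂ :=
  ∫ t, inner ℂ x (w t) * inner ℂ (w t) y ∂μ

/-- `w` takes values in the unit ball, and its `H¹` norm is square integrable. -/
structure IsTight (e : HilbertBasis ℕ ℂ H) (lam : ℕ → ℝ) (μ : Measure α) (K : ℝ)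
    (w : α → H) : Prop where
  measurable : AEStronglyMeasurable w μ
  norm_le : ∀ᵐ t ∂μ, ‖w t‖ ≤ 1
  memH1 : ∀ᵐ t ∂μ, MemH1 e lam (w t)
  integrable : Integrable (fun t => norm1 e lam (w t) ^ 2) μ
  integral_le : ∫ t, norm1 e lam (w t) ^ 2 ∂μ ≤ K

variable {e : HilbertBasis ℕ ℂ H} {lam : ℕ → ℝ} {μ : Measure α} {w : α → H}
  {K : ℝ}

theorem IsTight.measurable_inner (h : IsTight e lam μ K w) (x : H) :
    AEStronglyMeasurable (fun t => inner ℂ x (w t)) μ :=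
  (innerSL ℂ x).continuous.comp_aestronglyMeasurable h.measurable

theorem IsTight.measurable_inner' (h : IsTight e lam μ K w) (x : H) :
    AEStronglyMeasurable (fun t => inner ℂ (w t) x) μ := by
  refine (Complex.continuous_conj.comp_aestronglyMeasurable (h.measurable_inner x)).congr
    (ae_of_all _ fun t => ?_)
  exact inner_conj_symm _ _

theorem covForm_conj (x y : H) : starRingEnd ℂ (covForm μ w y x) = covForm μ w x y := by
  rw [covForm, covForm, ← integral_conj]
  refine integral_congr_ae (ae_of_all _ fun t => ?_)
  simp only [map_mul, inner_conj_symm]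
  ring

theorem covForm_self (x : H) :
    covForm μ w x x = ((∫ t, ‖inner ℂ x (w t)‖ ^ 2 ∂μ : ℝ) : ℂ) := by
  rw [covForm, ← integral_complex_ofReal]
  refine integral_congr_ae (ae_of_all _ fun t => ?_)
  simp only
  rw [← inner_conj_symm (w t) x, Complex.mul_conj']
  norm_cast

theorem covForm_smul_left (c : ℂ) (x y : H) :
    covForm μ w (c • x) y = starRingEnd ℂ c * covForm μ w x y := by
  rw [covForm, covForm, ← integral_const_mul]
  simp only [inner_smul_left, mul_assoc]

theorem covForm_smul_right (c : ℂ) (x y : H) :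
    covForm μ w x (c • y) = c * covForm μ w x y := by
  rw [covForm, covForm, ← integral_const_mul]
  simp only [inner_smul_right]
  congr 1; ext t; ring

variable [IsFiniteMeasure μ]

theorem IsTight.integrable_covForm (h : IsTight e lam μ K w) (x y : H) :
    Integrable (fun t => inner ℂ x (w t) * inner ℂ (w t) y) μ := by
  refine Integrable.of_bound ((h.measurable_inner x).mul (h.measurable_inner' y)) (‖x‖ * ‖y‖) ?_
  filter_upwards [h.norm_le] with t ht
  rw [norm_mul]
  refine mul_le_mul ((norm_inner_le_norm _ _).trans ?_) ((norm_inner_le_norm _ _).trans ?_)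
    (norm_nonneg _) (norm_nonneg _)
  · exact mul_le_of_le_one_right (norm_nonneg _) ht
  · exact mul_le_of_le_one_left (norm_nonneg _) ht

theorem IsTight.norm_covForm_le (h : IsTight e lam μ K w) (x y : H) :
    ‖covForm μ w x y‖ ≤ μ.real univ * ‖x‖ * ‖y‖ := by
  have := norm_integral_le_of_norm_le_const (μ := μ) (C := ‖x‖ * ‖y‖)
    (f := fun t => inner ℂ x (w t) * inner ℂ (w t) y) (by
      filter_upwards [h.norm_le] with t ht
      rw [norm_mul]
      refine mul_le_mul ((norm_inner_le_norm _ _).trans ?_) ((norm_inner_le_norm _ _).trans ?_)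
        (norm_nonneg _) (norm_nonneg _)
      · exact mul_le_of_le_one_right (norm_nonneg _) ht
      · exact mul_le_of_le_one_left (norm_nonneg _) ht)
  calc _ ≤ _ := this
    _ = _ := by ring

theorem IsTight.covForm_add_left (h : IsTight e lam μ K w) (x x' y : H) :
    covForm μ w (x + x') y = covForm μ w x y + covForm μ w x' y := by
  rw [covForm, covForm, covForm,
    ← integral_add (h.integrable_covForm _ _) (h.integrable_covForm _ _)]
  simp only [inner_add_left, add_mul]

theorem IsTight.covForm_add_right (h : IsTight e lam μ K w) (x y y' : H) :
    covForm μ w x (y + y') = covForm μ w x y + covForm μ w x y' := by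
  rw [covForm, covForm, covForm,
    ← integral_add (h.integrable_covForm _ _) (h.integrable_covForm _ _)]
  simp only [inner_add_right, mul_add]

/-- The truncation moves onto `w`, whose tail is at most `‖w‖₁/√λ_N`; then `‖w‖₁ ≤ 1 + ‖w‖₁²` brings
in the integrable quantity. Uniformity over a tight family gives compactness of the limit. -/
theorem IsTight.norm_covForm_sub_proj_le (hlam : ∀ j, 0 < lam j) (hmono : Monotone lam)
    (h : IsTight e lam μ K w) (N : ℕ) (x y : H) :
    ‖covForm μ w (x - proj e N x) y‖ ≤ (μ.real univ + K) / √(lam N) * ‖x‖ * ‖y‖ := by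
  have hint : Integrable (fun t => (1 + norm1 e lam (w t) ^ 2) / √(lam N) * ‖x‖ * ‖y‖) μ :=
    (((((integrable_const (1 : ℝ)).add h.integrable).div_const _).mul_const _).mul_const _)
  have hs : 0 < √(lam N) := Real.sqrt_pos.2 (hlam N)
  have := norm_integral_le_of_norm_le (μ := μ)
    (f := fun t => inner ℂ (x - proj e N x) (w t) * inner ℂ (w t) y) hint (by
      filter_upwards [h.norm_le, h.memH1] with t ht ht1
      have hsub : inner ℂ (x - proj e N x) (w t) = inner ℂ x (w t - proj e N (w t)) := by
        rw [inner_sub_left, inner_sub_right, inner_proj_left, inner_proj_right]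
      rw [norm_mul, hsub]
      have b1 : ‖w t - proj e N (w t)‖ ≤ (1 + norm1 e lam (w t) ^ 2) / √(lam N) := by
        rw [le_div_iff₀ hs]
        have h2 := norm_sub_proj_sq_le hlam hmono ht1 N
        have h3 : ‖w t - proj e N (w t)‖ * √(lam N) ≤ norm1 e lam (w t) := by
          refine (sq_le_sq₀ (by positivity) (norm1_nonneg _)).1 ?_
          rw [mul_pow, Real.sq_sqrt (hlam N).le, mul_comm]
          exact h2
        nlinarith [sq_nonneg (norm1 e lam (w t) - 1)]
      have b2 : ‖inner ℂ x (w t - proj e N (w t))‖ ≤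
          (1 + norm1 e lam (w t) ^ 2) / √(lam N) * ‖x‖ := by
        refine (norm_inner_le_norm _ _).trans ?_
        rw [mul_comm]
        exact mul_le_mul_of_nonneg_right b1 (norm_nonneg _)
      refine mul_le_mul b2 ((norm_inner_le_norm _ _).trans
        (mul_le_of_le_one_left (norm_nonneg _) ht)) (norm_nonneg _) (by positivity))
  refine this.trans ?_
  rw [integral_mul_const, integral_mul_const, integral_div,
    integral_add (integrable_const _) h.integrable, integral_const, smul_eq_mul, mul_one]
  gcongr
  exact h.integral_le

/-- Cauchy–Schwarz against the constant `1`, as nonnegativity of the variance. -/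
theorem sq_integral_le {f : α → ℝ} (hf : Integrable f μ) (hf2 : Integrable (fun t => f t ^ 2) μ) :
    (∫ t, f t ∂μ) ^ 2 ≤ μ.real univ * ∫ t, f t ^ 2 ∂μ := by
  rcases eq_or_lt_of_le (measureReal_nonneg (μ := μ) (s := univ)) with h0 | hpos
  · have : μ = 0 := by
      rw [← Measure.measure_univ_eq_zero]
      exact (measureReal_eq_zero_iff (measure_ne_top _ _)).1 h0.symm
    simp [this]
  · set m := μ.real univ
    set c := (∫ t, f t ∂μ) / m with hc
    have h0 : 0 ≤ ∫ t, (f t - c) ^ 2 ∂μ := integral_nonneg fun t => sq_nonneg _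
    have h1 : ∫ t, (f t - c) ^ 2 ∂μ = (∫ t, f t ^ 2 ∂μ) - 2 * c * (∫ t, f t ∂μ) + c ^ 2 * m := by
      have : (fun t => (f t - c) ^ 2) = fun t => f t ^ 2 - 2 * c * f t + c ^ 2 := by
        ext t; ring
      rw [this, integral_add (f := fun t => f t ^ 2 - 2 * c * f t) (hf2.sub (hf.const_mul _))
        (integrable_const _),
        integral_sub hf2 (hf.const_mul _), integral_const_mul, integral_const, smul_eq_mul,
        mul_comm (c ^ 2)]
    have h2 : (∫ t, f t ∂μ) = c * m := by rw [hc]; field_simp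
    rw [h1, h2] at h0
    rw [h2]
    nlinarith

/-- An `H¹` bound for the covariance operator applied to `y`, stated for partial sums so that it
survives a weak limit. -/
theorem IsTight.sum_norm_covForm_sq_le (hlam : ∀ j, 0 < lam j) (h : IsTight e lam μ K w) (y : H)
    (N : ℕ) : ∑ j ∈ Finset.range N, lam j * ‖covForm μ w (e j) y‖ ^ 2 ≤
      μ.real univ * K * ‖y‖ ^ 2 := by
  have hmeas : ∀ j, AEStronglyMeasurable (fun t => ‖e.repr (w t) j‖) μ := fun j =>
    (h.measurable.repr j).norm
  have hb : ∀ᵐ t ∂μ, ∀ j, ‖e.repr (w t) j‖ ≤ 1 := by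
    filter_upwards [h.norm_le] with t ht j
    exact (norm_repr_le e _ j).trans ht
  have hi1 : ∀ j, Integrable (fun t => ‖e.repr (w t) j‖) μ := fun j => by
    refine Integrable.of_bound (hmeas j) 1 ?_
    filter_upwards [hb] with t ht
    rw [norm_norm]; exact ht j
  have hi2 : ∀ j, Integrable (fun t => ‖e.repr (w t) j‖ ^ 2) μ := fun j => by
    refine Integrable.of_bound ((hmeas j).pow 2) 1 ?_
    filter_upwards [hb] with t ht
    rw [norm_pow, norm_norm]; exact pow_le_one₀ (norm_nonneg _) (ht j)
  have h1 : ∀ j, ‖covForm μ w (e j) y‖ ^ 2 ≤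
      ‖y‖ ^ 2 * (μ.real univ * ∫ t, ‖e.repr (w t) j‖ ^ 2 ∂μ) := by
    intro j
    have hle : ‖covForm μ w (e j) y‖ ≤ ∫ t, ‖e.repr (w t) j‖ * ‖y‖ ∂μ := by
      refine norm_integral_le_of_norm_le ((hi1 j).mul_const _) ?_
      filter_upwards [h.norm_le] with t ht
      rw [norm_mul, e.repr_apply_apply]
      exact mul_le_mul_of_nonneg_left ((norm_inner_le_norm _ _).trans
        (mul_le_of_le_one_left (norm_nonneg _) ht)) (norm_nonneg _)
    rw [integral_mul_const] at hle
    calc ‖covForm μ w (e j) y‖ ^ 2 ≤ ((∫ t, ‖e.repr (w t) j‖ ∂μ) * ‖y‖) ^ 2 :=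
          pow_le_pow_left₀ (norm_nonneg _) hle 2
      _ = ‖y‖ ^ 2 * (∫ t, ‖e.repr (w t) j‖ ∂μ) ^ 2 := by ring
      _ ≤ _ := mul_le_mul_of_nonneg_left (sq_integral_le (hi1 j) (hi2 j)) (sq_nonneg _)
  have hsum : ∑ j ∈ Finset.range N, lam j * ∫ t, ‖e.repr (w t) j‖ ^ 2 ∂μ ≤ K := by
    refine le_trans ?_ h.integral_le
    simp only [← integral_const_mul]
    rw [← integral_finsetSum _ fun j _ => (hi2 j).const_mul _]
    refine integral_mono_ae (integrable_finsetSum _ fun j _ => (hi2 j).const_mul _)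
      h.integrable ?_
    filter_upwards [h.memH1] with t ht
    exact sum_le_hasSum _ (fun j _ => mul_nonneg (hlam j).le (sq_nonneg _))
      (hasSum_norm1_sq hlam ht)
  calc _ ≤ ∑ j ∈ Finset.range N,
        lam j * (‖y‖ ^ 2 * (μ.real univ * ∫ t, ‖e.repr (w t) j‖ ^ 2 ∂μ)) :=
        Finset.sum_le_sum fun j _ => mul_le_mul_of_nonneg_left (h1 j) (hlam j).le
    _ = ‖y‖ ^ 2 * μ.real univ * ∑ j ∈ Finset.range N,
        lam j * ∫ t, ‖e.repr (w t) j‖ ^ 2 ∂μ := by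
        rw [Finset.mul_sum]; exact Finset.sum_congr rfl fun j _ => by ring
    _ ≤ ‖y‖ ^ 2 * μ.real univ * K := mul_le_mul_of_nonneg_left hsum (by positivity)
    _ = _ := by ring

/-- The full trace is `∫‖w‖²`, and the modes beyond `N` carry at most `K/λ_N` of it. So mass cannot
escape to high modes, and the limit operator cannot vanish. -/
theorem IsTight.le_re_sum_covForm (hlam : ∀ j, 0 < lam j) (hmono : Monotone lam)
    (h : IsTight e lam μ K w) {δ : ℝ} (hδ : 0 ≤ δ) (hge : ∀ᵐ t ∂μ, δ ≤ ‖w t‖) (N : ℕ) :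
    μ.real univ * δ ^ 2 - K / lam N ≤
      (∑ j ∈ Finset.range N, covForm μ w (e j) (e j)).re := by
  have hi : ∀ j, Integrable (fun t => ‖inner ℂ (e j) (w t)‖ ^ 2) μ := fun j => by
    refine Integrable.of_bound ((h.measurable_inner (e j)).norm.pow 2) 1 ?_
    filter_upwards [h.norm_le] with t ht
    rw [norm_pow, norm_norm]
    refine pow_le_one₀ (norm_nonneg _) ?_
    rw [← e.repr_apply_apply]
    exact (norm_repr_le e _ j).trans ht
  simp only [covForm_self]
  rw [← Complex.ofReal_sum, Complex.ofReal_re, ← integral_finsetSum _ fun j _ => hi j]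
  have hK : (∫ t, norm1 e lam (w t) ^ 2 ∂μ) / lam N ≤ K / lam N :=
    div_le_div_of_nonneg_right h.integral_le (hlam N).le
  have hlow : ∫ t, (δ ^ 2 - norm1 e lam (w t) ^ 2 / lam N) ∂μ ≤
      ∫ t, ∑ j ∈ Finset.range N, ‖inner ℂ (e j) (w t)‖ ^ 2 ∂μ := by
    refine integral_mono_ae ((integrable_const _).sub (h.integrable.div_const _))
      (integrable_finsetSum _ fun j _ => hi j) ?_
    filter_upwards [hge, h.memH1] with t ht ht1
    have h2 := norm_sub_proj_sq_le hlam hmono ht1 N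
    rw [mul_comm, ← le_div_iff₀ (hlam N)] at h2
    have h3 : δ ^ 2 ≤ ‖w t‖ ^ 2 := pow_le_pow_left₀ hδ ht 2
    have h4 : ∑ j ∈ Finset.range N, ‖inner ℂ (e j) (w t)‖ ^ 2 =
        ‖w t‖ ^ 2 - ‖w t - proj e N (w t)‖ ^ 2 := by
      have hA := (hasSum_norm_repr_sq e (w t)).sub
        (hasSum_norm_repr_sq e (w t - proj e N (w t)))
      rw [← hA.tsum_eq, tsum_eq_sum (s := Finset.range N)]
      · refine Finset.sum_congr rfl fun j hj => ?_
        rw [map_sub, lp.coeFn_sub, Pi.sub_apply, repr_proj, if_pos (Finset.mem_range.1 hj),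
          e.repr_apply_apply]
        simp
      · intro j hj
        rw [map_sub, lp.coeFn_sub, Pi.sub_apply, repr_proj,
          if_neg (fun h => hj (Finset.mem_range.2 h))]
        simp
    rw [h4]
    linarith
  rw [integral_sub (integrable_const _) (h.integrable.div_const _), integral_const, smul_eq_mul,
    integral_div] at hlow
  linarith

end RelaxationEnhancement

/-! ### Weak limits of covariances and the eigenvector they produce -/

namespace RelaxationEnhancement

variable {H : Type*} [NormedAddCommGroup H] [InnerProductSpace ℂ H]
variable {e : HilbertBasis ℕ ℂ H} {lam : ℕ → ℝ}
variable {α : Type*} [MeasurableSpace α] {μ : Measure α} {w : ℕ → α → H}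
  {K : ℝ}

theorem isSymmetric_limit_operator
    {T : H →L[ℂ] H} {𝒰 : Ultrafilter ℕ}
    (hT : ∀ x y, Tendsto (fun n => covForm μ (w n) x y) 𝒰 (𝓝 (inner ℂ (T x) y))) :
    (T : H →ₗ[ℂ] H).IsSymmetric := by
  intro x y
  refine tendsto_nhds_unique (hT x y) ?_
  have := (Complex.continuous_conj.tendsto _).comp (hT y x)
  rw [inner_conj_symm] at this
  exact this.congr fun n => covForm_conj x y

variable [IsFiniteMeasure μ]

theorem isCompactOperator_proj (N : ℕ) : IsCompactOperator (proj e N) := by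
  have : proj e N ∈ compactOperator (RingHom.id ℂ) H H := by
    refine Submodule.sum_mem _ fun j _ => ?_
    exact (isCompactOperator_of_locallyCompactSpace_dom (innerSL ℂ (e j))).clm_comp
      (ContinuousLinearMap.toSpanSingleton ℂ (e j))
  exact this

/-- Covariance operators of vectors bounded in `H` have weak limits along ultrafilters. -/
theorem exists_limit_operator [CompleteSpace H] (h : ∀ n, IsTight e lam μ K (w n))
    (𝒰 : Ultrafilter ℕ) :
    ∃ T : H →L[ℂ] H, ∀ x y,
      Tendsto (fun n => covForm μ (w n) x y) 𝒰 (𝓝 (inner ℂ (T x) y)) := by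
  have hex : ∀ x y, ∃ z, ‖z‖ ≤ μ.real univ * ‖x‖ * ‖y‖ ∧
      Tendsto (fun n => covForm μ (w n) x y) 𝒰 (𝓝 z) := by
    intro x y
    obtain ⟨z, hz, hlim⟩ := (isCompact_closedBall (0 : ℂ)
      -- Each scalar covariance stays in a fixed disc, so one ultrafilter gives limits for all pairs
      -- at once, without a diagonal subsequence. Uniqueness of limits then makes the limit form
      -- sesquilinear.
      (μ.real univ * ‖x‖ * ‖y‖)).ultrafilter_le_nhds
      (𝒰.map fun n => covForm μ (w n) x y) (by
        rw [le_principal_iff]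
        refine Filter.mem_map.2 (Filter.univ_mem' fun n => ?_)
        simpa using (h n).norm_covForm_le x y)
    exact ⟨z, by simpa using hz, hlim⟩
  choose b hb hlim using hex
  let B : H →ₗ⋆[ℂ] H →ₗ[ℂ] ℂ := LinearMap.mk₂'ₛₗ (starRingEnd ℂ) (RingHom.id ℂ) b
    (fun x x' y => tendsto_nhds_unique (hlim (x + x') y) (((hlim x y).add (hlim x' y)).congr
      fun n => ((h n).covForm_add_left x x' y).symm))
    (fun c x y => tendsto_nhds_unique (hlim (c • x) y) (((hlim x y).const_mul _).congr
      fun n => (covForm_smul_left c x y).symm))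
    (fun x y y' => tendsto_nhds_unique (hlim x (y + y')) (((hlim x y).add (hlim x y')).congr
      fun n => ((h n).covForm_add_right x y y').symm))
    (fun c x y => tendsto_nhds_unique (hlim x (c • y)) (((hlim x y).const_mul _).congr
      fun n => (covForm_smul_right c x y).symm))
  refine ⟨InnerProductSpace.continuousLinearMapOfBilin
    (B.mkContinuous₂ (μ.real univ) fun x y => hb x y), fun x y => ?_⟩
  rw [InnerProductSpace.continuousLinearMapOfBilin_apply]
  exact hlim x y

section Limit

variable {T : H →L[ℂ] H} {𝒰 : Ultrafilter ℕ}

/-- The uniform tail bound passes to the limit and makes `T` an operator-norm limit of the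
finite-rank operators `T ∘ P_N`. Testing `(TP_N - T)x` against itself turns the bound on forms into
a bound on norms. -/
theorem isCompactOperator_limit_operator [CompleteSpace H] (hlam : ∀ j, 0 < lam j)
    (hmono : Monotone lam)
    (htend : Tendsto lam atTop atTop) (h : ∀ n, IsTight e lam μ K (w n))
    (hT : ∀ x y, Tendsto (fun n => covForm μ (w n) x y) 𝒰 (𝓝 (inner ℂ (T x) y))) :
    IsCompactOperator T := by
  have hK : 0 ≤ K := le_trans (integral_nonneg fun t => sq_nonneg _) (h 0).integral_le
  refine isCompactOperator_of_tendsto (l := atTop) (F := fun N => T ∘L proj e N) ?_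
    (Eventually.of_forall fun N => (isCompactOperator_proj N).clm_comp T)
  rw [tendsto_iff_norm_sub_tendsto_zero]
  have hlim : Tendsto (fun N => (μ.real univ + K) / √(lam N)) atTop (𝓝 0) :=
    Tendsto.div_atTop tendsto_const_nhds (Real.tendsto_sqrt_atTop.comp htend)
  refine squeeze_zero (fun N => norm_nonneg _) (fun N => ?_) hlim
  refine ContinuousLinearMap.opNorm_le_bound _ (by positivity) fun x => ?_
  set z := (T ∘L proj e N - T) x with hz
  have hzx : z = -T (x - proj e N x) := by simp [hz]
  have h1 : ‖inner ℂ (T (x - proj e N x)) z‖ ≤ (μ.real univ + K) / √(lam N) * ‖x‖ * ‖z‖ :=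
    le_of_tendsto (hT (x - proj e N x) z).norm (Eventually.of_forall fun n =>
      (h n).norm_covForm_sub_proj_le hlam hmono N x z)
  have h2 : ‖inner ℂ (T (x - proj e N x)) z‖ = ‖z‖ * ‖z‖ := by
    have : T (x - proj e N x) = -z := by rw [hzx, neg_neg]
    rw [this, inner_neg_left, norm_neg, inner_self_eq_norm_sq_to_K, norm_pow]
    simp [sq]
  rw [h2] at h1
  rcases eq_or_lt_of_le (norm_nonneg z) with h0 | h0
  · rw [← h0]; positivity
  · exact le_of_mul_le_mul_right h1 h0

/-- A finite truncated trace is continuous under weak limits; for `N` large its lower bound is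
strictly positive. -/
theorem limit_operator_ne_zero (hlam : ∀ j, 0 < lam j) (hmono : Monotone lam)
    (htend : Tendsto lam atTop atTop) (h : ∀ n, IsTight e lam μ K (w n))
    (hT : ∀ x y, Tendsto (fun n => covForm μ (w n) x y) 𝒰 (𝓝 (inner ℂ (T x) y)))
    (hμ : μ ≠ 0) {δ : ℝ} (hδ : 0 < δ) (hge : ∀ n, ∀ᵐ t ∂μ, δ ≤ ‖w n t‖) : T ≠ 0 := by
  rintro rfl
  have : NeZero μ := ⟨hμ⟩
  have hm : 0 < μ.real univ := measureReal_univ_pos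
  have hlim0 : Tendsto (fun N => K / lam N) atTop (𝓝 0) :=
    Tendsto.div_atTop tendsto_const_nhds htend
  obtain ⟨N, hN⟩ := (hlim0.eventually_lt_const (u := μ.real univ * δ ^ 2) (by positivity)).exists
  have hsum : Tendsto (fun n => (∑ j ∈ Finset.range N, covForm μ (w n) (e j) (e j)).re) 𝒰
      (𝓝 (∑ j ∈ Finset.range N, inner ℂ ((0 : H →L[ℂ] H) (e j)) (e j)).re) :=
    (Complex.continuous_re.tendsto _).comp (tendsto_finsetSum _ fun j _ => hT (e j) (e j))
  have := ge_of_tendsto hsum (Eventually.of_forall fun n =>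
    (h n).le_re_sum_covForm hlam hmono hδ.le (hge n) N)
  simp at this
  linarith

theorem memH1_of_limit_operator (hlam : ∀ j, 0 < lam j) (h : ∀ n, IsTight e lam μ K (w n))
    (hT : ∀ x y, Tendsto (fun n => covForm μ (w n) x y) 𝒰 (𝓝 (inner ℂ (T x) y)))
    (y : H) : MemH1 e lam (T y) := by
  refine summable_of_sum_range_le (c := μ.real univ * K * ‖y‖ ^ 2)
    (fun j => mul_nonneg (hlam j).le (sq_nonneg _)) fun N => ?_
  have hsymm := isSymmetric_limit_operator hT
  have hlim : Tendsto (fun n => ∑ j ∈ Finset.range N, lam j * ‖covForm μ (w n) (e j) y‖ ^ 2) 𝒰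
      (𝓝 (∑ j ∈ Finset.range N, lam j * ‖inner ℂ (T (e j)) y‖ ^ 2)) :=
    tendsto_finsetSum _ fun j _ => (((hT (e j) y).norm.pow 2).const_mul _)
  have heq : ∑ j ∈ Finset.range N, lam j * ‖e.repr (T y) j‖ ^ 2 =
      ∑ j ∈ Finset.range N, lam j * ‖inner ℂ (T (e j)) y‖ ^ 2 := by
    refine Finset.sum_congr rfl fun j _ => ?_
    rw [e.repr_apply_apply]
    congr 3
    exact (hsymm (e j) y).symm
  rw [heq]
  exact le_of_tendsto hlim (Eventually.of_forall fun n =>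
    (h n).sum_norm_covForm_sq_le hlam y N)

end Limit

/-- If a unitary operator `V` asymptotically preserves the covariances of a tight sequence of
random vectors that stay away from zero, then `V` has an eigenvector in `H¹`. -/
theorem exists_eigenvector_of_asymptotically_invariant [CompleteSpace H] (hlam : ∀ j, 0 < lam j)
    (hmono : Monotone lam) (htend : Tendsto lam atTop atTop) (V : H ≃ₗᵢ[ℂ] H)
    (h : ∀ n, IsTight e lam μ K (w n)) (hμ : μ ≠ 0) {δ : ℝ} (hδ : 0 < δ)
    (hge : ∀ n, ∀ᵐ t ∂μ, δ ≤ ‖w n t‖)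
    (hinv : ∀ x, Tendsto (fun n => (∫ t, ‖inner ℂ x (V (w n t))‖ ^ 2 ∂μ) -
      ∫ t, ‖inner ℂ x (w n t)‖ ^ 2 ∂μ) atTop (𝓝 0)) :
    ∃ (ν : ℂ) (ψ : H), ψ ≠ 0 ∧ MemH1 e lam ψ ∧ V ψ = ν • ψ := by
  obtain ⟨T, hT⟩ := exists_limit_operator h (hyperfilter ℕ)
  have hsymm := isSymmetric_limit_operator hT
  have hcomp := isCompactOperator_limit_operator hlam hmono htend h hT
  have hne := limit_operator_ne_zero hlam hmono htend h hT hμ hδ hge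
  have hcomm : ∀ x, V (T x) = T (V x) := by
    -- Asymptotic invariance is assumed only for quadratic forms; in the limit, complex polarization
    -- (`ext_inner_map`) upgrades it to `V T V⁻¹ = T`.
    have hq : ∀ x, inner ℂ (T (V.symm x)) (V.symm x) = inner ℂ (T x) x := by
      intro x
      have h1 := (hT (V.symm x) (V.symm x)).sub (hT x x)
      have h2 : Tendsto (fun n => covForm μ (w n) (V.symm x) (V.symm x) - covForm μ (w n) x x)
          (hyperfilter ℕ) (𝓝 0) := by
        have := (Complex.continuous_ofReal.tendsto 0).comp
          ((hinv x).mono_left Nat.hyperfilter_le_atTop)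
        rw [Complex.ofReal_zero] at this
        refine this.congr fun n => ?_
        have hfun : ∀ t, inner ℂ (V.symm x) (w n t) = inner ℂ x (V (w n t)) := fun t => by
          rw [← LinearIsometryEquiv.inner_map_map V (V.symm x),
            LinearIsometryEquiv.apply_symm_apply]
        rw [covForm_self, covForm_self, Function.comp_apply, Complex.ofReal_sub]
        simp only [hfun]
      exact sub_eq_zero.1 (tendsto_nhds_unique h1 h2)
    have heq := (ext_inner_map
      ((V.toLinearEquiv : H →ₗ[ℂ] H) ∘ₗ (T : H →ₗ[ℂ] H) ∘ₗ (V.symm.toLinearEquiv : H →ₗ[ℂ] H))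
      (T : H →ₗ[ℂ] H)).1 fun x => by
        rw [ContinuousLinearMap.coe_coe, ← hq x, ← LinearIsometryEquiv.inner_map_map V (T _),
          LinearIsometryEquiv.apply_symm_apply]
        rfl
    intro x
    have := congrArg (fun f : H →ₗ[ℂ] H => f (V x)) heq
    simpa using this
  obtain ⟨c, hc, hc0⟩ : ∃ c, Module.End.HasEigenvalue (T : Module.End ℂ H) c ∧ c ≠ 0 := by
    by_contra! hno
    exact hne ((ContinuousLinearMap.eq_zero_of_forall_hasEigenvalue_eq_zero hcomp hsymm).1 hno)
  let E := Module.End.eigenspace (T : Module.End ℂ H) c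
  have hfin : FiniteDimensional ℂ E := ContinuousLinearMap.finite_dimensional_eigenspace hcomp c hc0
  have hnt : Nontrivial E := (Submodule.nontrivial_iff_ne_bot).2 hc
  have hmaps : ∀ x ∈ E, (V.toLinearEquiv : H →ₗ[ℂ] H) x ∈ E := by
    intro x hx
    rw [Module.End.mem_eigenspace_iff] at hx ⊢
    have hx' : T x = c • x := hx
    change T (V x) = c • V x
    rw [← hcomm, hx', map_smul]
  obtain ⟨ν, hν⟩ := Module.End.exists_eigenvalue ((V.toLinearEquiv : H →ₗ[ℂ] H).restrict hmaps)
  obtain ⟨ψ, hψ⟩ := hν.exists_hasEigenvector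
  have hTψ : T (ψ : H) = c • (ψ : H) := Module.End.mem_eigenspace_iff.1 ψ.2
  refine ⟨ν, ψ, fun h0 => hψ.2 (Subtype.ext h0), ?_, congrArg Subtype.val hψ.apply_eq_smul⟩
  -- As `c ≠ 0`, the vector lies in the range of `T`, hence in `H¹`.
  have : (ψ : H) = c⁻¹ • T (ψ : H) := by rw [hTψ, smul_smul, inv_mul_cancel₀ hc0, one_smul]
  rw [this]
  exact memH1_smul _ (memH1_of_limit_operator hlam h hT _)

end RelaxationEnhancement

/-! ### Pulled-back trajectories and enhanced dissipation -/

namespace RelaxationEnhancement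

/-- Comparing `G(t)` with `g(t+h)` leaves two unmatched pieces, the last stretch of `G` and the
first of `g`, each of length `h` and contributing at most `B * h`. -/
theorem abs_integral_sub_integral_le_of_shift {G g b : ℝ → ℝ} {τ h B : ℝ} (h0 : 0 ≤ h) (hτ : h ≤ τ)
    (hG : IntervalIntegrable G volume 0 τ) (hg : IntervalIntegrable g volume 0 τ)
    (hb : IntervalIntegrable b volume 0 τ) (hb0 : ∀ t, 0 ≤ b t)
    (hGB : ∀ t ∈ Ioc 0 τ, |G t| ≤ B) (hgB : ∀ t ∈ Ioc 0 τ, |g t| ≤ B)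
    (hshift : ∀ᵐ t, t ∈ Ioc 0 (τ - h) → |G t - g (t + h)| ≤ b t) :
    |(∫ t in (0 : ℝ)..τ, G t) - ∫ t in (0 : ℝ)..τ, g t| ≤
      (∫ t in (0 : ℝ)..τ, b t) + 2 * B * h := by
  have hτ0 : 0 ≤ τ := h0.trans hτ
  have hτh : 0 ≤ τ - h := sub_nonneg.2 hτ
  have sub1 : ∀ {f : ℝ → ℝ}, IntervalIntegrable f volume 0 τ → ∀ {s t}, 0 ≤ s → s ≤ t → t ≤ τ →
      IntervalIntegrable f volume s t := fun hf s t h1 h2 h3 => hf.mono_set (by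
    rw [uIcc_of_le h2, uIcc_of_le hτ0]; exact Icc_subset_Icc h1 h3)
  have e1 := intervalIntegral.integral_add_adjacent_intervals
    (sub1 hG le_rfl hτh (by linarith)) (sub1 hG hτh (by linarith) le_rfl)
  have e2 := intervalIntegral.integral_add_adjacent_intervals
    (sub1 hg le_rfl h0 hτ) (sub1 hg h0 hτ le_rfl)
  have e3 : ∫ t in h..τ, g t = ∫ t in (0 : ℝ)..(τ - h), g (t + h) := by
    rw [intervalIntegral.integral_comp_add_right]; simp
  have hgs : IntervalIntegrable (fun t => g (t + h)) volume 0 (τ - h) := by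
    have := (sub1 hg h0 hτ le_rfl).comp_add_right h
    simpa using this
  have n1 : |∫ t in (0 : ℝ)..(τ - h), (G t - g (t + h))| ≤ ∫ t in (0 : ℝ)..τ, b t := by
    refine (intervalIntegral.norm_integral_le_of_norm_le (f := fun t => G t - g (t + h)) hτh hshift
      (sub1 hb le_rfl hτh (by linarith))).trans ?_
    exact intervalIntegral.integral_mono_interval le_rfl hτh (by linarith)
      (ae_of_all _ hb0) hb
  have n2 : |∫ t in (τ - h)..τ, G t| ≤ B * h := by
    have := intervalIntegral.norm_integral_le_of_norm_le_const (a := τ - h) (b := τ) (f := G)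
      (C := B) fun t ht => by
        rw [uIoc_of_le (by linarith)] at ht
        exact hGB t ⟨by linarith [ht.1], ht.2⟩
    rwa [sub_sub_cancel, abs_of_nonneg h0] at this
  have n3 : |∫ t in (0 : ℝ)..h, g t| ≤ B * h := by
    have := intervalIntegral.norm_integral_le_of_norm_le_const (a := 0) (b := h) (f := g)
      (C := B) fun t ht => by
        rw [uIoc_of_le h0] at ht
        exact hgB t ⟨ht.1, ht.2.trans hτ⟩
    rwa [sub_zero, abs_of_nonneg h0] at this
  rw [intervalIntegral.integral_sub (sub1 hG le_rfl hτh (by linarith)) hgs, ← e3] at n1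
  rw [← e1, ← e2]
  rw [abs_le] at *
  constructor <;> linarith [n1.1, n1.2, n2.1, n2.2, n3.1, n3.2]

variable {H : Type*} [NormedAddCommGroup H] [InnerProductSpace ℂ H]
variable {e : HilbertBasis ℕ ℂ H} {lam : ℕ → ℝ} {U : ℝ → H ≃ₗᵢ[ℂ] H} {L : ℝ → H →ₗ.[ℂ] H}

/-- The trajectory `φ`, transported back by the free evolution to the beginning of the current
period. -/
noncomputable def pullback (U : ℝ → H ≃ₗᵢ[ℂ] H) (A : ℝ) (φ : ℝ → H) (t : ℝ) : H :=
  (U (Int.fract (A * t))).symm (φ t)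

theorem norm_pullback (A : ℝ) (φ : ℝ → H) (t : ℝ) : ‖pullback U A φ t‖ = ‖φ t‖ :=
  LinearIsometryEquiv.norm_map _ _

theorem Generates.symm_eq_propagator (hU : Generates e lam L U) (s : ℝ) (x : H) :
    (U s).symm x = propagator U 0 s x := by
  rw [propagator, LinearIsometryEquiv.trans_apply, hU.zero_apply]

section

variable {T : ℝ → H → H} {C : ℝ} {A τ M κ : ℝ} {φ : ℝ → H}

theorem Generates.isTight_pullback (hU : Generates e lam L U) (h2 : Condition2 e lam U)
    (hM : ∀ t s : ℝ, |t - s| ≤ 1 → ∀ ψ : H, MemH1 e lam ψ →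
      norm1 e lam (propagator U t s ψ) ≤ M * norm1 e lam ψ)
    (hT : IsSymmField e lam T C) (hτ : 0 ≤ τ) (hφ : IsTraj e lam T 1 0 τ φ) (hφ0 : ‖φ 0‖ = 1) :
    IsTight e lam (volume.restrict (Ioc 0 τ)) (M ^ 2 / 2) (pullback U A φ) := by
  have hmeasφ : AEStronglyMeasurable φ (volume.restrict (Ioc 0 τ)) :=
    aestronglyMeasurable_of_repr (hφ.aestronglyMeasurable_repr hτ)
  have hmeas : AEStronglyMeasurable (pullback U A φ) (volume.restrict (Ioc 0 τ)) := by
    refine aestronglyMeasurable_of_repr (e := e) fun j => ?_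
    have h1 : AEStronglyMeasurable (fun t => U (Int.fract (A * t)) (e j))
        (volume.restrict (Ioc 0 τ)) :=
      ((hU (e j)).continuous.stronglyMeasurable.comp_measurable
        (measurable_fract.comp (measurable_const_mul A))).aestronglyMeasurable
    refine (h1.inner (𝕜 := ℂ) hmeasφ).congr (ae_of_all _ fun t => ?_)
    simp only [pullback]
    rw [e.repr_apply_apply, ← LinearIsometryEquiv.inner_map_map (U (Int.fract (A * t))) (e j),
      LinearIsometryEquiv.apply_symm_apply]
  have hH1 : ∀ t, MemH1 e lam (φ t) → MemH1 e lam (pullback U A φ t) ∧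
      norm1 e lam (pullback U A φ t) ≤ M * norm1 e lam (φ t) := by
    intro t ht
    rw [pullback, hU.symm_eq_propagator]
    obtain ⟨B, -, hB⟩ := h2
    refine ⟨(hB _ _ _ ht).1, hM _ _ ?_ _ ht⟩
    rw [zero_sub, abs_neg, abs_of_nonneg (Int.fract_nonneg _)]
    exact (Int.fract_lt_one _).le
  have hmem : ∀ᵐ t ∂(volume.restrict (Ioc 0 τ)), MemH1 e lam (pullback U A φ t) := by
    filter_upwards [hφ.memH1] with t ht using (hH1 t ht).1
  have hle : ∀ᵐ t ∂(volume.restrict (Ioc 0 τ)), norm1 e lam (pullback U A φ t) ^ 2 ≤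
      M ^ 2 * norm1 e lam (φ t) ^ 2 := by
    filter_upwards [hφ.memH1] with t ht
    rw [← mul_pow]
    exact pow_le_pow_left₀ (norm1_nonneg _) (hH1 t ht).2 2
  have hint : Integrable (fun t => norm1 e lam (pullback U A φ t) ^ 2)
      (volume.restrict (Ioc 0 τ)) := by
    refine Integrable.mono' (hφ.normSq_integrable.const_mul (M ^ 2))
      ((aestronglyMeasurable_norm1 hT.pos (fun j => hmeas.repr j) hmem).pow 2) ?_
    filter_upwards [hle] with t ht
    rwa [Real.norm_of_nonneg (sq_nonneg _)]
  refine ⟨hmeas, ?_, hmem, hint, ?_⟩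
  · filter_upwards [ae_restrict_mem measurableSet_Ioc] with t ht
    rw [norm_pullback, ← hφ0]
    exact (hφ.mono le_rfl ht.1.le ht.2).norm_le hT ht.1.le
  · refine (integral_mono_ae hint (hφ.normSq_integrable.const_mul (M ^ 2)) hle).trans ?_
    rw [integral_const_mul, ← intervalIntegral.integral_of_le hτ]
    have := hφ.integral_norm1_sq_le hT hτ
    rw [hφ0] at this
    nlinarith [sq_nonneg M]

variable [CompleteSpace H]

/-- After one period, the pulled back trajectory has almost moved by the period map. -/
theorem Generates.norm_pullback_sub_le (hU : Generates e lam L U) (hlam : ∀ j, 0 < lam j)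
    (hL : ∀ t, IsSelfAdjoint (L t)) (hper : Function.Periodic L 1)
    (h1 : Condition1 e lam L) (h2 : Condition2 e lam U)
    (hM0 : 0 ≤ M) (hM : ∀ t s : ℝ, |t - s| ≤ 1 → ∀ ψ : H, MemH1 e lam ψ →
      norm1 e lam (propagator U t s ψ) ≤ M * norm1 e lam ψ)
    (hA : 0 < A) (hT : IsSymmField e lam (driftField L A) C)
    (hφ : IsTraj e lam (driftField L A) 1 0 τ φ) {t : ℝ} (ht0 : 0 ≤ t) (htτ : t + A⁻¹ ≤ τ)
    (ht : MemH1 e lam (φ t)) :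
    ‖U 1 (pullback U A φ t) - pullback U A φ (t + A⁻¹)‖ ≤
      M * √(A⁻¹ / 2) * norm1 e lam (φ t) := by
  have hAi : 0 < A⁻¹ := inv_pos.2 hA
  have hAt : A * (t + A⁻¹) = A * t + 1 := by rw [mul_add, mul_inv_cancel₀ hA.ne']
  have hAt0 : 0 ≤ A * t := by positivity
  -- The free orbit of `χ` meets `φ` at time `t`. Along the next period its `H¹` norm is bounded
  -- directly by that of `φ t`, since the propagator covers a phase of at most `1`.
  set χ := (U (A * t)).symm (φ t) with hχdef
  have hχ : MemH1 e lam χ := by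
    obtain ⟨B, -, hB⟩ := h2
    rw [hχdef, hU.symm_eq_propagator]
    exact (hB _ _ _ ht).1
  have tx := hU.isTraj hlam hL h1 h2 hA (c := 0) (fun t => by rw [add_zero])
    (a := t) (b := t + A⁻¹) hχ
  simp only [add_zero] at tx
  have ty := hφ.mono ht0 (by linarith) htτ
  have hcmp := tx.norm_sub_sq_le hT (by linarith) ty (by simp [hχdef])
    (K := M * norm1 e lam (φ t)) (fun r hr => by
      refine hM (A * r) (A * t) ?_ _ ht
      rw [← mul_sub, abs_of_nonneg (mul_nonneg hA.le (by linarith [hr.1]))]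
      have : A * (r - t) ≤ A * A⁻¹ := mul_le_mul_of_nonneg_left (by linarith [hr.2]) hA.le
      rwa [mul_inv_cancel₀ hA.ne'] at this)
  -- Time `A⁻¹` advances the phase `A t` by exactly one, so both pullbacks use the same fractional
  -- phase, and the extra factor is one period map.
  have hkey : U (Int.fract (A * t)) (U 1 (pullback U A φ t)) = U (A * (t + A⁻¹)) χ := by
    have e1 := hU.eq_fract_apply hlam hL hper h1 h2 hAt0 χ
    rw [hAt, hU.add_one_apply hlam hL hper h1 h2 hAt0,
      hU.eq_fract_apply hlam hL hper h1 h2 hAt0, ← Function.iterate_succ_apply,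
      Function.iterate_succ_apply', pullback]
    congr 2
    rw [LinearIsometryEquiv.symm_apply_eq, ← e1, hχdef, LinearIsometryEquiv.apply_symm_apply]
  have hfr : Int.fract (A * (t + A⁻¹)) = Int.fract (A * t) := by rw [hAt, Int.fract_add_one]
  have hnorm : ‖U 1 (pullback U A φ t) - pullback U A φ (t + A⁻¹)‖ =
      ‖φ (t + A⁻¹) - U (A * (t + A⁻¹)) χ‖ := by
    rw [← LinearIsometryEquiv.norm_map (U (Int.fract (A * t))), map_sub, hkey, norm_sub_rev]
    congr 2
    rw [pullback, hfr, LinearIsometryEquiv.apply_symm_apply]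
  rw [hnorm]
  refine (sq_le_sq₀ (norm_nonneg _)
    (mul_nonneg (mul_nonneg hM0 (Real.sqrt_nonneg _)) (norm1_nonneg _))).1 (hcmp.trans_eq ?_)
  rw [mul_pow, mul_pow, mul_pow, Real.sq_sqrt (by positivity)]
  ring

/-- The one-period error is integrated using `∫‖φ‖₁ ≤ τ + 1/2`, from the energy bound; the last term
comes from the two unmatched end pieces of length `A⁻¹`. Both vanish as `A → ∞`, uniformly in the
solution. -/
theorem Generates.abs_covariance_pullback_sub_le (hU : Generates e lam L U)
    (hlam : ∀ j, 0 < lam j)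
    (hL : ∀ t, IsSelfAdjoint (L t)) (hper : Function.Periodic L 1)
    (h1 : Condition1 e lam L) (h2 : Condition2 e lam U)
    (hM0 : 0 ≤ M) (hM : ∀ t s : ℝ, |t - s| ≤ 1 → ∀ ψ : H, MemH1 e lam ψ →
      norm1 e lam (propagator U t s ψ) ≤ M * norm1 e lam ψ)
    (hA : 0 < A) (hT : IsSymmField e lam (driftField L A) C) (hAτ : A⁻¹ ≤ τ)
    (hφ : IsTraj e lam (driftField L A) 1 0 τ φ) (hφ0 : ‖φ 0‖ = 1) (x : H) :
    |(∫ t in Ioc 0 τ, ‖inner ℂ x (U 1 (pullback U A φ t))‖ ^ 2) -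
      ∫ t in Ioc 0 τ, ‖inner ℂ x (pullback U A φ t)‖ ^ 2| ≤
      2 * ‖x‖ ^ 2 * M * √(A⁻¹ / 2) * (τ + 1 / 2) + 2 * ‖x‖ ^ 2 * A⁻¹ := by
  have hAi : 0 < A⁻¹ := inv_pos.2 hA
  have hτ : 0 ≤ τ := hAi.le.trans hAτ
  have htight := hU.isTight_pullback (A := A) h2 hM hT hτ hφ hφ0
  have hw1 : ∀ t ∈ Ioc 0 τ, ‖pullback U A φ t‖ ≤ 1 := fun t ht => by
    rw [norm_pullback, ← hφ0]
    exact (hφ.mono le_rfl ht.1.le ht.2).norm_le hT ht.1.le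
  have hbd : ∀ z : H, ‖z‖ ≤ 1 → ‖inner ℂ x z‖ ≤ ‖x‖ := fun z hz =>
    (norm_inner_le_norm _ _).trans (mul_le_of_le_one_right (norm_nonneg _) hz)
  have hGB : ∀ t ∈ Ioc 0 τ, |‖inner ℂ x (U 1 (pullback U A φ t))‖ ^ 2| ≤ ‖x‖ ^ 2 :=
    fun t ht => by
      rw [abs_of_nonneg (sq_nonneg _)]
      exact pow_le_pow_left₀ (norm_nonneg _)
        (hbd _ (by rw [LinearIsometryEquiv.norm_map]; exact hw1 t ht)) 2
  have hgB : ∀ t ∈ Ioc 0 τ, |‖inner ℂ x (pullback U A φ t)‖ ^ 2| ≤ ‖x‖ ^ 2 :=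
    fun t ht => by
      rw [abs_of_nonneg (sq_nonneg _)]
      exact pow_le_pow_left₀ (norm_nonneg _) (hbd _ (hw1 t ht)) 2
  have hG : IntervalIntegrable (fun t => ‖inner ℂ x (U 1 (pullback U A φ t))‖ ^ 2) volume 0 τ := by
    rw [intervalIntegrable_iff_integrableOn_Ioc_of_le hτ]
    refine Integrable.of_bound (AEStronglyMeasurable.pow (AEStronglyMeasurable.norm ?_) 2)
      (‖x‖ ^ 2) ((ae_restrict_mem measurableSet_Ioc).mono hGB)
    exact ((innerSL ℂ x).continuous.comp (U 1).continuous).comp_aestronglyMeasurable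
      htight.measurable
  have hg : IntervalIntegrable (fun t => ‖inner ℂ x (pullback U A φ t)‖ ^ 2) volume 0 τ := by
    rw [intervalIntegrable_iff_integrableOn_Ioc_of_le hτ]
    exact Integrable.of_bound ((htight.measurable_inner x).norm.pow 2) (‖x‖ ^ 2)
      ((ae_restrict_mem measurableSet_Ioc).mono hgB)
  have hn1 : IntervalIntegrable (fun t => norm1 e lam (φ t)) volume 0 τ :=
    (intervalIntegrable_iff_integrableOn_Ioc_of_le hτ).2 (hφ.norm1_integrable hlam hτ)
  have hn2 : IntervalIntegrable (fun t => norm1 e lam (φ t) ^ 2) volume 0 τ :=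
    (intervalIntegrable_iff_integrableOn_Ioc_of_le hτ).2 hφ.normSq_integrable
  have hshift : ∀ᵐ t, t ∈ Ioc 0 (τ - A⁻¹) →
      |‖inner ℂ x (U 1 (pullback U A φ t))‖ ^ 2 - ‖inner ℂ x (pullback U A φ (t + A⁻¹))‖ ^ 2| ≤
      2 * ‖x‖ ^ 2 * M * √(A⁻¹ / 2) * norm1 e lam (φ t) := by
    have hm := hφ.memH1
    rw [ae_restrict_iff' measurableSet_Ioc] at hm
    filter_upwards [hm] with t hmt ht
    have htτ : t ∈ Ioc 0 τ := ⟨ht.1, by linarith [ht.2]⟩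
    have ht'τ : t + A⁻¹ ∈ Ioc 0 τ := ⟨by linarith [ht.1], by linarith [ht.2]⟩
    have hd := hU.norm_pullback_sub_le hlam hL hper h1 h2 hM0 hM hA hT hφ ht.1.le ht'τ.2
      (hmt htτ)
    set p := inner ℂ x (U 1 (pullback U A φ t))
    set q := inner ℂ x (pullback U A φ (t + A⁻¹))
    have hp : ‖p‖ ≤ ‖x‖ := hbd _ (by rw [LinearIsometryEquiv.norm_map]; exact hw1 t htτ)
    have hq : ‖q‖ ≤ ‖x‖ := hbd _ (hw1 _ ht'τ)
    have hpq : |‖p‖ - ‖q‖| ≤ ‖x‖ * (M * √(A⁻¹ / 2) * norm1 e lam (φ t)) := by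
      refine (abs_norm_sub_norm_le _ _).trans ?_
      rw [← inner_sub_right]
      exact (norm_inner_le_norm _ _).trans (mul_le_mul_of_nonneg_left hd (norm_nonneg _))
    rw [sq_sub_sq, abs_mul, abs_of_nonneg (by positivity : 0 ≤ ‖p‖ + ‖q‖)]
    calc (‖p‖ + ‖q‖) * |‖p‖ - ‖q‖| ≤
          (‖x‖ + ‖x‖) * (‖x‖ * (M * √(A⁻¹ / 2) * norm1 e lam (φ t))) :=
          mul_le_mul (add_le_add hp hq) hpq (abs_nonneg _) (by positivity)
      _ = _ := by ring
  have hmain := abs_integral_sub_integral_le_of_shift hAi.le hAτ hG hg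
    (hn1.const_mul (2 * ‖x‖ ^ 2 * M * √(A⁻¹ / 2)))
    (fun t => mul_nonneg (by positivity) (norm1_nonneg _)) hGB hgB hshift
  rw [intervalIntegral.integral_of_le hτ, intervalIntegral.integral_of_le hτ,
    intervalIntegral.integral_const_mul] at hmain
  refine hmain.trans (add_le_add (mul_le_mul_of_nonneg_left ?_ (by positivity)) le_rfl)
  have hE := hφ.integral_norm1_sq_le hT hτ
  rw [hφ0] at hE
  calc ∫ t in (0 : ℝ)..τ, norm1 e lam (φ t) ≤ ∫ t in (0 : ℝ)..τ, (1 + norm1 e lam (φ t) ^ 2) :=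
        intervalIntegral.integral_mono_on hτ hn1 (intervalIntegrable_const.add hn2) fun t _ => by
          nlinarith [sq_nonneg (norm1 e lam (φ t) - 1), norm1_nonneg (e := e) (lam := lam) (φ t)]
    _ = τ + ∫ t in (0 : ℝ)..τ, norm1 e lam (φ t) ^ 2 := by
        rw [intervalIntegral.integral_add intervalIntegrable_const hn2]; simp
    _ ≤ τ + 1 / 2 := by linarith

/-- If the period map has no eigenvector in `H¹`, then the dissipation of all solutions with
initial data in the unit sphere is enhanced uniformly by a strong drift. -/
theorem exists_forall_norm_lt {Γ : H →ₗ.[ℂ] H} (he : IsEigenbasis Γ e lam)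
    (hL : ∀ t, IsSelfAdjoint (L t)) (hper : Function.Periodic L 1) (hU : Generates e lam L U)
    (h1 : Condition1 e lam L) (h2 : Condition2 e lam U)
    (hV : ¬ ∃ (ν : ℂ) (ψ : H), ψ ≠ 0 ∧ MemH1 e lam ψ ∧ U 1 ψ = ν • ψ) {τ δ : ℝ} (hτ : 0 < τ)
    (hδ : 0 < δ) : ∃ A₀ : ℝ, 0 < A₀ ∧ ∀ A : ℝ, A₀ < A → ∀ φ₀ : H, ‖φ₀‖ = 1 →
      ∀ φ : ℝ → H, IsSolution Γ e lam L A φ₀ φ → ‖φ τ‖ < δ := by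
  by_contra! hcon
  choose A hA φ₀ hφ₀ φ hφ hge using fun n : ℕ => hcon ((n : ℝ) + 1) (by positivity)
  have hApos : ∀ n, 0 < A n := fun n => lt_trans (by positivity) (hA n)
  have hinv : ∀ n, (A n)⁻¹ ≤ ((n : ℝ) + 1)⁻¹ := fun n => inv_anti₀ (by positivity) (hA n).le
  choose C hT using fun n => exists_isSymmField he.lam_pos hL h1 (A n)
  obtain ⟨M, hM0, hM⟩ := h2.exists_bound 1
  have ht : ∀ n, IsTraj e lam (driftField L (A n)) 1 0 τ (φ n) := fun n => (hφ n).isTraj he hτ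
  have h0 : ∀ n, ‖φ n 0‖ = 1 := fun n => by rw [(hφ n).initial, hφ₀]
  refine hV (exists_eigenvector_of_asymptotically_invariant
    (μ := volume.restrict (Ioc 0 τ)) (w := fun n => pullback U (A n) (φ n)) he.lam_pos he.mono
    he.tendsto (U 1) (fun n => hU.isTight_pullback h2 hM (hT n) hτ.le (ht n) (h0 n)) ?_ hδ
    (fun n => ?_) fun x => ?_)
  · rw [Ne, Measure.restrict_eq_zero]
    simpa using hτ
  · filter_upwards [ae_restrict_mem measurableSet_Ioc] with t htm
    rw [norm_pullback]
    -- Norms decrease in time, so the lower bound at the final time `τ` holds at all earlier times.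
    exact (hge n).trans (((ht n).mono htm.1.le htm.2 le_rfl).norm_le (hT n) htm.2)
  · have hlim : Tendsto (fun n : ℕ => ((n : ℝ) + 1)⁻¹) atTop (𝓝 0) := by
      simpa [one_div] using tendsto_one_div_add_atTop_nhds_zero_nat (𝕜 := ℝ)
    have hlim2 : Tendsto (fun n : ℕ => 2 * ‖x‖ ^ 2 * M * √(((n : ℝ) + 1)⁻¹ / 2) * (τ + 1 / 2) +
        2 * ‖x‖ ^ 2 * ((n : ℝ) + 1)⁻¹) atTop (𝓝 0) := by
      have hs := (Real.continuous_sqrt.tendsto _).comp (hlim.div_const 2)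
      have := ((hs.const_mul (2 * ‖x‖ ^ 2 * M)).mul_const (τ + 1 / 2)).add
        (hlim.const_mul (2 * ‖x‖ ^ 2))
      simpa using this
    refine squeeze_zero_norm' ?_ hlim2
    filter_upwards [hlim.eventually_le_const hτ] with n hn
    refine (hU.abs_covariance_pullback_sub_le he.lam_pos hL hper h1 h2 hM0 hM (hApos n) (hT n)
      ((hinv n).trans hn) (ht n) (h0 n) x).trans ?_
    have := hinv n
    gcongr

end

end RelaxationEnhancement

/-! ### Heat semigroup and Duhamel estimates -/

namespace RelaxationEnhancement

/-- Monotone convergence in a form that yields integrability of the sum together with the bound. -/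
theorem integrable_and_integral_le_of_hasSum {α : Type*} [MeasurableSpace α] {μ : Measure α}
    {F : ℕ → α → ℝ} {S : α → ℝ} {B : ℝ} (hF : ∀ n, Integrable (F n) μ)
    (hF0 : ∀ n t, 0 ≤ F n t) (hS : ∀ᵐ t ∂μ, HasSum (fun n => F n t) (S t))
    (hB : ∀ N, ∑ n ∈ Finset.range N, ∫ t, F n t ∂μ ≤ B) :
    Integrable S μ ∧ ∫ t, S t ∂μ ≤ B := by
  have hB0 : 0 ≤ B := by simpa using hB 0
  have hlim : Tendsto (fun N => ∑ n ∈ Finset.range N, ∫ t, F n t ∂μ) atTop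
      (𝓝 (∑' n, ∫ t, F n t ∂μ)) :=
    (summable_of_sum_range_le (fun n => integral_nonneg (hF0 n)) hB).hasSum.tendsto_sum_nat
  have hsum : Summable fun n => ∫ t, ‖F n t‖ ∂μ := by
    refine summable_of_sum_range_le (fun n => integral_nonneg fun t => norm_nonneg _) (c := B)
      fun N => ?_
    simpa only [Real.norm_of_nonneg (hF0 _ _)] using hB N
  have htsum := hasSum_integral_of_summable_integral_norm hF hsum
  have hint : Integrable (fun t => ∑' n, F n t) μ := by
    have hmeas : AEStronglyMeasurable (fun t => ∑' n, F n t) μ := by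
      refine aestronglyMeasurable_of_tendsto_ae atTop
        (f := fun N t => ∑ n ∈ Finset.range N, F n t)
        (fun N => Finset.aestronglyMeasurable_fun_sum _ fun n _ => (hF n).1) ?_
      filter_upwards [hS] with t ht
      rw [ht.tsum_eq]
      exact ht.tendsto_sum_nat
    refine ⟨hmeas, ?_⟩
    rw [hasFiniteIntegral_iff_ofReal (ae_of_all _ fun t => tsum_nonneg fun n => hF0 n t)]
    have h1 : ∫⁻ t, ENNReal.ofReal (∑' n, F n t) ∂μ = ∑' n, ENNReal.ofReal (∫ t, F n t ∂μ) := by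
      have : ∫⁻ t, ENNReal.ofReal (∑' n, F n t) ∂μ = ∫⁻ t, ∑' n, ENNReal.ofReal (F n t) ∂μ := by
        refine lintegral_congr_ae ?_
        filter_upwards [hS] with t ht
        exact ENNReal.ofReal_tsum_of_nonneg (fun n => hF0 n t) ht.summable
      rw [this, lintegral_tsum fun n => (hF n).1.aemeasurable.ennreal_ofReal]
      congr 1
      ext n
      rw [ofReal_integral_eq_lintegral_ofReal (hF n) (ae_of_all _ (hF0 n))]
    rw [h1, ← ENNReal.ofReal_tsum_of_nonneg (fun n => integral_nonneg (hF0 n))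
      (summable_of_sum_range_le (fun n => integral_nonneg (hF0 n)) hB)]
    exact ENNReal.ofReal_lt_top
  have hae : (fun t => ∑' n, F n t) =ᵐ[μ] S := by
    filter_upwards [hS] with t ht using ht.tsum_eq
  refine ⟨hint.congr hae, ?_⟩
  rw [← integral_congr_ae hae, ← htsum.tsum_eq]
  exact le_of_tendsto' hlim hB

/-- The scalar smoothing estimate behind parabolic regularity. -/
theorem mul_norm_exp_integral_sq_le {l t : ℝ} (hl : 0 < l) (ht : 0 ≤ t) {g : ℝ → ℂ}
    (hg : IntervalIntegrable g volume 0 t)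
    (hg2 : IntervalIntegrable (fun s => ‖g s‖ ^ 2) volume 0 t) :
    l * ‖(Real.exp (-(l * t)) : ℂ) * ∫ s in (0 : ℝ)..t, (Real.exp (l * s) : ℂ) * g s‖ ^ 2 ≤
      (∫ s in (0 : ℝ)..t, ‖g s‖ ^ 2) / 2 := by
  set k : ℝ → ℝ := fun s => Real.exp (-(l * t)) * Real.exp (l * s) with hk
  have hkc : Continuous k := by fun_prop
  have hkg : IntervalIntegrable (fun s => k s * ‖g s‖) volume 0 t :=
    hg.norm.continuousOn_mul hkc.continuousOn
  have hk2 : IntervalIntegrable (fun s => k s ^ 2) volume 0 t :=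
    (hkc.pow 2).intervalIntegrable _ _
  set Z := ∫ s in (0 : ℝ)..t, k s * ‖g s‖ with hZ
  set Y := ∫ s in (0 : ℝ)..t, ‖g s‖ ^ 2 with hY
  have hX : ∫ s in (0 : ℝ)..t, k s ^ 2 ≤ 1 / (2 * l) := by
    have hd : ∀ s ∈ uIcc 0 t, HasDerivAt (fun s => k s ^ 2 / (2 * l)) (k s ^ 2) s := by
      intro s _
      have h1 : HasDerivAt (fun s => l * s) l s := by simpa using (hasDerivAt_id s).const_mul l
      have h2 := ((h1.exp.const_mul (Real.exp (-(l * t)))).pow 2).div_const (2 * l)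
      refine h2.congr_deriv ?_
      simp only [hk]
      field_simp
      ring
    rw [intervalIntegral.integral_eq_sub_of_hasDerivAt hd hk2]
    have h1 : k t = 1 := by simp only [hk]; rw [← Real.exp_add]; simp
    rw [h1, one_pow]
    have : 0 ≤ k 0 ^ 2 / (2 * l) := by positivity
    linarith
  -- Cauchy–Schwarz by completing the square: with `∫k² ≤ 1/(2l)`, the coefficient `2lZ` turns
  -- nonnegativity into `l Z² ≤ Y/2`.
  have hq : 0 ≤ ∫ s in (0 : ℝ)..t, (2 * l * Z * k s - ‖g s‖) ^ 2 :=
    intervalIntegral.integral_nonneg ht fun s _ => sq_nonneg _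
  have hq' : ∫ s in (0 : ℝ)..t, (2 * l * Z * k s - ‖g s‖) ^ 2 =
      (2 * l * Z) ^ 2 * (∫ s in (0 : ℝ)..t, k s ^ 2) - 2 * (2 * l * Z) * Z + Y := by
    have hfun : (fun s => (2 * l * Z * k s - ‖g s‖) ^ 2) = fun s =>
        (2 * l * Z) ^ 2 * k s ^ 2 - 2 * (2 * l * Z) * (k s * ‖g s‖) + ‖g s‖ ^ 2 := by
      ext s; ring
    rw [hfun, intervalIntegral.integral_add ((hk2.const_mul _).sub (hkg.const_mul _)) hg2,
      intervalIntegral.integral_sub (hk2.const_mul _) (hkg.const_mul _),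
      intervalIntegral.integral_const_mul, intervalIntegral.integral_const_mul]
  have hZ2 : l * Z ^ 2 ≤ Y / 2 := by
    have h3 : (2 * l * Z) ^ 2 * (∫ s in (0 : ℝ)..t, k s ^ 2) ≤ 2 * l * Z ^ 2 := by
      calc _ ≤ (2 * l * Z) ^ 2 * (1 / (2 * l)) := mul_le_mul_of_nonneg_left hX (sq_nonneg _)
        _ = _ := by field_simp
    nlinarith
  refine le_trans (mul_le_mul_of_nonneg_left (pow_le_pow_left₀ (norm_nonneg _) ?_ 2) hl.le) hZ2
  rw [← intervalIntegral.integral_const_mul]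
  refine intervalIntegral.norm_integral_le_of_norm_le ht (ae_of_all _ fun s _ => ?_) hkg
  rw [← mul_assoc, norm_mul, norm_mul, Complex.norm_real, Complex.norm_real,
    Real.norm_of_nonneg (Real.exp_nonneg _), Real.norm_of_nonneg (Real.exp_nonneg _)]

variable {H : Type*} [NormedAddCommGroup H] [InnerProductSpace ℂ H]
variable {e : HilbertBasis ℕ ℂ H} {lam : ℕ → ℝ}

/-- Locally square integrable functions on `[0, ∞)`. -/
structure LocSqIntegrable {H : Type*} [NormedAddCommGroup H] (f : ℝ → H) : Prop where
  measurable : AEStronglyMeasurable f (volume.restrict (Ioi 0))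
  integrable : ∀ t, IntegrableOn (fun s => ‖f s‖ ^ 2) (Ioc 0 t)

theorem LocSqIntegrable.measurable_Ioc {H : Type*} [NormedAddCommGroup H] {f : ℝ → H}
    (hf : LocSqIntegrable f) (t : ℝ) :
    AEStronglyMeasurable f (volume.restrict (Ioc 0 t)) :=
  hf.measurable.mono_measure (Measure.restrict_mono Ioc_subset_Ioi_self le_rfl)

theorem LocSqIntegrable.repr_intervalIntegrable {f : ℝ → H} (hf : LocSqIntegrable f) (j : ℕ)
    {t : ℝ} (ht : 0 ≤ t) : IntervalIntegrable (fun s => e.repr (f s) j) volume 0 t ∧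
      IntervalIntegrable (fun s => ‖e.repr (f s) j‖ ^ 2) volume 0 t := by
  rw [intervalIntegrable_iff_integrableOn_Ioc_of_le ht,
    intervalIntegrable_iff_integrableOn_Ioc_of_le ht]
  have hm := (hf.measurable_Ioc t).repr (e := e) j
  constructor
  · refine Integrable.mono' (g := fun s => 1 + ‖f s‖ ^ 2)
      ((integrable_const 1).add (hf.integrable t))
      hm (ae_of_all _ fun s => ?_)
    have := norm_repr_le e (f s) j
    nlinarith [sq_nonneg (‖f s‖ - 1)]
  · refine Integrable.mono' (hf.integrable t) (hm.norm.pow 2) (ae_of_all _ fun s => ?_)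
    rw [Real.norm_of_nonneg (sq_nonneg _)]
    exact pow_le_pow_left₀ (norm_nonneg _) (norm_repr_le e _ j) 2

variable (e lam) in
/-- The Duhamel integral `∫₀ᵗ exp(-(t-s)Γ) f(s) ds`. -/
noncomputable def duhamel (f : ℝ → H) (t : ℝ) : H := ofCoords e fun j =>
  (Real.exp (-(lam j * t)) : ℂ) * ∫ s in (0 : ℝ)..t, (Real.exp (lam j * s) : ℂ) * e.repr (f s) j

/-- The scalar constant `1/2` does not depend on the eigenvalue, so summing over the modes by
Parseval loses nothing: the integral gains a full `Γ^{1/2}`, pointwise in time. -/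
theorem duhamel_spec (hlam : ∀ j, 0 < lam j) (hmono : Monotone lam) {f : ℝ → H}
    (hf : LocSqIntegrable f) {t : ℝ} (ht : 0 ≤ t) :
    (∀ j, e.repr (duhamel e lam f t) j = (Real.exp (-(lam j * t)) : ℂ) *
      ∫ s in (0 : ℝ)..t, (Real.exp (lam j * s) : ℂ) * e.repr (f s) j) ∧
    MemH1 e lam (duhamel e lam f t) ∧
    norm1 e lam (duhamel e lam f t) ^ 2 ≤ (∫ s in (0 : ℝ)..t, ‖f s‖ ^ 2) / 2 := by
  set c : ℕ → ℂ := fun j => (Real.exp (-(lam j * t)) : ℂ) *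
    ∫ s in (0 : ℝ)..t, (Real.exp (lam j * s) : ℂ) * e.repr (f s) j with hc
  have hfi : IntervalIntegrable (fun s => ‖f s‖ ^ 2) volume 0 t :=
    (intervalIntegrable_iff_integrableOn_Ioc_of_le ht).2 (hf.integrable t)
  have hsumle : ∀ N, ∑ j ∈ Finset.range N, lam j * ‖c j‖ ^ 2 ≤
      (∫ s in (0 : ℝ)..t, ‖f s‖ ^ 2) / 2 := by
    intro N
    calc _ ≤ ∑ j ∈ Finset.range N, (∫ s in (0 : ℝ)..t, ‖e.repr (f s) j‖ ^ 2) / 2 :=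
          Finset.sum_le_sum fun j _ => mul_norm_exp_integral_sq_le (hlam j) ht
            (hf.repr_intervalIntegrable j ht).1 (hf.repr_intervalIntegrable j ht).2
      _ = (∫ s in (0 : ℝ)..t, ∑ j ∈ Finset.range N, ‖e.repr (f s) j‖ ^ 2) / 2 := by
          rw [← Finset.sum_div, intervalIntegral.integral_finsetSum fun j _ =>
            (hf.repr_intervalIntegrable j ht).2]
      _ ≤ _ := by
          refine div_le_div_of_nonneg_right ?_ (by norm_num)
          refine intervalIntegral.integral_mono_on ht ?_ hfi fun s _ =>
            sum_le_hasSum _ (fun j _ => sq_nonneg _) (hasSum_norm_repr_sq e (f s))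
          have := IntervalIntegrable.sum (Finset.range N) fun j _ =>
            (hf.repr_intervalIntegrable (e := e) j ht).2
          rwa [show (fun s => ∑ j ∈ Finset.range N, ‖e.repr (f s) j‖ ^ 2) =
            ∑ j ∈ Finset.range N, fun s => ‖e.repr (f s) j‖ ^ 2 by
              ext s; simp only [Finset.sum_apply]]
  have hs1 : Summable fun j => lam j * ‖c j‖ ^ 2 :=
    summable_of_sum_range_le (fun j => mul_nonneg (hlam j).le (sq_nonneg _)) hsumle
  have hs0 : Summable fun j => ‖c j‖ ^ 2 := by
    refine Summable.of_nonneg_of_le (fun j => sq_nonneg _) (fun j => ?_)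
      (hs1.mul_left (lam 0)⁻¹)
    rw [← mul_assoc]
    refine le_mul_of_one_le_left (sq_nonneg _) ?_
    rw [inv_mul_eq_div, one_le_div (hlam 0)]
    exact hmono (Nat.zero_le j)
  have hrepr : ∀ j, e.repr (duhamel e lam f t) j = c j := fun j => repr_ofCoords hs0 j
  have hmem : MemH1 e lam (duhamel e lam f t) := by
    simpa only [MemH1, hrepr] using hs1
  refine ⟨hrepr, hmem, ?_⟩
  have := hasSum_norm1_sq hlam hmem
  simp only [hrepr] at this
  exact le_of_tendsto' this.tendsto_sum_nat hsumle

theorem continuousOn_repr_duhamel (hlam : ∀ j, 0 < lam j) (hmono : Monotone lam) {f : ℝ → H}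
    (hf : LocSqIntegrable f) (j : ℕ) :
    ContinuousOn (fun t => e.repr (duhamel e lam f t) j) (Ici 0) := by
  have h : ContinuousOn (fun t => ∫ s in (0 : ℝ)..t, (Real.exp (lam j * s) : ℂ) * e.repr (f s) j)
      (Ici 0) := by
    intro t ht
    have ht1 : (0 : ℝ) ≤ t + 1 := by have := mem_Ici.1 ht; linarith
    have hi : IntervalIntegrable (fun s => (Real.exp (lam j * s) : ℂ) * e.repr (f s) j)
        volume 0 (t + 1) :=
      (hf.repr_intervalIntegrable j ht1).1.continuousOn_mul (by fun_prop)
    have hc := (absolutelyContinuousOnInterval_integral hi).continuousOn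
    rw [uIcc_of_le ht1] at hc
    refine (hc t ⟨ht, by linarith⟩).mono_of_mem_nhdsWithin ?_
    filter_upwards [self_mem_nhdsWithin, mem_nhdsWithin_of_mem_nhds (Iio_mem_nhds (lt_add_one t))]
      with s h1 h2 using ⟨h1, h2.le⟩
  refine ContinuousOn.congr (f := fun t => (Real.exp (-(lam j * t)) : ℂ) *
    ∫ s in (0 : ℝ)..t, (Real.exp (lam j * s) : ℂ) * e.repr (f s) j)
    (ContinuousOn.mul (by fun_prop) h) fun t ht => (duhamel_spec hlam hmono hf ht).1 j

variable (e lam) in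
/-- The heat semigroup `exp(-tΓ)`. -/
noncomputable def heat (x : H) (t : ℝ) : H := ofCoords e fun j =>
  (Real.exp (-(lam j * t)) : ℂ) * e.repr x j

theorem repr_heat (hlam : ∀ j, 0 < lam j) (x : H) {t : ℝ} (ht : 0 ≤ t) (j : ℕ) :
    e.repr (heat e lam x t) j = (Real.exp (-(lam j * t)) : ℂ) * e.repr x j := by
  refine repr_ofCoords (Summable.of_nonneg_of_le (fun j => sq_nonneg _) (fun j => ?_)
    (hasSum_norm_repr_sq e x).summable) j
  refine pow_le_pow_left₀ (norm_nonneg _) ?_ 2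
  rw [norm_mul, Complex.norm_real, Real.norm_of_nonneg (Real.exp_nonneg _)]
  refine mul_le_of_le_one_left (norm_nonneg _) (Real.exp_le_one_iff.2 ?_)
  have := mul_nonneg (hlam j).le ht
  linarith

/-- All multipliers lie in `[0,1]`, so tails are controlled uniformly in `t`; `N = 0` is
contractivity. -/
theorem norm_sub_proj_heat_le (hlam : ∀ j, 0 < lam j) (x : H) {t : ℝ} (ht : 0 ≤ t) (N : ℕ) :
    ‖heat e lam x t - proj e N (heat e lam x t)‖ ≤ ‖x - proj e N x‖ := by
  refine (sq_le_sq₀ (norm_nonneg _) (norm_nonneg _)).1 ?_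
  refine hasSum_le (fun j => ?_) (hasSum_norm_repr_sq e _) (hasSum_norm_repr_sq e _)
  rw [map_sub, lp.coeFn_sub, Pi.sub_apply, repr_proj, map_sub, lp.coeFn_sub, Pi.sub_apply,
    repr_proj, repr_heat hlam x ht]
  split_ifs
  · simp
  · rw [sub_zero, sub_zero]
    refine pow_le_pow_left₀ (norm_nonneg _) ?_ 2
    rw [norm_mul, Complex.norm_real, Real.norm_of_nonneg (Real.exp_nonneg _)]
    refine mul_le_of_le_one_left (norm_nonneg _) (Real.exp_le_one_iff.2 ?_)
    have := mul_nonneg (hlam j).le ht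
    linarith

theorem norm_heat_le (hlam : ∀ j, 0 < lam j) (x : H) {t : ℝ} (ht : 0 ≤ t) :
    ‖heat e lam x t‖ ≤ ‖x‖ := by
  simpa [proj] using norm_sub_proj_heat_le hlam (e := e) x ht 0

/-- Smoothing: `λ exp(-2λt) ≤ 1/t`, from `λt + 1 ≤ exp(λt)`. -/
theorem memH1_heat (hlam : ∀ j, 0 < lam j) (x : H) {t : ℝ} (ht : 0 < t) :
    MemH1 e lam (heat e lam x t) := by
  refine Summable.of_nonneg_of_le (fun j => mul_nonneg (hlam j).le (sq_nonneg _)) (fun j => ?_)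
    ((hasSum_norm_repr_sq e x).summable.mul_left t⁻¹)
  rw [repr_heat hlam x ht.le, norm_mul, mul_pow, Complex.norm_real,
    Real.norm_of_nonneg (Real.exp_nonneg _), ← mul_assoc]
  refine mul_le_mul_of_nonneg_right ?_ (sq_nonneg _)
  rw [← Real.exp_nat_mul, inv_eq_one_div, le_div_iff₀ ht]
  have h1 := Real.add_one_le_exp (lam j * t)
  have h2 : Real.exp ((2 : ℕ) * -(lam j * t)) * Real.exp (lam j * t) ≤ 1 := by
    rw [← Real.exp_add, Real.exp_le_one_iff]
    have := mul_nonneg (hlam j).le ht.le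
    push_cast; linarith
  have h3 := Real.exp_pos ((2 : ℕ) * -(lam j * t))
  nlinarith

/-- The pointwise bound `1/t` is not integrable at `0`; instead each mode satisfies `∫ λ exp(-2λs)
ds ≤ 1/2`, and the modes are summed. -/
theorem integral_norm1_heat_le (hlam : ∀ j, 0 < lam j) (x : H) (t : ℝ) :
    IntegrableOn (fun s => norm1 e lam (heat e lam x s) ^ 2) (Ioc 0 t) ∧
      ∫ s in Ioc 0 t, norm1 e lam (heat e lam x s) ^ 2 ≤ ‖x‖ ^ 2 / 2 := by
  rcases le_or_gt t 0 with ht | ht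
  · rw [Ioc_eq_empty (not_lt.2 ht)]
    simpa using by positivity
  refine integrable_and_integral_le_of_hasSum
    (F := fun j s => lam j * (Real.exp (-(lam j * s)) ^ 2 * ‖e.repr x j‖ ^ 2))
    (fun j => ?_) (fun j s => mul_nonneg (hlam j).le (by positivity)) ?_ fun N => ?_
  · have : Continuous fun s => lam j * (Real.exp (-(lam j * s)) ^ 2 * ‖e.repr x j‖ ^ 2) := by
      fun_prop
    exact (this.integrableOn_Icc (a := 0) (b := t)).mono_set Ioc_subset_Icc_self
  · filter_upwards [ae_restrict_mem measurableSet_Ioc] with s hs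
    have := hasSum_norm1_sq hlam (memH1_heat (e := e) hlam x hs.1)
    simpa only [repr_heat hlam x hs.1.le, norm_mul, mul_pow, Complex.norm_real,
      Real.norm_of_nonneg (Real.exp_nonneg _)] using this
  · have hj : ∀ j, ∫ s in Ioc 0 t, lam j * (Real.exp (-(lam j * s)) ^ 2 * ‖e.repr x j‖ ^ 2) ≤
        ‖e.repr x j‖ ^ 2 / 2 := by
      intro j
      rw [← intervalIntegral.integral_of_le ht.le]
      have hd : ∀ s ∈ uIcc 0 t, HasDerivAt
          (fun s => -(Real.exp (-(lam j * s)) ^ 2 * ‖e.repr x j‖ ^ 2 / 2))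
          (lam j * (Real.exp (-(lam j * s)) ^ 2 * ‖e.repr x j‖ ^ 2)) s := by
        intro s _
        have h1 : HasDerivAt (fun s => -(lam j * s)) (-lam j) s := by
          simpa [neg_mul] using (hasDerivAt_id s).const_mul (-lam j)
        refine ((((h1.exp.pow 2).mul_const (‖e.repr x j‖ ^ 2)).div_const 2).neg).congr_deriv ?_
        simp only [Nat.cast_ofNat, Nat.add_one_sub_one, pow_one]
        ring
      rw [intervalIntegral.integral_eq_sub_of_hasDerivAt hd
        (Continuous.intervalIntegrable (by fun_prop) _ _)]
      have : 0 ≤ Real.exp (-(lam j * t)) ^ 2 * ‖e.repr x j‖ ^ 2 / 2 := by positivity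
      simp
      linarith
    calc _ ≤ ∑ j ∈ Finset.range N, ‖e.repr x j‖ ^ 2 / 2 := Finset.sum_le_sum fun j _ => hj j
      _ ≤ _ := by
        rw [← Finset.sum_div]
        exact div_le_div_of_nonneg_right
          (sum_le_hasSum _ (fun j _ => sq_nonneg _) (hasSum_norm_repr_sq e x)) (by norm_num)

end RelaxationEnhancement

/-! ### Terms of the Dyson series -/

namespace RelaxationEnhancement

variable {H : Type*} [NormedAddCommGroup H] [InnerProductSpace ℂ H]
variable {e : HilbertBasis ℕ ℂ H} {lam : ℕ → ℝ} {T : ℝ → H → H} {C : ℝ}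

theorem norm_sub_proj_le_norm1 (hlam : ∀ j, 0 < lam j) (hmono : Monotone lam) {x : H}
    (hx : MemH1 e lam x) (N : ℕ) : ‖x - proj e N x‖ ≤ norm1 e lam x / √(lam N) := by
  have hs : 0 < √(lam N) := Real.sqrt_pos.2 (hlam N)
  rw [le_div_iff₀ hs]
  refine (sq_le_sq₀ (by positivity) (norm1_nonneg _)).1 ?_
  rw [mul_pow, Real.sq_sqrt (hlam N).le, mul_comm]
  exact norm_sub_proj_sq_le hlam hmono hx N

theorem IsSymmField.repr_apply (hT : IsSymmField e lam T C) {x : H} (hx : MemH1 e lam x) (s : ℝ)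
    (j : ℕ) : e.repr (T s x) j = inner ℂ (T s (e j)) x := by
  rw [e.repr_apply_apply, hT.symm s _ _ (memH1_basis j) hx]

theorem IsSymmField.locSqIntegrable (hT : IsSymmField e lam T C)
    (hmeas : ∀ j, AEStronglyMeasurable (fun s => T s (e j)) volume) {v : ℝ → H}
    (hv : ∀ j, AEStronglyMeasurable (fun s => e.repr (v s) j) (volume.restrict (Ioi 0)))
    (h1 : ∀ s, 0 < s → MemH1 e lam (v s))
    (hint : ∀ t, IntegrableOn (fun s => norm1 e lam (v s) ^ 2) (Ioc 0 t)) :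
    LocSqIntegrable (fun s => Complex.I • T s (v s)) ∧ ∀ t, 0 ≤ t →
      ∫ s in (0 : ℝ)..t, ‖Complex.I • T s (v s)‖ ^ 2 ≤
        C ^ 2 * ∫ s in Ioc 0 t, norm1 e lam (v s) ^ 2 := by
  have hm : AEStronglyMeasurable (fun s => Complex.I • T s (v s)) (volume.restrict (Ioi 0)) := by
    refine AEStronglyMeasurable.const_smul (aestronglyMeasurable_of_repr (e := e) fun j => ?_) _
    refine ((hmeas j).restrict.inner (𝕜 := ℂ) (aestronglyMeasurable_of_repr hv)).congr ?_
    filter_upwards [ae_restrict_mem measurableSet_Ioi] with s hs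
    exact (hT.repr_apply (h1 s hs) s j).symm
  have hle : ∀ s, 0 < s → ‖Complex.I • T s (v s)‖ ^ 2 ≤ C ^ 2 * norm1 e lam (v s) ^ 2 := by
    intro s hs
    rw [norm_smul, Complex.norm_I, one_mul, ← mul_pow]
    exact pow_le_pow_left₀ (norm_nonneg _) (hT.bound s _ (h1 s hs)) 2
  have hi : ∀ t, IntegrableOn (fun s => ‖Complex.I • T s (v s)‖ ^ 2) (Ioc 0 t) := by
    intro t
    refine Integrable.mono' ((hint t).const_mul (C ^ 2))
      ((hm.mono_measure (Measure.restrict_mono Ioc_subset_Ioi_self le_rfl)).norm.pow 2) ?_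
    filter_upwards [ae_restrict_mem measurableSet_Ioc] with s hs
    rw [Real.norm_of_nonneg (sq_nonneg _)]
    exact hle s hs.1
  refine ⟨⟨hm, hi⟩, fun t ht => ?_⟩
  rw [intervalIntegral.integral_of_le ht, ← integral_const_mul]
  refine integral_mono_ae (hi t) ((hint t).const_mul _) ?_
  filter_upwards [ae_restrict_mem measurableSet_Ioc] with s hs using hle s hs.1

variable (e lam T) in
/-- The terms of the Dyson series for `x' = i T x - Γ x`. -/
noncomputable def dyson (x : H) : ℕ → ℝ → H
  | 0 => heat e lam x
  | n + 1 => duhamel e lam fun s => Complex.I • T s (dyson x n s)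

/-- The properties of the Dyson terms that are propagated by the recursion. -/
structure DysonBound (e : HilbertBasis ℕ ℂ H) (lam : ℕ → ℝ) (K R : ℝ) (n : ℕ) (v : ℝ → H) :
    Prop where
  continuousOn : ∀ j, ContinuousOn (fun t => e.repr (v t) j) (Ici 0)
  memH1 : ∀ t, 0 < t → MemH1 e lam (v t)
  integrable : ∀ t, IntegrableOn (fun s => norm1 e lam (v s) ^ 2) (Ioc 0 t)
  integral_le : ∀ t, 0 ≤ t →
    ∫ s in Ioc 0 t, norm1 e lam (v s) ^ 2 ≤ R * ((K * t) ^ n / n.factorial)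

theorem DysonBound.measurable {K R : ℝ} {n : ℕ} {v : ℝ → H} (h : DysonBound e lam K R n v)
    (j : ℕ) : AEStronglyMeasurable (fun s => e.repr (v s) j) (volume.restrict (Ioi 0)) :=
  ((h.continuousOn j).mono Ioi_subset_Ici_self).aestronglyMeasurable measurableSet_Ioi

theorem DysonBound.norm1_duhamel_sq_le (hT : IsSymmField e lam T C) (hmono : Monotone lam)
    (hmeas : ∀ j, AEStronglyMeasurable (fun s => T s (e j)) volume) {R : ℝ} {n : ℕ}
    {v : ℝ → H} (h : DysonBound e lam (C ^ 2 / 2) R n v) {t : ℝ} (ht : 0 ≤ t) :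
    norm1 e lam (duhamel e lam (fun s => Complex.I • T s (v s)) t) ^ 2 ≤
      C ^ 2 / 2 * (R * ((C ^ 2 / 2 * t) ^ n / n.factorial)) := by
  obtain ⟨hf, hfi⟩ := hT.locSqIntegrable hmeas h.measurable h.memH1 h.integrable
  have h1 := (duhamel_spec (e := e) hT.pos hmono hf ht).2.2
  have h2 := hfi t ht
  have h3 := mul_le_mul_of_nonneg_left (h.integral_le t ht) (sq_nonneg C)
  linarith

/-- Duhamel turns the integrated `H¹` bound into a pointwise one at the cost of `C²/2`; integrating
that in time raises the power of `t` and produces the next factorial. -/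
theorem DysonBound.duhamel (hT : IsSymmField e lam T C) (hmono : Monotone lam)
    (hmeas : ∀ j, AEStronglyMeasurable (fun s => T s (e j)) volume) {R : ℝ} {n : ℕ}
    {v : ℝ → H} (h : DysonBound e lam (C ^ 2 / 2) R n v) :
    DysonBound e lam (C ^ 2 / 2) R (n + 1) (duhamel e lam fun s => Complex.I • T s (v s)) := by
  obtain ⟨hf, hfi⟩ := hT.locSqIntegrable hmeas h.measurable h.memH1 h.integrable
  set u := RelaxationEnhancement.duhamel e lam fun s => Complex.I • T s (v s)
  set K := C ^ 2 / 2 with hK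
  have hK0 : 0 ≤ K := by positivity
  have hcont := fun j => continuousOn_repr_duhamel (e := e) hT.pos hmono hf j
  have hmem : ∀ t, 0 < t → MemH1 e lam (u t) := fun t ht =>
    (duhamel_spec (e := e) hT.pos hmono hf ht.le).2.1
  have hle : ∀ t, 0 ≤ t → norm1 e lam (u t) ^ 2 ≤ K * (R * ((K * t) ^ n / n.factorial)) :=
    fun t ht => h.norm1_duhamel_sq_le hT hmono hmeas ht
  have hpoly : Continuous fun t => K * (R * ((K * t) ^ n / n.factorial)) := by fun_prop
  have hint : ∀ t, IntegrableOn (fun s => norm1 e lam (u s) ^ 2) (Ioc 0 t) := by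
    intro t
    refine Integrable.mono' ((hpoly.integrableOn_Icc (a := 0) (b := t)).mono_set
      Ioc_subset_Icc_self) ((aestronglyMeasurable_norm1 hT.pos (fun j => ?_) ?_).pow 2) ?_
    · exact ((hcont j).mono (Ioc_subset_Ioi_self.trans Ioi_subset_Ici_self)).aestronglyMeasurable
        measurableSet_Ioc
    · filter_upwards [ae_restrict_mem measurableSet_Ioc] with s hs using hmem s hs.1
    · filter_upwards [ae_restrict_mem measurableSet_Ioc] with s hs
      rw [Real.norm_of_nonneg (sq_nonneg _)]
      exact hle s hs.1.le
  refine ⟨hcont, hmem, hint, fun t ht => ?_⟩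
  calc ∫ s in Ioc 0 t, norm1 e lam (u s) ^ 2 ≤
        ∫ s in Ioc 0 t, K * (R * ((K * s) ^ n / n.factorial)) := by
        refine setIntegral_mono_on (hint t) ((hpoly.integrableOn_Icc (a := 0) (b := t)).mono_set
          Ioc_subset_Icc_self) measurableSet_Ioc fun s hs => hle s hs.1.le
    _ = R * ((K * t) ^ (n + 1) / (n + 1).factorial) := by
        rw [← intervalIntegral.integral_of_le ht]
        have : (fun s : ℝ => K * (R * ((K * s) ^ n / n.factorial))) = fun s =>
            (K * R * K ^ n / n.factorial) * s ^ n := by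
          ext s; rw [mul_pow]; ring
        rw [this, intervalIntegral.integral_const_mul, integral_pow, Nat.factorial_succ]
        have h1 : ((n.factorial : ℕ) : ℝ) ≠ 0 := by positivity
        have h2 : ((n : ℝ) + 1) ≠ 0 := by positivity
        push_cast
        field_simp
        ring

theorem dysonBound_dyson (hT : IsSymmField e lam T C) (hmono : Monotone lam)
    (hmeas : ∀ j, AEStronglyMeasurable (fun s => T s (e j)) volume) (x : H) (n : ℕ) :
    DysonBound e lam (C ^ 2 / 2) (‖x‖ ^ 2 / 2) n (dyson e lam T x n) := by
  induction n with
  | zero =>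
    refine ⟨fun j => ?_, fun t ht => memH1_heat hT.pos x ht,
      fun t => (integral_norm1_heat_le hT.pos x t).1, fun t _ => ?_⟩
    · refine ContinuousOn.congr (f := fun t => (Real.exp (-(lam j * t)) : ℂ) * e.repr x j)
        (by fun_prop) fun t ht => repr_heat hT.pos x ht j
    · rw [pow_zero, Nat.factorial_zero, Nat.cast_one, div_one, mul_one]
      exact (integral_norm1_heat_le (e := e) hT.pos x t).2
  | succ n ih => exact ih.duhamel hT hmono hmeas

/-- A summable majorant for the `H¹` norms of the Dyson terms. -/
noncomputable def dysonMajorant (K R t : ℝ) (n : ℕ) : ℝ :=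
  (K * R * (1 / 2) ^ n + (2 * K * t) ^ n / n.factorial) / 2

theorem summable_dysonMajorant (K R t : ℝ) : Summable (dysonMajorant K R t) :=
  (((summable_geometric_two).mul_left (K * R)).add
    (Real.summable_pow_div_factorial (2 * K * t))).div_const 2

theorem dysonMajorant_nonneg {K R t : ℝ} (hK : 0 ≤ K) (hR : 0 ≤ R) (ht : 0 ≤ t) (n : ℕ) :
    0 ≤ dysonMajorant K R t n := by
  unfold dysonMajorant; positivity

theorem norm1_dyson_succ_le (hT : IsSymmField e lam T C) (hmono : Monotone lam)
    (hmeas : ∀ j, AEStronglyMeasurable (fun s => T s (e j)) volume) (x : H) (n : ℕ) {t τ : ℝ}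
    (ht : 0 ≤ t) (hτ : t ≤ τ) : MemH1 e lam (dyson e lam T x (n + 1) t) ∧
      norm1 e lam (dyson e lam T x (n + 1) t) ≤
        dysonMajorant (C ^ 2 / 2) (‖x‖ ^ 2 / 2) τ n := by
  have hb := dysonBound_dyson hT hmono hmeas x n
  obtain ⟨hf, -⟩ := hT.locSqIntegrable hmeas hb.measurable hb.memH1 hb.integrable
  refine ⟨(duhamel_spec (e := e) hT.pos hmono hf ht).2.1, ?_⟩
  have h := hb.norm1_duhamel_sq_le hT hmono hmeas ht
  set K := C ^ 2 / 2 with hK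
  have hK0 : 0 ≤ K := by positivity
  have hR : 0 ≤ ‖x‖ ^ 2 / 2 := by positivity
  set R := ‖x‖ ^ 2 / 2
  have hmon : dysonMajorant K R t n ≤ dysonMajorant K R τ n := by
    unfold dysonMajorant; gcongr
  refine le_trans ((sq_le_sq₀ (norm1_nonneg _) (dysonMajorant_nonneg hK0 hR ht n)).1
    (h.trans ?_)) hmon
  -- A factor `2ⁿ` is moved so that one part is geometric and the other still exponential; then `ab
  -- ≤ ((a+b)/2)²` replaces the square root by a summable average.
  have hab : K * (R * ((K * t) ^ n / n.factorial)) =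
      (K * R * (1 / 2) ^ n) * ((2 * K * t) ^ n / n.factorial) := by
    have : (2 * K * t) ^ n = 2 ^ n * (K * t) ^ n := by rw [← mul_pow, mul_assoc]
    rw [this, one_div, inv_pow]
    field_simp
  rw [hab, dysonMajorant]
  nlinarith [sq_nonneg (K * R * (1 / 2) ^ n - (2 * K * t) ^ n / n.factorial)]

end RelaxationEnhancement

/-! ### Sum of the Dyson series -/

namespace RelaxationEnhancement

variable {H : Type*} [NormedAddCommGroup H] [InnerProductSpace ℂ H]
variable {e : HilbertBasis ℕ ℂ H} {lam : ℕ → ℝ} {T : ℝ → H → H} {C : ℝ}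

section DysonSum

variable (e lam T) in
/-- The sum of the Dyson series. -/
noncomputable def dysonSum (x : H) (t : ℝ) : H := ∑' n, dyson e lam T x n t

/-- The sum of the majorants of all Dyson terms but the first. -/
noncomputable def dysonTail (C : ℝ) (x : H) (τ : ℝ) : ℝ :=
  ∑' n, dysonMajorant (C ^ 2 / 2) (‖x‖ ^ 2 / 2) τ n

variable (hT : IsSymmField e lam T C) (hmono : Monotone lam)
  (hmeas : ∀ j, AEStronglyMeasurable (fun s => T s (e j)) volume) (x : H)

include hT hmono hmeas

theorem norm_sub_proj_dyson_le (N : ℕ) {t τ : ℝ} (ht : 0 ≤ t) (hτ : t ≤ τ) (n : ℕ) :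
    ‖dyson e lam T x (n + 1) t - proj e N (dyson e lam T x (n + 1) t)‖ ≤
      dysonMajorant (C ^ 2 / 2) (‖x‖ ^ 2 / 2) τ n / √(lam N) := by
  obtain ⟨h1, h2⟩ := norm1_dyson_succ_le hT hmono hmeas x n ht hτ
  exact (norm_sub_proj_le_norm1 hT.pos hmono h1 N).trans
    (div_le_div_of_nonneg_right h2 (Real.sqrt_nonneg _))

theorem norm_dyson_succ_le {t τ : ℝ} (ht : 0 ≤ t) (hτ : t ≤ τ) (n : ℕ) :
    ‖dyson e lam T x (n + 1) t‖ ≤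
      dysonMajorant (C ^ 2 / 2) (‖x‖ ^ 2 / 2) τ n / √(lam 0) := by
  simpa [proj] using norm_sub_proj_dyson_le hT hmono hmeas x 0 ht hτ n

variable [CompleteSpace H]

theorem summable_dyson {t : ℝ} (ht : 0 ≤ t) : Summable fun n => dyson e lam T x n t := by
  rw [← summable_nat_add_iff 1]
  exact Summable.of_norm_bounded ((summable_dysonMajorant _ _ t).div_const _)
    fun n => norm_dyson_succ_le hT hmono hmeas x ht le_rfl n

theorem hasSum_repr_dyson {t : ℝ} (ht : 0 ≤ t) (j : ℕ) :
    HasSum (fun n => e.repr (dyson e lam T x n t) j) (e.repr (dysonSum e lam T x t) j) := by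
  have := (innerSL ℂ (e j)).hasSum (summable_dyson hT hmono hmeas x ht).hasSum
  simpa [e.repr_apply_apply, dysonSum] using this

/-- The bound is uniform for `t ∈ [0,τ]`, so the truncations converge uniformly there. The heat term
is treated separately because its `H¹` norm may blow up at `t = 0`. -/
theorem norm_sub_proj_dysonSum_le (N : ℕ) {t τ : ℝ} (ht : 0 ≤ t) (hτ : t ≤ τ) :
    ‖dysonSum e lam T x t - proj e N (dysonSum e lam T x t)‖ ≤
      ‖x - proj e N x‖ + dysonTail C x τ / √(lam N) := by
  have hs := (summable_dyson hT hmono hmeas x ht).hasSum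
  have h1 : HasSum (fun n => dyson e lam T x n t - proj e N (dyson e lam T x n t))
      (dysonSum e lam T x t - proj e N (dysonSum e lam T x t)) := hs.sub ((proj e N).hasSum hs)
  rw [← hasSum_nat_add_iff' 1] at h1
  have h2 := tsum_of_norm_bounded
    ((summable_dysonMajorant (C ^ 2 / 2) (‖x‖ ^ 2 / 2) τ).hasSum.div_const (√(lam N)))
    fun n => norm_sub_proj_dyson_le hT hmono hmeas x N ht hτ n
  rw [h1.tsum_eq, Finset.sum_range_one] at h2
  have h3 := norm_sub_proj_heat_le (e := e) hT.pos x ht N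
  have h4 := norm_add_le (dysonSum e lam T x t - proj e N (dysonSum e lam T x t) -
    (heat e lam x t - proj e N (heat e lam x t))) (heat e lam x t - proj e N (heat e lam x t))
  rw [sub_add_cancel] at h4
  refine h4.trans ?_
  rw [add_comm]
  exact add_le_add h3 h2

/-- The series is summed after applying `Γ^{1/2}` termwise; the resulting vector certifies
membership and the bound. -/
theorem memH1_dysonSum {t τ : ℝ} (ht : 0 < t) (hτ : t ≤ τ) :
    MemH1 e lam (dysonSum e lam T x t) ∧ norm1 e lam (dysonSum e lam T x t) ≤
      norm1 e lam (heat e lam x t) + dysonTail C x τ := by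
  have hmem : ∀ n, MemH1 e lam (dyson e lam T x n t) := fun n =>
    (dysonBound_dyson hT hmono hmeas x n).memH1 t ht
  have hb : ∀ n, ‖sqrtGen e lam (dyson e lam T x (n + 1) t)‖ ≤
      dysonMajorant (C ^ 2 / 2) (‖x‖ ^ 2 / 2) τ n := fun n => by
    rw [norm_sqrtGen hT.pos (hmem _)]
    exact (norm1_dyson_succ_le hT hmono hmeas x n ht.le hτ).2
  have hs : Summable fun n => sqrtGen e lam (dyson e lam T x n t) := by
    rw [← summable_nat_add_iff 1]
    exact Summable.of_norm_bounded (summable_dysonMajorant _ _ τ) hb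
  set z := ∑' n, sqrtGen e lam (dyson e lam T x n t) with hz
  have hrepr : ∀ j, e.repr z j = (√(lam j) : ℂ) * e.repr (dysonSum e lam T x t) j := by
    intro j
    have h1 := (innerSL ℂ (e j)).hasSum hs.hasSum
    simp only [innerSL_apply_apply, ← e.repr_apply_apply, repr_sqrtGen hT.pos (hmem _)] at h1
    exact h1.unique ((hasSum_repr_dyson hT hmono hmeas x ht.le j).mul_left _)
  obtain ⟨h1, h2⟩ := memH1_of_repr hT.pos hrepr
  refine ⟨h1, ?_⟩
  rw [h2, hz, hs.tsum_eq_zero_add]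
  refine (norm_add_le _ _).trans (add_le_add ?_ ?_)
  · rw [norm_sqrtGen hT.pos (hmem 0)]; rfl
  · exact tsum_of_norm_bounded (summable_dysonMajorant _ _ τ).hasSum hb

theorem locSqIntegrable_dysonSum :
    (∀ t, IntegrableOn (fun s => norm1 e lam (dysonSum e lam T x s) ^ 2) (Ioc 0 t)) ∧
      LocSqIntegrable fun s => Complex.I • T s (dysonSum e lam T x s) := by
  have hv : ∀ j, AEStronglyMeasurable (fun s => e.repr (dysonSum e lam T x s) j)
      (volume.restrict (Ioi 0)) := by
    intro j
    refine aestronglyMeasurable_of_tendsto_ae atTop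
      (f := fun N s => ∑ n ∈ Finset.range N, e.repr (dyson e lam T x n s) j)
      (fun N => Finset.aestronglyMeasurable_fun_sum _ fun n _ =>
        (dysonBound_dyson hT hmono hmeas x n).measurable j) ?_
    filter_upwards [ae_restrict_mem measurableSet_Ioi] with s hs
    exact (hasSum_repr_dyson hT hmono hmeas x (le_of_lt hs) j).tendsto_sum_nat
  have hmem : ∀ s, 0 < s → MemH1 e lam (dysonSum e lam T x s) := fun s hs =>
    (memH1_dysonSum hT hmono hmeas x hs le_rfl).1
  have hint : ∀ t, IntegrableOn (fun s => norm1 e lam (dysonSum e lam T x s) ^ 2) (Ioc 0 t) := by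
    intro t
    refine Integrable.mono' (g := fun s => 2 * norm1 e lam (heat e lam x s) ^ 2 +
        2 * dysonTail C x t ^ 2)
      (((integral_norm1_heat_le hT.pos x t).1.const_mul 2).add (integrable_const _))
      ((aestronglyMeasurable_norm1 hT.pos (fun j =>
        (hv j).mono_measure (Measure.restrict_mono Ioc_subset_Ioi_self le_rfl)) ?_).pow 2) ?_
    · filter_upwards [ae_restrict_mem measurableSet_Ioc] with s hs using hmem s hs.1
    · filter_upwards [ae_restrict_mem measurableSet_Ioc] with s hs
      rw [Real.norm_of_nonneg (sq_nonneg _)]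
      have h := pow_le_pow_left₀ (norm1_nonneg _)
        (memH1_dysonSum hT hmono hmeas x hs.1 hs.2).2 2
      nlinarith [sq_nonneg (norm1 e lam (heat e lam x s) - dysonTail C x t)]
  exact ⟨hint, (hT.locSqIntegrable hmeas hv hmem hint).1⟩

/-- The Dyson series solves the Duhamel equation. -/
theorem repr_dysonSum {t : ℝ} (ht : 0 ≤ t) (j : ℕ) :
    e.repr (dysonSum e lam T x t) j = (Real.exp (-(lam j * t)) : ℂ) * (e.repr x j +
      ∫ s in (0 : ℝ)..t, (Real.exp (lam j * s) : ℂ) *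
        e.repr (Complex.I • T s (dysonSum e lam T x s)) j) := by
  have h1 := hasSum_repr_dyson hT hmono hmeas x ht j
  rw [← hasSum_nat_add_iff' 1, Finset.sum_range_one] at h1
  -- A majorant in `H`: contractivity for the heat term, and division by `√λ₀` to pass from the `H¹`
  -- norm to the `H` norm for the others.
  let γ : ℕ → ℝ := fun n => Nat.casesOn n ‖x‖ fun n =>
    dysonMajorant (C ^ 2 / 2) (‖x‖ ^ 2 / 2) t n / √(lam 0)
  have hγ : Summable γ := by
    rw [← summable_nat_add_iff 1]
    exact (summable_dysonMajorant _ _ t).div_const _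
  have hvγ : ∀ n s, 0 ≤ s → s ≤ t → ‖dyson e lam T x n s‖ ≤ γ n := by
    intro n s hs hst
    cases n with
    | zero => exact norm_heat_le hT.pos x hs
    | succ n => exact norm_dyson_succ_le hT hmono hmeas x hs hst n
  have hsource := fun n => (hT.locSqIntegrable hmeas
    (dysonBound_dyson hT hmono hmeas x n).measurable (dysonBound_dyson hT hmono hmeas x n).memH1
    (dysonBound_dyson hT hmono hmeas x n).integrable).1
  -- Symmetry moves the unbounded `T s` onto the basis vector, so convergence of the series in `H`
  -- suffices to pass to the limit under the integral.
  have hD : ∀ s, 0 < s → ∀ y, MemH1 e lam y → e.repr (Complex.I • T s y) j =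
      Complex.I * inner ℂ (T s (e j)) y := by
    intro s _ y hy
    rw [map_smul, lp.coeFn_smul, Pi.smul_apply, smul_eq_mul, hT.repr_apply hy]
  have h2 := intervalIntegral.hasSum_integral_of_dominated_convergence (μ := volume) (a := 0)
    (b := t) (F := fun n s => (Real.exp (lam j * s) : ℂ) *
      e.repr (Complex.I • T s (dyson e lam T x n s)) j)
    (f := fun s => (Real.exp (lam j * s) : ℂ) *
        e.repr (Complex.I • T s (dysonSum e lam T x s)) j)
    (fun n _ => Real.exp (lam j * t) * (C * norm1 e lam (e j) * γ n))
    (fun n => by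
      rw [uIoc_of_le ht]
      have := ((hsource n).measurable_Ioc t).repr (e := e) j
      exact AEStronglyMeasurable.mul (Continuous.aestronglyMeasurable (by fun_prop)) this)
    (fun n => ae_of_all _ fun s hs => by
      rw [uIoc_of_le ht] at hs
      rw [hD s hs.1 _ ((dysonBound_dyson hT hmono hmeas x n).memH1 s hs.1), norm_mul, norm_mul,
        Complex.norm_I, one_mul, Complex.norm_real, Real.norm_of_nonneg (Real.exp_nonneg _)]
      refine mul_le_mul (Real.exp_le_exp.2 (mul_le_mul_of_nonneg_left hs.2 (hT.pos j).le))
        ((norm_inner_le_norm _ _).trans (mul_le_mul (hT.bound s _ (memH1_basis j))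
          (hvγ n s hs.1.le hs.2) (norm_nonneg _) (mul_nonneg hT.nonneg (norm1_nonneg _))))
        (norm_nonneg _) (Real.exp_nonneg _))
    (ae_of_all _ fun s _ => (hγ.mul_left _).mul_left _)
    intervalIntegrable_const
    (ae_of_all _ fun s hs => by
      rw [uIoc_of_le ht] at hs
      rw [hD s hs.1 _ (memH1_dysonSum hT hmono hmeas x hs.1 le_rfl).1]
      simp only [hD s hs.1 _ ((dysonBound_dyson hT hmono hmeas x _).memH1 s hs.1)]
      have := (innerSL ℂ (T s (e j))).hasSum (summable_dyson hT hmono hmeas x hs.1.le).hasSum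
      exact (this.mul_left _).mul_left _)
  have h3 := h2.mul_left (Real.exp (-(lam j * t)) : ℂ)
  have h4 : (fun n => e.repr (dyson e lam T x (n + 1) t) j) = fun n =>
      (Real.exp (-(lam j * t)) : ℂ) * ∫ s in (0 : ℝ)..t, (Real.exp (lam j * s) : ℂ) *
        e.repr (Complex.I • T s (dyson e lam T x n s)) j := by
    ext n
    exact (duhamel_spec hT.pos hmono (hsource n) ht).1 j
  rw [h4] at h1
  have h5 := h1.unique h3
  have h6 : e.repr (dyson e lam T x 0 t) j = (Real.exp (-(lam j * t)) : ℂ) * e.repr x j :=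
    repr_heat hT.pos x ht j
  rw [h6] at h5
  rw [mul_add, ← h5]
  ring

theorem dysonSum_equation (j : ℕ) {t : ℝ} (ht : 0 ≤ t) :
    IntervalIntegrable (coordVel e lam T 1 (dysonSum e lam T x) j) volume 0 t ∧
      e.repr (dysonSum e lam T x t) j =
        e.repr x j + ∫ s in (0 : ℝ)..t, coordVel e lam T 1 (dysonSum e lam T x) j s := by
  have hf := (locSqIntegrable_dysonSum hT hmono hmeas x).2
  set φ := dysonSum e lam T x
  set g : ℝ → ℂ := fun s => e.repr (Complex.I • T s (φ s)) j with hg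
  have hgi : IntervalIntegrable g volume 0 t := (hf.repr_intervalIntegrable j ht).1
  have hGi : IntervalIntegrable (fun s => (Real.exp (lam j * s) : ℂ) * g s) volume 0 t :=
    hgi.continuousOn_mul (by fun_prop)
  set v : ℝ → ℂ := fun s => e.repr x j + ∫ r in (0 : ℝ)..s, (Real.exp (lam j * r) : ℂ) * g r
    with hv
  have hvc : ContinuousOn v (uIcc 0 t) :=
    ((absolutelyContinuousOnInterval_integral hGi).continuousOn).const_add (e.repr x j)
  have hmild : ∀ s ∈ Icc 0 t, e.repr (φ s) j = (Real.exp (-(lam j * s)) : ℂ) * v s :=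
    fun s hs => repr_dysonSum hT hmono hmeas x hs.1 j
  have hφc : ContinuousOn (fun s => e.repr (φ s) j) (uIcc 0 t) := by
    refine ContinuousOn.congr (f := fun s => (Real.exp (-(lam j * s)) : ℂ) * v s)
      (ContinuousOn.mul (by fun_prop) hvc) ?_
    rw [uIcc_of_le ht]
    exact hmild
  have hvel : coordVel e lam T 1 φ j = fun s => g s - (lam j : ℂ) * e.repr (φ s) j := by
    ext s
    simp only [coordVel, hg, map_smul, lp.coeFn_smul, Pi.smul_apply, smul_eq_mul,
      Complex.ofReal_one, one_mul]
  have hveli : IntervalIntegrable (coordVel e lam T 1 φ j) volume 0 t := by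
    rw [hvel]
    exact hgi.sub (hφc.intervalIntegrable.const_mul _)
  refine ⟨hveli, ?_⟩
  have hexp : ∀ s : ℝ, HasDerivAt (fun s : ℝ => (Real.exp (-(lam j * s)) : ℂ))
      (-(lam j : ℂ) * (Real.exp (-(lam j * s)) : ℂ)) s := by
    intro s
    have h1 : HasDerivAt (fun s => -(lam j * s)) (-lam j) s := by
      simpa [neg_mul] using (hasDerivAt_id s).const_mul (-lam j)
    have := h1.exp.ofReal_comp
    refine this.congr_deriv ?_
    push_cast
    ring
  have hexpi : ∀ a b : ℝ, IntervalIntegrable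
      (fun s : ℝ => -(lam j : ℂ) * (Real.exp (-(lam j * s)) : ℂ)) volume a b := fun a b =>
    Continuous.intervalIntegrable (by fun_prop) _ _
  -- The mild formula is the product of `exp(-λs)` and the primitive `v`; the product rule recovers
  -- the differential form of the equation.
  have hprod := mul_sub_mul_eq_integral ht (hexpi 0 t) hGi
    (u := fun s : ℝ => (Real.exp (-(lam j * s)) : ℂ)) (v := v)
    (fun s _ => by
      rw [intervalIntegral.integral_eq_sub_of_hasDerivAt (fun r _ => hexp r) (hexpi 0 s)]
      ring)
    (fun s _ => by simp [hv])
  have hv0 : v 0 = e.repr x j := by simp [hv]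
  rw [← hmild t (right_mem_Icc.2 ht), hv0, mul_zero, neg_zero, Real.exp_zero, Complex.ofReal_one,
    one_mul, sub_eq_iff_eq_add'] at hprod
  rw [hprod]
  congr 1
  refine intervalIntegral.integral_congr fun s hs => ?_
  rw [uIcc_of_le ht] at hs
  rw [hvel]
  simp only
  rw [hmild s hs, ← mul_assoc (Real.exp (-(lam j * s)) : ℂ), ← Complex.ofReal_mul, ← Real.exp_add,
    neg_add_cancel, Real.exp_zero, Complex.ofReal_one, one_mul]
  ring

theorem continuousOn_dysonSum (htend : Tendsto lam atTop atTop) :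
    ContinuousOn (dysonSum e lam T x) (Ici 0) := by
  have hτ : ∀ τ, 0 ≤ τ → ContinuousOn (dysonSum e lam T x) (Icc 0 τ) := by
    intro τ hτ0
    have hlim : Tendsto (fun N => ‖x - proj e N x‖ + dysonTail C x τ / √(lam N)) atTop (𝓝 0) := by
      have h1 : Tendsto (fun N => ‖x - proj e N x‖) atTop (𝓝 0) := by
        have := (tendsto_const_nhds (x := x)).sub (tendsto_proj e x)
        rw [sub_self] at this
        exact tendsto_zero_iff_norm_tendsto_zero.1 this
      have h2 : Tendsto (fun N => dysonTail C x τ / √(lam N)) atTop (𝓝 0) :=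
        Tendsto.div_atTop tendsto_const_nhds (Real.tendsto_sqrt_atTop.comp htend)
      simpa using h1.add h2
    have hunif : TendstoUniformlyOn (fun N t => proj e N (dysonSum e lam T x t))
        (dysonSum e lam T x) atTop (Icc 0 τ) := by
      rw [Metric.tendstoUniformlyOn_iff]
      intro ε hε
      filter_upwards [hlim.eventually_lt_const hε] with N hN t ht
      rw [dist_eq_norm]
      exact (norm_sub_proj_dysonSum_le hT hmono hmeas x N ht.1 ht.2).trans_lt hN
    refine hunif.continuousOn (Frequently.of_forall fun N => ?_)
    simp only [proj_apply]
    refine continuousOn_finsetSum _ fun j _ => ContinuousOn.smul ?_ continuousOn_const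
    have := (absolutelyContinuousOnInterval_integral
      (dysonSum_equation hT hmono hmeas x j hτ0).1).continuousOn
    rw [uIcc_of_le hτ0] at this
    exact (this.const_add (e.repr x j)).congr fun t ht =>
      (dysonSum_equation hT hmono hmeas x j ht.1).2
  intro t ht
  have ht0 : 0 ≤ t := ht
  refine (hτ (t + 1) (by linarith) t ⟨ht0, by linarith⟩).mono_of_mem_nhdsWithin ?_
  filter_upwards [self_mem_nhdsWithin, mem_nhdsWithin_of_mem_nhds (Iio_mem_nhds (lt_add_one t))]
    with s h1 h2 using ⟨h1, h2.le⟩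

theorem dysonSum_zero : dysonSum e lam T x 0 = x :=
  ext_repr e fun j => by simpa using (dysonSum_equation hT hmono hmeas x j le_rfl).2

end DysonSum

end RelaxationEnhancement

/-! ### From coordinates to the weak equation, and existence -/

namespace RelaxationEnhancement

variable {H : Type*} [NormedAddCommGroup H] [InnerProductSpace ℂ H]
variable {e : HilbertBasis ℕ ℂ H} {lam : ℕ → ℝ} {U : ℝ → H ≃ₗᵢ[ℂ] H} {L : ℝ → H →ₗ.[ℂ] H}

section WeakFormulation

variable {T : ℝ → H → H} {x χ χ' : H} {φ : ℝ → H}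

theorem inner_proj_eq_sum (N : ℕ) (x y : H) :
    inner ℂ (proj e N x) y =
      ∑ j ∈ Finset.range N, (starRingEnd ℂ) (e.repr x j) * e.repr y j := by
  simp [proj_apply, e.repr_apply_apply, mul_comm]

theorem sum_coordVel_eq (hχ : ∀ j, e.repr χ' j = lam j * e.repr χ j) (N : ℕ) (s : ℝ) :
    ∑ j ∈ Finset.range N, (starRingEnd ℂ) (e.repr χ j) * coordVel e lam T 1 φ j s =
      inner ℂ (proj e N χ) (Complex.I • T s (φ s)) - inner ℂ (proj e N χ') (φ s) := by
  rw [inner_smul_right, inner_proj_eq_sum, inner_proj_eq_sum, Finset.mul_sum,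
    ← Finset.sum_sub_distrib]
  refine Finset.sum_congr rfl fun j _ => ?_
  rw [hχ, map_mul, Complex.conj_ofReal, coordVel]
  push_cast
  ring

/-- Coordinatewise equations imply the weak equation tested against any `χ` in the domain of the
generator, `χ'` being the image of `χ`. -/
theorem weak_equation_of_coord (hχ : ∀ j, e.repr χ' j = lam j * e.repr χ j) {t : ℝ} (ht : 0 ≤ t)
    (hcont : ContinuousOn φ (Ici 0)) (hf : LocSqIntegrable fun s => Complex.I • T s (φ s))
    (hcoord : ∀ j, IntervalIntegrable (coordVel e lam T 1 φ j) volume 0 t ∧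
      e.repr (φ t) j = e.repr x j + ∫ s in (0 : ℝ)..t, coordVel e lam T 1 φ j s) :
    IntervalIntegrable (fun s => inner ℂ χ (Complex.I • T s (φ s)) - inner ℂ χ' (φ s)) volume 0 t ∧
      inner ℂ χ (φ t) = inner ℂ χ x +
        ∫ s in (0 : ℝ)..t, (inner ℂ χ (Complex.I • T s (φ s)) - inner ℂ χ' (φ s)) := by
  obtain ⟨M, hM⟩ := (isCompact_Icc (a := (0 : ℝ)) (b := t)).exists_bound_of_continuousOn
    (hcont.mono fun s hs => hs.1)
  have hφm : AEStronglyMeasurable φ (volume.restrict (Ioc 0 t)) :=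
    (hcont.mono fun s hs => (hs.1.le : (0 : ℝ) ≤ s)).aestronglyMeasurable measurableSet_Ioc
  set bound : ℝ → ℝ := fun s => ‖χ‖ * (1 + ‖Complex.I • T s (φ s)‖ ^ 2) + ‖χ'‖ * M with hbound
  have hbi : IntervalIntegrable bound volume 0 t :=
    (intervalIntegrable_iff_integrableOn_Ioc_of_le ht).2
      ((((integrable_const 1).add (hf.integrable t)).const_mul _).add (integrable_const _))
  have hmeas : ∀ y y' : H, AEStronglyMeasurable
      (fun s => inner ℂ y (Complex.I • T s (φ s)) - inner ℂ y' (φ s))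
      (volume.restrict (Ioc 0 t)) := fun y y' =>
    (aestronglyMeasurable_const.inner (hf.measurable_Ioc t)).sub
      (aestronglyMeasurable_const.inner hφm)
  have hle : ∀ y y' : H, ‖y‖ ≤ ‖χ‖ → ‖y'‖ ≤ ‖χ'‖ → ∀ s ∈ Ioc 0 t,
      ‖inner ℂ y (Complex.I • T s (φ s)) - inner ℂ y' (φ s)‖ ≤ bound s := by
    intro y y' hy hy' s hs
    refine (norm_sub_le _ _).trans (add_le_add ((norm_inner_le_norm _ _).trans ?_)
      ((norm_inner_le_norm _ _).trans ?_))
    · refine mul_le_mul hy ?_ (norm_nonneg _) (norm_nonneg _)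
      nlinarith [sq_nonneg (‖Complex.I • T s (φ s)‖ - 1)]
    · exact mul_le_mul hy' (hM s ⟨hs.1.le, hs.2⟩) (norm_nonneg _) (norm_nonneg _)
  have hI : IntervalIntegrable
      (fun s => inner ℂ χ (Complex.I • T s (φ s)) - inner ℂ χ' (φ s)) volume 0 t := by
    refine hbi.mono_fun' (by rw [uIoc_of_le ht]; exact hmeas _ _) ?_
    rw [uIoc_of_le ht]
    filter_upwards [ae_restrict_mem measurableSet_Ioc] with s hs using hle _ _ le_rfl le_rfl s hs
  refine ⟨hI, ?_⟩
  -- Truncating the test vector makes the weak equation a finite combination of coordinate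
  -- equations. Since `χ` and `χ'` are truncated together, both terms converge under a single
  -- dominating function.
  have hpart : ∀ N, inner ℂ (proj e N χ) (φ t) = inner ℂ (proj e N χ) x + ∫ s in (0 : ℝ)..t,
      (inner ℂ (proj e N χ) (Complex.I • T s (φ s)) - inner ℂ (proj e N χ') (φ s)) := by
    intro N
    simp_rw [← sum_coordVel_eq hχ]
    rw [intervalIntegral.integral_finsetSum fun j _ => (hcoord j).1.const_mul _, inner_proj_eq_sum,
      inner_proj_eq_sum, ← Finset.sum_add_distrib]
    refine Finset.sum_congr rfl fun j _ => ?_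
    rw [intervalIntegral.integral_const_mul, (hcoord j).2, mul_add]
  have hlim : ∀ y z : H, Tendsto (fun N => inner ℂ (proj e N y) z) atTop (𝓝 (inner ℂ y z)) :=
    fun y z => (tendsto_proj (e := e) y).inner tendsto_const_nhds
  refine tendsto_nhds_unique (hlim χ (φ t)) ?_
  simp_rw [hpart]
  refine (hlim χ x).add (intervalIntegral.tendsto_integral_filter_of_dominated_convergence bound
    (Eventually.of_forall fun N => by rw [uIoc_of_le ht]; exact hmeas _ _)
    (Eventually.of_forall fun N => ae_of_all _ fun s hs => ?_) hbi
    (ae_of_all _ fun s _ => (hlim _ _).sub (hlim _ _)))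
  rw [uIoc_of_le ht] at hs
  exact hle _ _ (norm_proj_le e N χ) (norm_proj_le e N χ') s hs

end WeakFormulation

/-- For `A ≠ 0` the scaling `s ↦ A s` preserves null sets, so almost-everywhere measurability
survives the change of time. -/
theorem Generates.aestronglyMeasurable_driftField (hU : Generates e lam L U) {A : ℝ} (hA : A ≠ 0)
    {χ : H} (hχ : MemH1 e lam χ) :
    AEStronglyMeasurable (fun s => driftField L A s χ) volume := by
  refine AEStronglyMeasurable.const_smul ?_ _
  refine (hU.aestronglyMeasurable_opApply hχ).comp_quasiMeasurePreserving
    (f := fun s : ℝ => A * s) ⟨by fun_prop, ?_⟩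
  rw [Real.map_volume_mul_left hA]
  exact Measure.smul_absolutelyContinuous

theorem exists_isSolution [CompleteSpace H] {Γ : H →ₗ.[ℂ] H} (hΓ : IsSelfAdjoint Γ)
    (he : IsEigenbasis Γ e lam) (hL : ∀ t, IsSelfAdjoint (L t)) (hU : Generates e lam L U)
    (h1 : Condition1 e lam L) {A : ℝ} (hA : A ≠ 0) (x : H) :
    ∃ φ : ℝ → H, IsSolution Γ e lam L A x φ := by
  obtain ⟨C, hT⟩ := exists_isSymmField he.lam_pos hL h1 A
  have hmeas : ∀ j, AEStronglyMeasurable (fun s => driftField L A s (e j)) volume := fun j =>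
    hU.aestronglyMeasurable_driftField hA (memH1_basis j)
  have hcont := continuousOn_dysonSum hT he.mono hmeas x he.tendsto
  have hsq := locSqIntegrable_dysonSum hT he.mono hmeas x
  have hinner : ∀ (χ : H) (s : ℝ) (y : H), inner ℂ χ (Complex.I • driftField L A s y) =
      Complex.I * (A : ℂ) * inner ℂ χ (opApply (L (A * s)) y) := fun χ s y => by
    rw [driftField, inner_smul_right, inner_smul_right, mul_assoc]
  have hweak := fun (χ : Γ.domain) (t : ℝ) (ht : 0 ≤ t) =>
    weak_equation_of_coord (he.repr_apply hΓ χ) ht hcont hsq.2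
      fun j => dysonSum_equation hT he.mono hmeas x j ht
  simp only [hinner] at hweak
  refine ⟨_, hcont, dysonSum_zero hT he.mono hmeas x, ?_, fun t _ => hsq.1 t,
    fun χ t ht => (hweak χ t ht).1, fun χ t ht => (hweak χ t ht).2⟩
  filter_upwards [ae_restrict_mem measurableSet_Ioi] with t ht using
    (memH1_dysonSum hT he.mono hmeas x ht le_rfl).1

end RelaxationEnhancement

theorem mainTheorem1 {H : Type*} [NormedAddCommGroup H] [InnerProductSpace ℂ H] [CompleteSpace H]
    (Γ : H →ₗ.[ℂ] H) (hΓ : IsSelfAdjoint Γ)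
    (e : HilbertBasis ℕ ℂ H) (lam : ℕ → ℝ)
    (he : RelaxationEnhancement.IsEigenbasis Γ e lam)
    (L : ℝ → H →ₗ.[ℂ] H) (hL : ∀ t : ℝ, IsSelfAdjoint (L t)) (hper : Function.Periodic L 1)
    (U : ℝ → H ≃ₗᵢ[ℂ] H) (hU : RelaxationEnhancement.Generates e lam L U)
    (h1 : RelaxationEnhancement.Condition1 e lam L)
    (h2 : RelaxationEnhancement.Condition2 e lam U) :
    RelaxationEnhancement.RelaxationEnhancing Γ e lam L ↔
      ¬ ∃ (μ : ℂ) (ψ : H), ψ ≠ 0 ∧ RelaxationEnhancement.MemH1 e lam ψ ∧ U 1 ψ = μ • ψ := by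
  constructor
  · rintro h ⟨μ, ψ, hψ0, hψ, hV⟩
    exact RelaxationEnhancement.not_relaxationEnhancing_of_eigenvector he hL hper hU h1 h2
      hψ0 hψ hV h
  · intro hV τ δ hτ hδ
    obtain ⟨A₀, hA₀, h⟩ :=
      RelaxationEnhancement.exists_forall_norm_lt he hL hper hU h1 h2 hV hτ hδ
    exact ⟨A₀, hA₀, fun A hA x hx =>
      ⟨RelaxationEnhancement.exists_isSolution hΓ he hL hU h1 (hA₀.trans hA).ne' x, h A hA x hx⟩⟩
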